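/- **Notation.** For a unital C*-algebra $A$ let $A_{sa}$ be its self-adjoint part and $S(A)$ its state space. A *Lip-norm* on $A$ is a seminorm $L$ defined on a dense subspace of $A_{sa}$ containing $1_A$ (and set equal to $\infty$ elsewhere on $A_{sa}$), lower semicontinuous for the norm, with $\{L=0\}=\mathbb R1_A$, and such that the Monge–Kantorovich metric $mk_L(\varphi,\psi)=\sup\{|\varphi(a)-\psi(a)| : L(a)\le 1\}$ metrizes the weak* topology of $S(A)$; $(A,L)$ is then a *compact quantum metric space*. It is *$2$-quasi-Leibniz* if $L\big(\tfrac{ab+ba}{2}\big)$ and $L\big(\tfrac{ab-ba}{2i}\big)$ are both at most $2\,(L(a)\|b\|+L(b)\|a\|)$ for all $a,b\in A_{sa}$. Let $QCQMS_2$ be the class of $2$-quasi-Leibniz compact quantum metric spaces. A *bridge* $\gamma$ from $A$ to $B$ consists of a unital C*-algebra $D$, unital injective *-homomorphisms $\pi_A:A\to D$, $\pi_B:B\to D$ and $\omega\in D$ such that $S_1(D|\omega)=\{\varphi\in S(D):\varphi((1-\omega)^*(1-\omega))=\varphi((1-\omega)(1-\omega)^*)=0\}$ is non-empty. The *length* of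 $\gamma$ for $L_A,L_B$ is the maximum of the Hausdorff distances $\mathrm{Haus}_{mk_{L_A}}(S(A),\pi_A^*S_1(D|\omega))$ and $\mathrm{Haus}_{mk_{L_B}}(S(B),\pi_B^*S_1(D|\omega))$ and of the Hausdorff distance between $\{L_A\le 1\}$ and $\{L_B\le 1\}$ for $(a,b)\mapsto\|\pi_A(a)\omega-\omega\pi_B(b)\|_D$. The *quantum propinquity* $\Lambda$ between two members of $QCQMS_2$ is the infimum, over all finite chains of bridges which join them through successive members of $QCQMS_2$, of the sum of the lengths of the bridges. Let $\mathcal N=(\mathbb N\setminus\{0\})^{\mathbb N}$ be the Baire space, with $d_{\mathcal N}(x,y)=2^{-\min\{m:x(m)\ne y(m)\}}$ for $x\neq y$. For $\beta\in\mathcal N$ put $\boxtimes\beta(n)=\prod_{j=0}^{n-1}(\beta(j)+1)$ (so $\boxtimes\beta(0)=1$), and let $\mathrm{UHF}(\beta)$ be the C*-inductive limit of the matrix algebras $M_{\boxtimes\beta(n)}(\mathbb C)$ under the maps $a\mapsto\mathrm{diag}(a,\dots,a)$ ($\beta(n)+1$ copies). Let $A_n\subseteq\mathrm{UHF}(\beta)$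 be the canonical image of $M_{\boxtimes\beta(n)}(\mathbb C)$, let $\tau(\beta)$ be the unique tracial state of $\mathrm{UHF}(\beta)$, which is faithful, and let $E_{\beta,n}:\mathrm{UHF}(\beta)\to A_n$ be the unique $\tau(\beta)$-preserving conditional expectation (contractive linear projection) onto $A_n$. **Theorem.** Let $(X,d_X)$ be a non-empty compact metric space. For $\beta\in\mathcal N$ and $f\in C(X,\mathrm{UHF}(\beta))_{sa}$ set $$L_\beta(f)=\sup_{x,y\in X}\frac{\|f(x)-f(y)\|}{d_X(x,y)}+\sup_{n\in\mathbb N}\ \boxtimes\beta(n)\,\sup_{x\in X}\|f(x)-E_{\beta,n}(f(x))\|\in[0,\infty]\qquad(\tfrac00=0),$$ let $\pi_\beta:C(X)\otimes\mathrm{UHF}(\beta)\to C(X,\mathrm{UHF}(\beta))$ be the canonical *-isomorphism, $\pi_\beta(f\otimes a)(x)=f(x)a$, and put $L_\beta^\otimes=L_\beta\circ\pi_\beta$. Then $(C(X)\otimes\mathrm{UHF}(\beta),L^\otimes_\beta)$ belongs to $QCQMS_2$ for each $\beta\in\mathcal N$, and the map $$\beta\in(\mathcal N,d_{\mathcal N})\longmapsto\big(C(X)\otimes\mathrm{UHF}(\beta),L^\otimes_\beta\big)\in(QCQMS_2,\Lambda)$$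 is $2$-Lipschitz: for all $\beta,\eta\in\mathcal N$, $$\Lambda\big((C(X)\otimes\mathrm{UHF}(\beta),L^\otimes_\beta),(C(X)\otimes\mathrm{UHF}(\eta),L^\otimes_\eta)\big)\le 2\,d_{\mathcal N}(\beta,\eta),$$ and thus it is continuous. The same holds with $(C(X,\mathrm{UHF}(\beta)),L_\beta)$ in place of $(C(X)\otimes\mathrm{UHF}(\beta),L^\otimes_\beta)$. -/

import Mathlib

open scoped ENNReal NNReal TensorProduct Topology ComplexOrder

universe u v

/-! ### C⋆-completions -/

/-- A C⋆-seminorm on a unital complex ⋆-algebra. -/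
structure CStarSeminorm (R : Type u) [Ring R] [Algebra ℂ R] [StarRing R] extends
    Seminorm ℂ R where
  mul_le' : ∀ x y, toFun (x * y) ≤ toFun x * toFun y
  star_mul_self' : ∀ x, toFun (star x * x) = toFun x ^ 2

namespace CStarSeminorm

section

variable {R : Type u} [Ring R] [Algebra ℂ R] [StarRing R] (p : CStarSeminorm R)

theorem le_star (x : R) : p.toSeminorm x ≤ p.toSeminorm (star x) := by
  have h1 : p.toSeminorm (star x * x) = p.toSeminorm x ^ 2 := p.star_mul_self' x
  have h2 : p.toSeminorm (star x * x) ≤ p.toSeminorm (star x) * p.toSeminorm x :=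
    p.mul_le' _ _
  have h3 := apply_nonneg p.toSeminorm x
  have h4 := apply_nonneg p.toSeminorm (star x)
  by_contra h
  push Not at h
  nlinarith

theorem star_eq (x : R) : p.toSeminorm (star x) = p.toSeminorm x :=
  le_antisymm (by simpa using p.le_star (star x)) (p.le_star x)

/-- The algebra `R` regarded as a seminormed algebra with the seminorm `p`. -/
def Carrier (_p : CStarSeminorm R) : Type u := R

instance : Ring p.Carrier := inferInstanceAs (Ring R)
instance : Algebra ℂ p.Carrier := inferInstanceAs (Algebra ℂ R)
instance : StarRing p.Carrier := inferInstanceAs (StarRing R)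
instance [StarModule ℂ R] : StarModule ℂ p.Carrier := inferInstanceAs (StarModule ℂ R)

noncomputable instance : SeminormedRing p.Carrier where
  __ := (inferInstance : Ring p.Carrier)
  __ := (AddGroupSeminorm.toSeminormedAddCommGroup
    (E := p.Carrier) p.toSeminorm.toAddGroupSeminorm)
  norm_mul_le := p.mul_le'

noncomputable instance : NormedAlgebra ℂ p.Carrier where
  norm_smul_le c x := le_of_eq (map_smul_eq_mul p.toSeminorm c x)

theorem norm_carrier (x : p.Carrier) : ‖x‖ = p.toSeminorm x := rfl

instance : NormedStarGroup p.Carrier where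
  norm_star_le x := le_of_eq (p.star_eq x)

/-- The C⋆-algebra obtained from `R` by completion with respect to the C⋆-seminorm `p`
(elements of seminorm zero are identified with zero). -/
def Completion : Type u := UniformSpace.Completion p.Carrier

noncomputable instance : NormedRing p.Completion :=
  inferInstanceAs (NormedRing (UniformSpace.Completion p.Carrier))

instance : CompleteSpace p.Completion :=
  inferInstanceAs (CompleteSpace (UniformSpace.Completion p.Carrier))

noncomputable instance : Algebra ℂ p.Completion :=
  inferInstanceAs (Algebra ℂ (UniformSpace.Completion p.Carrier))

noncomputable instance : NormedAlgebra ℂ p.Completion where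
  norm_smul_le := norm_smul_le (α := ℂ) (β := UniformSpace.Completion p.Carrier)

/-- The canonical map from `R` to its completion. -/
noncomputable def coe (x : R) : p.Completion :=
  UniformSpace.Completion.coe' (α := p.Carrier) x

theorem norm_coe (x : R) : ‖p.coe x‖ = p.toSeminorm x :=
  UniformSpace.Completion.norm_coe (E := p.Carrier) x

theorem denseRange_coe : DenseRange p.coe :=
  UniformSpace.Completion.denseRange_coe (α := p.Carrier)

theorem coe_add (x y : R) : p.coe (x + y) = p.coe x + p.coe y :=
  UniformSpace.Completion.coe_add (α := p.Carrier) x y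

theorem coe_mul (x y : R) : p.coe (x * y) = p.coe x * p.coe y :=
  UniformSpace.Completion.coe_mul (α := p.Carrier) x y

theorem coe_one : p.coe 1 = 1 :=
  UniformSpace.Completion.coe_one p.Carrier

theorem coe_zero : p.coe 0 = 0 :=
  UniformSpace.Completion.coe_zero (α := p.Carrier)

theorem coe_smul (c : ℂ) (x : R) : p.coe (c • x) = c • p.coe x :=
  UniformSpace.Completion.coe_smul (X := p.Carrier) c x

noncomputable instance : Star p.Completion where
  star := UniformSpace.Completion.map (α := p.Carrier) (β := p.Carrier) star

theorem continuous_star' : Continuous (star : p.Completion → p.Completion) :=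
  UniformSpace.Completion.continuous_map (α := p.Carrier) (β := p.Carrier)

theorem coe_star (x : R) : p.coe (star x) = star (p.coe x) :=
  (UniformSpace.Completion.map_coe (α := p.Carrier) (β := p.Carrier) (f := star)
    (starNormedAddGroupHom (E := p.Carrier)).uniformContinuous x).symm

noncomputable instance : StarRing p.Completion where
  star_involutive x := by
    refine p.denseRange_coe.induction_on (p := fun x => star (star x) = x) x
      (isClosed_eq (p.continuous_star'.comp p.continuous_star') continuous_id) fun a => ?_
    rw [← coe_star, ← coe_star, star_star]
  star_mul x y := by
    refine p.denseRange_coe.induction_on₂ (p := fun x y => star (x * y) = star y * star x)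
      (isClosed_eq (p.continuous_star'.comp continuous_mul)
        ((p.continuous_star'.comp continuous_snd).mul
          (p.continuous_star'.comp continuous_fst))) (fun a b => ?_) x y
    rw [← coe_mul, ← coe_star, star_mul, coe_mul, coe_star, coe_star]
  star_add x y := by
    refine p.denseRange_coe.induction_on₂ (p := fun x y => star (x + y) = star x + star y)
      (isClosed_eq (p.continuous_star'.comp continuous_add)
        ((p.continuous_star'.comp continuous_fst).add
          (p.continuous_star'.comp continuous_snd))) (fun a b => ?_) x y
    rw [← coe_add, ← coe_star, star_add, coe_add, coe_star, coe_star]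

instance : CStarRing p.Completion where
  norm_mul_self_le x := by
    refine p.denseRange_coe.induction_on (p := fun x => ‖x‖ * ‖x‖ ≤ ‖star x * x‖) x
      (isClosed_le (continuous_norm.mul continuous_norm)
        (continuous_norm.comp (p.continuous_star'.mul continuous_id))) fun a => ?_
    rw [← coe_star, ← coe_mul, norm_coe, norm_coe, ← sq]
    exact (p.star_mul_self' a).ge

instance [StarModule ℂ R] : StarModule ℂ p.Completion where
  star_smul c x := by
    refine p.denseRange_coe.induction_on (p := fun x => star (c • x) = star c • star x) x
      (isClosed_eq (p.continuous_star'.comp (continuous_const_smul c))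
        (p.continuous_star'.const_smul (star c))) fun a => ?_
    rw [← coe_smul, ← coe_star, star_smul, coe_smul, coe_star]

noncomputable instance [StarModule ℂ R] : CStarAlgebra p.Completion where

/-- The canonical unital ⋆-homomorphism from `R` to its completion. -/
noncomputable def coeHom [StarModule ℂ R] : R →⋆ₐ[ℂ] p.Completion where
  toFun := p.coe
  map_one' := p.coe_one
  map_mul' := p.coe_mul
  map_zero' := p.coe_zero
  map_add' := p.coe_add
  commutes' c := by
    rw [Algebra.algebraMap_eq_smul_one, coe_smul, coe_one, Algebra.algebraMap_eq_smul_one]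
  map_star' := p.coe_star

end

end CStarSeminorm

/-! ### The maximal C⋆-tensor product -/

namespace CStarSeminorm

section

variable {R : Type u} [Ring R] [Algebra ℂ R] [StarRing R]

/-- The zero C⋆-seminorm. -/
noncomputable instance : Inhabited (CStarSeminorm R) where
  default :=
    { (0 : Seminorm ℂ R) with
      mul_le' := fun _ _ => show (0 : ℝ) ≤ 0 * 0 by simp
      star_mul_self' := fun _ => show (0 : ℝ) = 0 ^ 2 by simp }

/-- The largest C⋆-seminorm on `R`, when the C⋆-seminorms are pointwise bounded. -/
noncomputable def sup
    (h : ∀ x : R, BddAbove (Set.range fun p : CStarSeminorm R => p.toSeminorm x)) :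
    CStarSeminorm R where
  toFun x := ⨆ p : CStarSeminorm R, p.toSeminorm x
  map_zero' := by simp
  add_le' x y := ciSup_le fun p => (map_add_le_add p.toSeminorm x y).trans
    (add_le_add (le_ciSup (h x) p) (le_ciSup (h y) p))
  neg' x := by simp
  smul' c x := by
    simp only [map_smul_eq_mul]
    exact (Real.mul_iSup_of_nonneg (norm_nonneg c) _).symm
  mul_le' x y := ciSup_le fun p => (p.mul_le' x y).trans
    (mul_le_mul (le_ciSup (h x) p) (le_ciSup (h y) p) (apply_nonneg p.toSeminorm y)
      (Real.iSup_nonneg fun q => apply_nonneg q.toSeminorm x))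
  star_mul_self' x := by
    have hx : 0 ≤ ⨆ p : CStarSeminorm R, p.toSeminorm x :=
      Real.iSup_nonneg fun q => apply_nonneg q.toSeminorm x
    apply le_antisymm
    · refine ciSup_le fun p => (p.star_mul_self' x).le.trans ?_
      exact pow_le_pow_left₀ (apply_nonneg p.toSeminorm x) (le_ciSup (h x) p) 2
    · have hy : 0 ≤ ⨆ p : CStarSeminorm R, p.toSeminorm (star x * x) :=
        Real.iSup_nonneg fun q => apply_nonneg q.toSeminorm _
      rw [← Real.le_sqrt hx hy]
      refine ciSup_le fun p => Real.le_sqrt_of_sq_le ?_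
      exact (p.star_mul_self' x).ge.trans (le_ciSup (h (star x * x)) p)

end

end CStarSeminorm

section Tensor

variable {A : Type u} {B : Type v} [CStarAlgebra A] [CStarAlgebra B]

theorem CStarSeminorm.tmul_le (p : CStarSeminorm (A ⊗[ℂ] B)) (a : A) (b : B) :
    p.toSeminorm (a ⊗ₜ[ℂ] b) ≤ ‖a‖ * ‖b‖ := by
  let i : A →⋆ₐ[ℂ] (A ⊗[ℂ] B) :=
    { (Algebra.TensorProduct.includeLeft : A →ₐ[ℂ] A ⊗[ℂ] B) with
      map_star' := fun x => by simp }
  let j : B →⋆ₐ[ℂ] (A ⊗[ℂ] B) :=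
    { (Algebra.TensorProduct.includeRight : B →ₐ[ℂ] A ⊗[ℂ] B) with
      map_star' := fun x => by simp }
  have hi : p.toSeminorm (a ⊗ₜ[ℂ] 1) ≤ ‖a‖ := by
    rw [← p.norm_coe]
    exact NonUnitalStarAlgHom.norm_apply_le (p.coeHom.comp i) a
  have hj : p.toSeminorm (1 ⊗ₜ[ℂ] b) ≤ ‖b‖ := by
    rw [← p.norm_coe]
    exact NonUnitalStarAlgHom.norm_apply_le (p.coeHom.comp j) b
  have hab : a ⊗ₜ[ℂ] b = (a ⊗ₜ[ℂ] (1 : B)) * ((1 : A) ⊗ₜ[ℂ] b) := by simp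
  rw [hab]
  exact (p.mul_le' _ _).trans
    (mul_le_mul hi hj (apply_nonneg p.toSeminorm _) (norm_nonneg a))

theorem CStarSeminorm.bddAbove_tensor (t : A ⊗[ℂ] B) :
    BddAbove (Set.range fun p : CStarSeminorm (A ⊗[ℂ] B) => p.toSeminorm t) := by
  induction t using TensorProduct.induction_on with
  | zero => exact ⟨0, by rintro _ ⟨p, rfl⟩; simp⟩
  | tmul a b => exact ⟨‖a‖ * ‖b‖, by rintro _ ⟨p, rfl⟩; exact p.tmul_le a b⟩
  | add x y hx hy =>
    obtain ⟨c, hc⟩ := hx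
    obtain ⟨d, hd⟩ := hy
    refine ⟨c + d, ?_⟩
    rintro _ ⟨p, rfl⟩
    exact (map_add_le_add p.toSeminorm x y).trans
      (add_le_add (hc ⟨p, rfl⟩) (hd ⟨p, rfl⟩))

variable (A B) in
/-- The C⋆-tensor product `A ⊗ B`: the completion of the algebraic tensor product over `ℂ` for its
largest C⋆-norm. When `A` or `B` is nuclear (for instance commutative), this is the completion for
the only C⋆-norm of the algebraic tensor product. -/
abbrev CStarTensor : Type (max u v) :=
  (CStarSeminorm.sup (CStarSeminorm.bddAbove_tensor (A := A) (B := B))).Completion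

/-- The elementary tensor `a ⊗ b` in the C⋆-tensor product. -/
noncomputable def CStarTensor.tmul (a : A) (b : B) : CStarTensor A B :=
  CStarSeminorm.coe _ (a ⊗ₜ[ℂ] b)

end Tensor

/-! ### The Baire space -/

/-- The set of sequences of positive integers. -/
def BaireSeq : Type := ℕ → ℕ+

/-- The metric `2 ^ (-min {m | x m ≠ y m})` of the Baire space. -/
noncomputable instance : MetricSpace BaireSeq where
  dist x y := open Classical in
    if x = y then 0 else ((2 : ℝ) ^ sInf {m : ℕ | x m ≠ y m})⁻¹
  dist_self x := by simp
  dist_comm x y := by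
    by_cases h : x = y
    · simp [h]
    · simp [h, Ne.symm h, fun m => @eq_comm _ (x m) (y m)]
  dist_triangle x y z := by
    classical
    have nn : ∀ a b : BaireSeq,
        0 ≤ (if a = b then 0 else ((2 : ℝ) ^ sInf {m : ℕ | a m ≠ b m})⁻¹) := by
      intro a b; split_ifs <;> positivity
    by_cases hxz : x = z
    · rw [if_pos hxz]; exact add_nonneg (nn x y) (nn y z)
    have hne : {m : ℕ | x m ≠ z m}.Nonempty := Function.ne_iff.mp hxz
    have hs := Nat.sInf_mem hne
    rw [if_neg hxz]
    set N := sInf {m : ℕ | x m ≠ z m}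
    have key : ∀ a b : BaireSeq, a N ≠ b N → ((2 : ℝ) ^ N)⁻¹ ≤
        (if a = b then 0 else ((2 : ℝ) ^ sInf {m : ℕ | a m ≠ b m})⁻¹) := by
      intro a b hab
      have : a ≠ b := fun h => hab (by rw [h])
      rw [if_neg this]
      have hle : sInf {m : ℕ | a m ≠ b m} ≤ N := Nat.sInf_le hab
      gcongr
      norm_num
    by_cases hy : x N = y N
    · have : y N ≠ z N := by rw [← hy]; exact hs
      linarith [key y z this, nn x y]
    · linarith [key x y hy, nn y z]
  eq_of_dist_eq_zero {x y} h := by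
    classical
    by_contra hxy
    have h' : (if x = y then 0 else ((2 : ℝ) ^ sInf {m : ℕ | x m ≠ y m})⁻¹) = 0 := h
    rw [if_neg hxy] at h'
    have : (0 : ℝ) < ((2 : ℝ) ^ sInf {m : ℕ | x m ≠ y m})⁻¹ := by positivity
    exact this.ne' h'

/-! ### Matrix algebras and UHF algebras -/

/-- The C⋆-algebra of complex `k × k` matrices. -/
abbrev MatAlg (k : ℕ) : Type := CStarMatrix (Fin k) (Fin k) ℂ

theorem amplify_sum {k l : ℕ} (hk : 0 < k) (hkl : k ∣ l) (i : ℕ) (hi : i < l)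
    (g : ℕ → ℂ) :
    ∑ p : Fin l, (if i / k = (p : ℕ) / k then g ((p : ℕ) % k) else 0) = ∑ q : Fin k, g q := by
  obtain ⟨m, rfl⟩ := hkl
  have him : i / k < m := by
    rw [Nat.div_lt_iff_lt_mul hk]; rwa [mul_comm]
  rw [mul_comm k m, ← finProdFinEquiv.sum_comp, Fintype.sum_prod_type]
  rw [Finset.sum_eq_single (⟨i / k, him⟩ : Fin m)]
  · refine Finset.sum_congr rfl fun q _ => ?_
    have h1 : ((q : ℕ) + k * (i / k)) / k = i / k := by
      rw [Nat.add_mul_div_left _ _ hk, Nat.div_eq_of_lt q.2, zero_add]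
    have h2 : ((q : ℕ) + k * (i / k)) % k = q := by
      rw [Nat.add_mul_mod_self_left, Nat.mod_eq_of_lt q.2]
    simp [finProdFinEquiv, h1, h2]
  · intro b _ hb
    refine Finset.sum_eq_zero fun q _ => ?_
    have h1 : ((q : ℕ) + k * (b : ℕ)) / k = b := by
      rw [Nat.add_mul_div_left _ _ hk, Nat.div_eq_of_lt q.2, zero_add]
    have : i / k ≠ (b : ℕ) := fun h => hb (Fin.ext h.symm)
    simp [finProdFinEquiv, h1, this]
  · simp

/-- The block diagonal matrix `diag(a, …, a) ∈ M_l(ℂ)` of `a ∈ M_k(ℂ)`. -/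
def amplifyFun {k l : ℕ} (hk : 0 < k) (a : MatAlg k) : MatAlg l :=
  CStarMatrix.ofMatrix (Matrix.of fun i j =>
    if (i : ℕ) / k = (j : ℕ) / k then
      a ⟨(i : ℕ) % k, Nat.mod_lt _ hk⟩ ⟨(j : ℕ) % k, Nat.mod_lt _ hk⟩ else 0)

theorem amplifyFun_apply {k l : ℕ} (hk : 0 < k) (a : MatAlg k) (i j : Fin l) :
    amplifyFun hk a i j = if (i : ℕ) / k = (j : ℕ) / k then
      a ⟨(i : ℕ) % k, Nat.mod_lt _ hk⟩ ⟨(j : ℕ) % k, Nat.mod_lt _ hk⟩ else 0 := rfl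

/-- The unital ⋆-homomorphism sending `a ∈ M_k(ℂ)` to the block diagonal matrix
`diag(a, …, a) ∈ M_l(ℂ)` with `l / k` copies of `a` on the diagonal, when `k` divides `l`. -/
noncomputable def amplify {k l : ℕ} (hk : 0 < k) (hkl : k ∣ l) : MatAlg k →⋆ₐ[ℂ] MatAlg l where
  toFun := amplifyFun hk
  map_one' := by
    ext i j
    by_cases hij : i = j
    · subst hij; simp [amplifyFun_apply]
    · have : (i : ℕ) / k = (j : ℕ) / k → ¬ (i : ℕ) % k = (j : ℕ) % k := by
        intro h1 h2
        exact hij (Fin.ext (by rw [← Nat.div_add_mod (i : ℕ) k, ← Nat.div_add_mod (j : ℕ) k, h1, h2]))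
      simp only [amplifyFun_apply, CStarMatrix.one_apply, Fin.mk.injEq, hij, if_false]
      split_ifs with h1 h2
      · exact absurd h2 (this h1)
      · rfl
      · rfl
  map_mul' a b := by
    ext i j
    simp only [amplifyFun_apply, CStarMatrix.mul_apply]
    by_cases hij : (i : ℕ) / k = (j : ℕ) / k
    · rw [if_pos hij, ← hij]
      let g : ℕ → ℂ := fun q => if hq : q < k then
        a ⟨(i : ℕ) % k, Nat.mod_lt _ hk⟩ ⟨q, hq⟩ * b ⟨q, hq⟩ ⟨(j : ℕ) % k, Nat.mod_lt _ hk⟩ else 0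
      have h := amplify_sum hk hkl (i : ℕ) i.2 g
      have h1 : ∑ q : Fin k, g q = ∑ q : Fin k,
          a ⟨(i : ℕ) % k, Nat.mod_lt _ hk⟩ q * b q ⟨(j : ℕ) % k, Nat.mod_lt _ hk⟩ :=
        Finset.sum_congr rfl fun q _ => by simp [g]
      rw [← h1, ← h]
      refine Finset.sum_congr rfl fun p _ => ?_
      by_cases hp : (i : ℕ) / k = (p : ℕ) / k
      · simp [g, hp, Nat.mod_lt _ hk]
      · simp [hp]
    · rw [if_neg hij, eq_comm]
      refine Finset.sum_eq_zero fun p _ => ?_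
      by_cases hp : (i : ℕ) / k = (p : ℕ) / k
      · rw [if_neg (fun h => hij (hp.trans h)), mul_zero]
      · rw [if_neg hp, zero_mul]
  map_zero' := by
    ext i j
    simp [amplifyFun_apply, CStarMatrix.zero_apply]
  map_add' a b := by
    ext i j
    simp only [amplifyFun_apply, CStarMatrix.add_apply]
    split_ifs <;> simp
  commutes' c := by
    ext i j
    simp only [amplifyFun_apply, CStarMatrix.algebraMap_apply, Fin.mk.injEq]
    by_cases hij : i = j
    · subst hij; simp
    · have : (i : ℕ) / k = (j : ℕ) / k → ¬ (i : ℕ) % k = (j : ℕ) % k := by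
        intro h1 h2
        exact hij (Fin.ext (by rw [← Nat.div_add_mod (i : ℕ) k, ← Nat.div_add_mod (j : ℕ) k, h1, h2]))
      rw [if_neg hij]
      split_ifs with h1 h2
      · exact absurd h2 (this h1)
      · rfl
      · rfl
  map_star' a := by
    ext i j
    simp only [amplifyFun_apply, CStarMatrix.star_apply]
    by_cases hij : (i : ℕ) / k = (j : ℕ) / k
    · rw [if_pos hij, if_pos hij.symm]
    · rw [if_neg hij, if_neg (Ne.symm hij), star_zero]


theorem amplify_injective {k l : ℕ} (hk : 0 < k) (hl : 0 < l) (hkl : k ∣ l) :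
    Function.Injective (amplify hk hkl) := by
  intro a b h
  ext i j
  have hle : k ≤ l := Nat.le_of_dvd hl hkl
  have h' : amplifyFun hk a ⟨i, i.2.trans_le hle⟩ ⟨j, j.2.trans_le hle⟩ =
      amplifyFun hk b (⟨i, i.2.trans_le hle⟩ : Fin l) ⟨j, j.2.trans_le hle⟩ :=
    congrFun (congrFun h _) _
  simpa [amplifyFun_apply, Nat.div_eq_of_lt, Nat.mod_eq_of_lt] using h'

theorem amplify_self {k : ℕ} (hk : 0 < k) (a : MatAlg k) : amplify hk dvd_rfl a = a := by
  ext i j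
  change amplifyFun hk a i j = a i j
  simp [amplifyFun_apply, Nat.div_eq_of_lt, Nat.mod_eq_of_lt]

theorem amplify_amplify {k l m : ℕ} (hk : 0 < k) (hl : 0 < l) (hkl : k ∣ l) (hlm : l ∣ m)
    (a : MatAlg k) : amplify hl hlm (amplify hk hkl a) = amplify hk (hkl.trans hlm) a := by
  ext i j
  change amplifyFun hl (amplifyFun hk a) i j = amplifyFun hk a i j
  obtain ⟨c, rfl⟩ := hkl
  have key : ∀ n : ℕ, n % (k * c) / k = n / k % c := fun n => Nat.mod_mul_right_div_self n k c
  have hdiv : ∀ n : ℕ, n / (k * c) = n / k / c := fun n => (Nat.div_div_eq_div_mul n k c).symm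
  have hmod : ∀ n : ℕ, n % (k * c) % k = n % k := fun n => Nat.mod_mul_right_mod n k c
  simp only [amplifyFun_apply, key, hdiv, hmod]
  by_cases h : (i : ℕ) / k = (j : ℕ) / k
  · simp [h]
  · rw [if_neg h]
    split_ifs with h1 h2
    · exact absurd (by rw [← Nat.div_add_mod ((i : ℕ) / k) c, ← Nat.div_add_mod ((j : ℕ) / k) c,
        h1, h2]) h
    · rfl
    · rfl

/-- The sequence `⊠β`: `⊠β(n) = ∏_{j < n} (β(j) + 1)`. -/
def boxtimes (β : BaireSeq) (n : ℕ) : ℕ := ∏ j ∈ Finset.range n, ((β j : ℕ) + 1)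

theorem boxtimes_pos (β : BaireSeq) (n : ℕ) : 0 < boxtimes β n :=
  Finset.prod_pos fun _ _ => Nat.succ_pos _

theorem boxtimes_dvd (β : BaireSeq) {m n : ℕ} (h : m ≤ n) : boxtimes β m ∣ boxtimes β n :=
  Finset.prod_dvd_prod_of_subset _ _ _ (Finset.range_subset_range.mpr h)

/-- The connecting maps `M_{⊠β(m)}(ℂ) → M_{⊠β(n)}(ℂ)`, `m ≤ n`, of the inductive sequence of `β`;
for `n = m + 1` it is `a ↦ diag(a, …, a)` with `β(m) + 1` copies of `a`. -/
noncomputable def uhfMap (β : BaireSeq) (m n : ℕ) (h : m ≤ n) :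
    MatAlg (boxtimes β m) →⋆ₐ[ℂ] MatAlg (boxtimes β n) :=
  amplify (boxtimes_pos β m) (boxtimes_dvd β h)

instance (β : BaireSeq) :
    DirectedSystem (fun n => MatAlg (boxtimes β n)) (uhfMap β · · ·) where
  map_self _ x := amplify_self _ x
  map_map _ _ _ _ _ x := amplify_amplify _ _ _ _ x

/-- The algebraic inductive limit of the inductive sequence of `β`. -/
abbrev UHFAlg (β : BaireSeq) : Type :=
  DirectLimit (fun n => MatAlg (boxtimes β n)) (uhfMap β)

theorem norm_uhfMap (β : BaireSeq) (m n : ℕ) (h : m ≤ n) (a : MatAlg (boxtimes β m)) :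
    ‖uhfMap β m n h a‖ = ‖a‖ :=
  NonUnitalStarAlgHom.norm_map (uhfMap β m n h)
    (amplify_injective _ (boxtimes_pos β n) _) a

/-- The C⋆-norm of the algebraic inductive limit, which is the matrix norm at each stage. -/
noncomputable def uhfNorm (β : BaireSeq) : CStarSeminorm (UHFAlg β) where
  toFun := DirectLimit.lift (uhfMap β) (fun _ a => ‖a‖) (fun _ _ _ _ => (norm_uhfMap β _ _ _ _).symm)
  map_zero' := by
    rw [DirectLimit.zero_def 0]
    exact norm_zero
  add_le' := DirectLimit.induction₂ _ fun i x y => by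
    rw [DirectLimit.add_def]
    exact norm_add_le x y
  neg' := DirectLimit.induction _ fun i x => by
    rw [DirectLimit.neg_def]
    exact norm_neg x
  smul' c := DirectLimit.induction _ fun i x => by
    rw [DirectLimit.smul_def]
    exact norm_smul c x
  mul_le' := DirectLimit.induction₂ _ fun i x y => by
    rw [DirectLimit.mul_def]
    exact norm_mul_le x y
  star_mul_self' := DirectLimit.induction _ fun i x => by
    rw [DirectLimit.star_def, DirectLimit.mul_def]
    exact (CStarRing.norm_star_mul_self (x := x)).trans (sq ‖x‖).symm

/-- The UHF algebra of `β`: the C⋆-inductive limit of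
`M_{⊠β(0)}(ℂ) → M_{⊠β(1)}(ℂ) → M_{⊠β(2)}(ℂ) → ⋯`. -/
abbrev UHF (β : BaireSeq) : Type := (uhfNorm β).Completion

/-- The canonical unital ⋆-homomorphism `M_{⊠β(n)}(ℂ) → UHF(β)`. -/
noncomputable def uhfHom (β : BaireSeq) (n : ℕ) : MatAlg (boxtimes β n) →⋆ₐ[ℂ] UHF β :=
  (uhfNorm β).coeHom.comp
    { DirectLimit.Algebra.of (R := ℂ) (fun n => MatAlg (boxtimes β n)) (uhfMap β) n with
      map_star' := fun _ => rfl }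

theorem uhfHom_map (β : BaireSeq) {m n : ℕ} (h : m ≤ n) (a : MatAlg (boxtimes β m)) :
    uhfHom β n (uhfMap β m n h a) = uhfHom β m a := by
  have h1 := DirectLimit.mk_apply (F := fun n => MatAlg (boxtimes β n)) (f := uhfMap β) m n a h
  exact congrArg (uhfNorm β).coe h1

theorem norm_uhfHom (β : BaireSeq) (n : ℕ) (a : MatAlg (boxtimes β n)) : ‖uhfHom β n a‖ = ‖a‖ :=
  (uhfNorm β).norm_coe _

theorem dense_iUnion_range_uhfHom (β : BaireSeq) : Dense (⋃ n, Set.range (uhfHom β n)) := by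
  refine Dense.mono ?_ (uhfNorm β).denseRange_coe
  rintro _ ⟨x, rfl⟩
  induction x using DirectLimit.induction with
  | _ i x => exact Set.mem_iUnion.mpr ⟨i, x, rfl⟩

/-- The `n`-th member of the inductive sequence `𝓘(β)`: the image of `M_{⊠β(n)}(ℂ)`
in `UHF(β)`. -/
noncomputable def uhfSub (β : BaireSeq) (n : ℕ) : StarSubalgebra ℂ (UHF β) :=
  (uhfHom β n).range

/-! ### Compact quantum metric spaces -/

section StateSpace

variable {A : Type u} [CStarAlgebra A]

variable (A) in
/-- The state space of a unital C⋆-algebra, as a subset of the dual with the weak⋆ topology. -/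
def stateSpace : Set (WeakDual ℂ A) :=
  {φ | (∀ a : A, 0 ≤ φ (star a * a)) ∧ φ 1 = 1}

/-- A seminorm on a subspace of the self-adjoint part of `A` is encoded by its extension `L` to all
self-adjoint elements with the value `∞` outside of its domain. This is its
Monge-Kantorovich metric. -/
noncomputable def mongeKantorovich (L : selfAdjoint A → ℝ≥0∞) (φ ψ : WeakDual ℂ A) : ℝ≥0∞ :=
  ⨆ (a : selfAdjoint A) (_ : L a ≤ 1), edist (φ a) (ψ a)

/-- `L` is a Lip-norm, that is, `(A, L)` is a compact quantum metric space. -/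
structure IsLipNorm (L : selfAdjoint A → ℝ≥0∞) : Prop where
  add_le : ∀ a b, L (a + b) ≤ L a + L b
  smul : ∀ (r : ℝ) (a), L (r • a) = ENNReal.ofReal |r| * L a
  dense_dom : Dense {a | L a ≠ ∞}
  eq_zero_iff : ∀ a, L a = 0 ↔ ∃ r : ℝ, (a : A) = (r : ℂ) • 1
  metrizes : ∃ m : MetricSpace (stateSpace A),
    m.toUniformSpace.toTopologicalSpace = instTopologicalSpaceSubtype ∧
      ∀ φ ψ : stateSpace A, ENNReal.ofReal (m.dist φ ψ) = mongeKantorovich L φ ψ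
  lowerSemicontinuous : LowerSemicontinuous L

/-- The `C`-quasi-Leibniz inequalities for the Jordan product `(ab + ba) / 2` and the Lie product
`(ab - ba) / 2i` of self-adjoint elements. -/
def IsQuasiLeibniz (C : ℝ≥0) (L : selfAdjoint A → ℝ≥0∞) : Prop :=
  ∀ a b c : selfAdjoint A,
    ((c : A) = (1 / 2 : ℂ) • ((a : A) * b + (b : A) * a) →
      L c ≤ C * (L a * ‖(b : A)‖ₑ + L b * ‖(a : A)‖ₑ)) ∧
    ((c : A) = (1 / (2 * Complex.I) : ℂ) • ((a : A) * b - (b : A) * a) →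
      L c ≤ C * (L a * ‖(b : A)‖ₑ + L b * ‖(a : A)‖ₑ))

end StateSpace

/-- A pair `(A, L)` of a unital C⋆-algebra `A` and an extended real valued function `L` on its
self-adjoint part. -/
structure LipPair : Type (u + 1) where
  carrier : Type u
  [cstarAlgebra : CStarAlgebra carrier]
  lip : selfAdjoint carrier → ℝ≥0∞

attribute [instance] LipPair.cstarAlgebra

/-- `(A, L)` is a `C`-quasi-Leibniz compact quantum metric space. -/
structure LipPair.IsQCQMS (C : ℝ≥0) (P : LipPair.{u}) : Prop where
  isLipNorm : IsLipNorm P.lip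
  isQuasiLeibniz : IsQuasiLeibniz C P.lip

/-! ### The quantum Gromov-Hausdorff propinquity -/

/-- The `1`-level set of an element `ω` of a unital C⋆-algebra: the states `φ` with
`φ((1 - ω)⋆(1 - ω)) = φ((1 - ω)(1 - ω)⋆) = 0`. -/
def levelSet {D : Type u} [CStarAlgebra D] (ω : D) : Set (WeakDual ℂ D) :=
  {φ | φ ∈ stateSpace D ∧ φ (star (1 - ω) * (1 - ω)) = 0 ∧ φ ((1 - ω) * star (1 - ω)) = 0}

/-- A bridge between two unital C⋆-algebras, with pivot `ω`. -/
structure Bridge (A B : Type u) [CStarAlgebra A] [CStarAlgebra B] : Type (u + 1) where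
  D : Type u
  [cstarAlgebra : CStarAlgebra D]
  left : A →⋆ₐ[ℂ] D
  left_injective : Function.Injective left
  right : B →⋆ₐ[ℂ] D
  right_injective : Function.Injective right
  ω : D
  levelSet_nonempty : (levelSet ω).Nonempty

attribute [instance] Bridge.cstarAlgebra

/-- The Hausdorff distance between `S` and `T` for the distance function `d`
between points of `S` and points of `T`. -/
noncomputable def hausdorffOf {S T : Type*} (d : S → T → ℝ≥0∞) (s : Set S) (t : Set T) :
    ℝ≥0∞ :=
  max (⨆ x ∈ s, ⨅ y ∈ t, d x y) (⨆ y ∈ t, ⨅ x ∈ s, d x y)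

/-- The dual map of a unital ⋆-homomorphism. -/
noncomputable def dualMap {A D : Type u} [CStarAlgebra A] [CStarAlgebra D] (f : A →⋆ₐ[ℂ] D)
    (φ : WeakDual ℂ D) : WeakDual ℂ A :=
  StrongDual.toWeakDual ((WeakDual.toStrongDual φ).comp
    ⟨f.toAlgHom.toLinearMap, AddMonoidHomClass.continuous_of_bound f 1 fun a => by
      simpa using NonUnitalStarAlgHom.norm_apply_le f a⟩)

namespace Bridge

variable {A B : Type u} [CStarAlgebra A] [CStarAlgebra B]

/-- The height of a bridge. -/
noncomputable def height (γ : Bridge A B) (LA : selfAdjoint A → ℝ≥0∞)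
    (LB : selfAdjoint B → ℝ≥0∞) : ℝ≥0∞ :=
  max (hausdorffOf (mongeKantorovich LA) (stateSpace A) (dualMap γ.left '' levelSet γ.ω))
    (hausdorffOf (mongeKantorovich LB) (stateSpace B) (dualMap γ.right '' levelSet γ.ω))

/-- The bridge seminorm. -/
noncomputable def bridgeNorm (γ : Bridge A B) (a : A) (b : B) : ℝ≥0∞ :=
  ‖γ.left a * γ.ω - γ.ω * γ.right b‖ₑ

/-- The reach of a bridge. -/
noncomputable def reach (γ : Bridge A B) (LA : selfAdjoint A → ℝ≥0∞)
    (LB : selfAdjoint B → ℝ≥0∞) : ℝ≥0∞ :=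
  hausdorffOf (fun (a : selfAdjoint A) (b : selfAdjoint B) => γ.bridgeNorm a b)
    {a | LA a ≤ 1} {b | LB b ≤ 1}

/-- The length of a bridge. -/
noncomputable def length (γ : Bridge A B) (LA : selfAdjoint A → ℝ≥0∞)
    (LB : selfAdjoint B → ℝ≥0∞) : ℝ≥0∞ :=
  max (γ.height LA LB) (γ.reach LA LB)

end Bridge

/-- A trek: a finite sequence of one or more bridges joining successive `C`-quasi-Leibniz compact
quantum metric spaces. -/
inductive Trek (C : ℝ≥0) : LipPair.{u} → LipPair.{u} → Type (u + 1)
  | single {P Q : LipPair.{u}} (hP : P.IsQCQMS C) (hQ : Q.IsQCQMS C)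
      (γ : Bridge P.carrier Q.carrier) : Trek C P Q
  | cons {P Q R : LipPair.{u}} (hP : P.IsQCQMS C)
      (γ : Bridge P.carrier Q.carrier) (t : Trek C Q R) : Trek C P R

/-- The length of a trek is the sum of the lengths of its bridges. -/
noncomputable def Trek.length {C : ℝ≥0} : {P Q : LipPair.{u}} → Trek C P Q → ℝ≥0∞
  | P, Q, .single _ _ γ => γ.length P.lip Q.lip
  | P, _, .cons (Q := Q) _ γ t => γ.length P.lip Q.lip + t.length

/-- The quantum Gromov-Hausdorff propinquity between `C`-quasi-Leibniz compact quantum metric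
spaces: the infimum of the lengths of the treks from one to the other. -/
noncomputable def qpropinquity (C : ℝ≥0) (P Q : LipPair.{u}) : ℝ≥0∞ :=
  ⨅ t : Trek C P Q, t.length

/-! ### The Lip-norms -/

section Lip

variable {A : Type v} [CStarAlgebra A]

/-- A tracial state. -/
def IsTracialState (τ : WeakDual ℂ A) : Prop :=
  τ ∈ stateSpace A ∧ ∀ a b : A, τ (a * b) = τ (b * a)

/-- A faithful functional. -/
def IsFaithfulState (τ : WeakDual ℂ A) : Prop :=
  ∀ a : A, τ (star a * a) = 0 → a = 0

/-- `E` is a conditional expectation of `A` onto `B`: a contractive linear projection. -/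
structure IsCondExp (B : StarSubalgebra ℂ A) (E : A →L[ℂ] A) : Prop where
  map_mem : ∀ a, E a ∈ B
  map_eq : ∀ b ∈ B, E b = b
  contractive : ∀ a, ‖E a‖ ≤ ‖a‖

variable {X : Type u} [MetricSpace X] [CompactSpace X]

/-- The Lipschitz constant of an `A`-valued function, where `0 / 0 = 0` in `[0, ∞]`. -/
noncomputable def lipConst (f : C(X, A)) : ℝ≥0∞ :=
  ⨆ (x : X) (y : X), edist (f x) (f y) / edist x y

/-- The pointwise extension `E^X(f)(x) = E(f(x))` of `E` to `C(X, A)`. -/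
noncomputable def extendExp (E : A →L[ℂ] A) (f : C(X, A)) : C(X, A) :=
  (⟨E, E.continuous⟩ : C(A, A)).comp f

/-- The seminorm `f ↦ l(f) + sup_n ‖f - E_n^X(f)‖ / b(n)` on the self-adjoint part of
`C(X, A)`. -/
noncomputable def ahLip (E : ℕ → A →L[ℂ] A) (b : ℕ → ℝ) (f : selfAdjoint C(X, A)) : ℝ≥0∞ :=
  lipConst (f : C(X, A)) +
    ⨆ n : ℕ, ‖(f : C(X, A)) - extendExp (E n) f‖ₑ / ENNReal.ofReal (b n)

end Lip

/-- The pair of `C(X, UHF(β))` and its seminorm for the weights `1 / ⊠β(n)`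
and the conditional expectations `E n`. -/
noncomputable def uhfFunPair (X : Type u) [MetricSpace X] [CompactSpace X] (β : BaireSeq)
    (E : ℕ → UHF β →L[ℂ] UHF β) : LipPair.{u} where
  carrier := C(X, UHF β)
  lip := ahLip E fun n => 1 / (boxtimes β n : ℝ)

/-- The pair of `C(X) ⊗ UHF(β)` and the seminorm transported from
`C(X, UHF(β))` by the ⋆-isomorphism `π`. -/
noncomputable def uhfTensorPair (X : Type u) [MetricSpace X] [CompactSpace X] (β : BaireSeq)
    (E : ℕ → UHF β →L[ℂ] UHF β)
    (π : CStarTensor C(X, ℂ) (UHF β) ≃⋆ₐ[ℂ] C(X, UHF β)) : LipPair.{u} where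
  carrier := CStarTensor C(X, ℂ) (UHF β)
  lip t := (uhfFunPair X β E).lip ⟨π t, t.2.map π⟩

/-! Truncation to a matrix stage drives the estimate. Restrict `L_β` to `C(X, M_k)`, where `k =
⊠β(N)`. The maps `E_n` are commuting contractions, so applying `E_N` pointwise retracts `C(X,
UHF(β))` onto this subalgebra without increasing `L_β`. Moreover `L_β(f) ≤ 1` forces `‖f - E_N f‖ ≤
1/⊠β(N) ≤ 2^(-N)`, each factor `β(j) + 1` being at least `2`. The bridge inside `C(X, UHF(β))` with
pivot `1` has height zero, because a state `φ` of the subalgebra extends to `φ ∘ E_N`; its length is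
therefore at most `2^(-N)`.

On `C(X, M_k)` the terms with `n ≥ N` vanish, and for `n ≤ N` the map `E_n` is a block average whose
size depends only on `β(0), …, β(N-1)`. If `β` and `η` first differ at `N`, both spaces thus retract
onto one and the same space, and two bridges joined there have total length at most `2 · 2^(-N) = 2
d(β, η)`. The lemmas carrying this are `LipRetraction.length_bridge_le`,
`CondExpTower.lipRetraction`, `ahLip_congr` and `exists_common_retraction`.

That `L_β` is a Lip-norm follows from Rieffel's criterion (`IsTotallyBoundedLip.metrizes`): its unit
ball is totally bounded modulo scalars, since it is uniformly close to Lipschitz functions with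
values in a finite-dimensional space, where Arzelà–Ascoli applies. The Leibniz constant `2` comes
from `norm_mul_sub_extendExp_le`.

The maps `E_n` extend the block traces, the adjoints of the diagonal embeddings for the normalized
traces. Their uniqueness among contractive projections rests on Tomiyama's argument. The tensor
product reduces to `C(X, UHF(β))` because every C⋆-seminorm on the algebraic tensor product is
dominated by the supremum norm: this is automatic on `C(X) ⊗ M_k`, which is already a C⋆-algebra,
and passes to the limit along `E_n`. -/

/-! ### Block traces of matrices -/

/-- The index of the `i`-th coordinate of the `s`-th block of size `k` among `l` coordinates. -/
def blockIndex {k l : ℕ} (s : Fin (l / k)) (i : Fin k) : Fin l :=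
  ⟨s * k + i, by
    have h1 : ((s : ℕ) + 1) * k ≤ l / k * k := Nat.mul_le_mul_right k s.2
    have h2 := Nat.div_mul_le_self l k
    have h3 := i.2
    rw [add_mul, one_mul] at h1
    omega⟩

theorem blockIndex_div {k l : ℕ} (s : Fin (l / k)) (i : Fin k) :
    (blockIndex s i : ℕ) / k = s := by
  have hk : 0 < k := i.pos
  change ((s : ℕ) * k + i) / k = s
  rw [add_comm, Nat.add_mul_div_right _ _ hk, Nat.div_eq_of_lt i.2, zero_add]

theorem blockIndex_mod {k l : ℕ} (s : Fin (l / k)) (i : Fin k) :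
    (blockIndex s i : ℕ) % k = i := by
  change ((s : ℕ) * k + i) % k = i
  rw [add_comm, Nat.add_mul_mod_self_right, Nat.mod_eq_of_lt i.2]

theorem sum_blockIndex {M : Type*} [AddCommMonoid M] {k l : ℕ} (hk : 0 < k) (hkl : k ∣ l)
    (g : Fin l → M) : ∑ p, g p = ∑ s : Fin (l / k), ∑ i : Fin k, g (blockIndex s i) := by
  rw [← Fintype.sum_prod_type']
  refine (Fintype.sum_bijective (fun x : Fin (l / k) × Fin k => blockIndex x.1 x.2) ⟨?_, ?_⟩ _ _
    fun _ => rfl).symm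
  · rintro ⟨s, i⟩ ⟨t, j⟩ h
    have h1 := blockIndex_div s i
    have h2 := blockIndex_mod s i
    simp only at h
    rw [h, blockIndex_div] at h1
    rw [h, blockIndex_mod] at h2
    exact Prod.ext (Fin.ext h1.symm) (Fin.ext h2.symm)
  · intro p
    refine ⟨⟨⟨p / k, Nat.div_lt_div_of_lt_of_dvd hkl p.2⟩, ⟨p % k, Nat.mod_lt _ hk⟩⟩, Fin.ext ?_⟩
    exact Nat.div_add_mod' p k

theorem amplify_blockIndex {k l : ℕ} (hk : 0 < k) (hkl : k ∣ l) (a : MatAlg k)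
    (s t : Fin (l / k)) (i j : Fin k) :
    amplify hk hkl a (blockIndex s i) (blockIndex t j) = if s = t then a i j else 0 := by
  change amplifyFun hk a _ _ = _
  simp only [amplifyFun_apply, blockIndex_div, blockIndex_mod, Fin.ext_iff]

/-- The normalized trace of a matrix. -/
noncomputable def normTrace (k : ℕ) : MatAlg k →ₗ[ℂ] ℂ where
  toFun a := (k : ℂ)⁻¹ * ∑ i, a i i
  map_add' a b := by simp [Finset.sum_add_distrib, mul_add]
  map_smul' c a := by simp [← Finset.mul_sum, mul_left_comm]

theorem normTrace_apply {k : ℕ} (a : MatAlg k) : normTrace k a = (k : ℂ)⁻¹ * ∑ i, a i i := rfl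

theorem normTrace_mul {k : ℕ} (a b : MatAlg k) :
    normTrace k (a * b) = (k : ℂ)⁻¹ * ∑ i, ∑ j, a i j * b j i := by
  simp [normTrace_apply, CStarMatrix.mul_apply]

theorem normTrace_mul_comm {k : ℕ} (a b : MatAlg k) :
    normTrace k (a * b) = normTrace k (b * a) := by
  rw [normTrace_mul, normTrace_mul, Finset.sum_comm]
  simp only [mul_comm]

theorem normTrace_one {k : ℕ} (hk : 0 < k) : normTrace k 1 = 1 := by
  have : (k : ℂ) ≠ 0 := by exact_mod_cast hk.ne'
  simp [normTrace_apply, this]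

theorem normTrace_star_mul_self {k : ℕ} (a : MatAlg k) :
    normTrace k (star a * a) = (((k : ℝ)⁻¹ * ∑ i, ∑ j, ‖a j i‖ ^ 2 : ℝ) : ℂ) := by
  rw [normTrace_mul]
  push_cast
  congr 1
  refine Finset.sum_congr rfl fun i _ => Finset.sum_congr rfl fun j _ => ?_
  rw [CStarMatrix.star_apply]
  exact Complex.conj_mul' _

theorem normTrace_star_mul_self_nonneg {k : ℕ} (a : MatAlg k) :
    0 ≤ normTrace k (star a * a) := by
  rw [normTrace_star_mul_self]
  exact_mod_cast by positivity

theorem eq_zero_of_normTrace_star_mul_self {k : ℕ} {a : MatAlg k}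
    (h : normTrace k (star a * a) = 0) : a = 0 := by
  rw [normTrace_star_mul_self] at h
  have h' : (k : ℝ)⁻¹ * ∑ i, ∑ j, ‖a j i‖ ^ 2 = 0 := by exact_mod_cast h
  ext i j
  have hk : (k : ℝ)⁻¹ ≠ 0 := by
    have := i.pos
    positivity
  have h1 := (mul_eq_zero.mp h').resolve_left hk
  rw [Finset.sum_eq_zero_iff_of_nonneg fun _ _ => by positivity] at h1
  have h2 := h1 j (Finset.mem_univ _)
  rw [Finset.sum_eq_zero_iff_of_nonneg fun _ _ => by positivity] at h2
  have h3 := h2 i (Finset.mem_univ _)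
  simpa using h3

/-- The trace pairing is nondegenerate: take `b = star (x - y)` and use faithfulness. Identities
between block traces are obtained by pairing both sides with an arbitrary matrix. -/
theorem eq_of_normTrace_mul {k : ℕ} {x y : MatAlg k}
    (h : ∀ b, normTrace k (x * b) = normTrace k (y * b)) : x = y := by
  rw [← sub_eq_zero]
  apply eq_zero_of_normTrace_star_mul_self
  rw [normTrace_mul_comm, sub_mul, map_sub, h, sub_self]

/-- The average of the `l / k` diagonal blocks of size `k` of a matrix of size `l`. -/
noncomputable def blockTrace (k l : ℕ) : MatAlg l →ₗ[ℂ] MatAlg k where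
  toFun a := CStarMatrix.ofMatrix (Matrix.of fun i j =>
    ((l / k : ℕ) : ℂ)⁻¹ * ∑ s : Fin (l / k), a (blockIndex s i) (blockIndex s j))
  map_add' a b := by
    ext i j
    simp [Finset.sum_add_distrib, mul_add]
  map_smul' c a := by
    ext i j
    simp [← Finset.mul_sum, mul_left_comm]

theorem blockTrace_apply {k l : ℕ} (a : MatAlg l) (i j : Fin k) :
    blockTrace k l a i j =
      ((l / k : ℕ) : ℂ)⁻¹ * ∑ s : Fin (l / k), a (blockIndex s i) (blockIndex s j) := rfl

/-- Block averaging is the adjoint of amplification: only the diagonal blocks of `x` meet a block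
diagonal matrix, and the normalization splits as `1/l = (1/k) · 1/(l/k)`. -/
theorem normTrace_mul_amplify {k l : ℕ} (hk : 0 < k) (hkl : k ∣ l) (x : MatAlg l)
    (b : MatAlg k) :
    normTrace l (x * amplify hk hkl b) = normTrace k (blockTrace k l x * b) := by
  rw [normTrace_mul, normTrace_mul, sum_blockIndex hk hkl]
  simp only [sum_blockIndex hk hkl, amplify_blockIndex, blockTrace_apply, mul_ite, mul_zero]
  have h1 : ∀ s : Fin (l / k), ∀ i : Fin k, (∑ t : Fin (l / k), ∑ j : Fin k,
      if t = s then x (blockIndex s i) (blockIndex t j) * b j i else 0) =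
      ∑ j, x (blockIndex s i) (blockIndex s j) * b j i := by
    intro s i
    rw [Finset.sum_eq_single s]
    · simp
    · intro t _ ht
      simp [ht]
    · simp
  simp only [h1]
  rw [Finset.sum_comm]
  have h2 : (l : ℂ)⁻¹ = (k : ℂ)⁻¹ * ((l / k : ℕ) : ℂ)⁻¹ := by
    rw [← mul_inv, ← Nat.cast_mul, Nat.mul_div_cancel' hkl]
  rw [h2, mul_assoc, Finset.mul_sum]
  congr 1
  refine Finset.sum_congr rfl fun i _ => ?_
  rw [Finset.sum_comm, Finset.mul_sum]
  refine Finset.sum_congr rfl fun j _ => ?_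
  rw [mul_assoc, Finset.sum_mul]

theorem normTrace_amplify {k l : ℕ} (hk : 0 < k) (hl : 0 < l) (hkl : k ∣ l) (b : MatAlg k) :
    normTrace l (amplify hk hkl b) = normTrace k b := by
  have h2 : (l : ℂ)⁻¹ = (k : ℂ)⁻¹ * ((l / k : ℕ) : ℂ)⁻¹ := by
    rw [← mul_inv, ← Nat.cast_mul, Nat.mul_div_cancel' hkl]
  have h3 : ((l / k : ℕ) : ℂ) ≠ 0 := by
    exact_mod_cast (Nat.div_pos (Nat.le_of_dvd hl hkl) hk).ne'
  rw [normTrace_apply, normTrace_apply, sum_blockIndex hk hkl]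
  simp only [amplify_blockIndex, if_true]
  rw [Finset.sum_const, Finset.card_univ, Fintype.card_fin, nsmul_eq_mul, h2]
  field_simp

/-- Adjoint to the multiplicativity of `amplify`, after cycling the factors under the trace. -/
theorem blockTrace_amplify_mul {k l : ℕ} (hk : 0 < k) (hkl : k ∣ l) (b : MatAlg k)
    (x : MatAlg l) : blockTrace k l (amplify hk hkl b * x) = b * blockTrace k l x := by
  refine eq_of_normTrace_mul fun c => ?_
  rw [← normTrace_mul_amplify hk hkl, mul_assoc, normTrace_mul_comm, mul_assoc, ← map_mul,
    normTrace_mul_amplify hk hkl, ← mul_assoc, normTrace_mul_comm, ← mul_assoc]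

theorem blockTrace_amplify {k l : ℕ} (hk : 0 < k) (hl : 0 < l) (hkl : k ∣ l) (b : MatAlg k) :
    blockTrace k l (amplify hk hkl b) = b := by
  refine eq_of_normTrace_mul fun c => ?_
  rw [← normTrace_mul_amplify hk hkl, ← map_mul, normTrace_amplify hk hl hkl]

/-- Adjoint to the transitivity `amplify_amplify` of the embeddings. -/
theorem blockTrace_blockTrace {k l m : ℕ} (hk : 0 < k) (hl : 0 < l) (hkl : k ∣ l)
    (hlm : l ∣ m) (x : MatAlg m) :
    blockTrace k l (blockTrace l m x) = blockTrace k m x := by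
  refine eq_of_normTrace_mul fun c => ?_
  rw [← normTrace_mul_amplify hk hkl, ← normTrace_mul_amplify hl hlm,
    ← normTrace_mul_amplify hk (hkl.trans hlm), amplify_amplify]

theorem blockTrace_star {k l : ℕ} (x : MatAlg l) :
    blockTrace k l (star x) = star (blockTrace k l x) := by
  ext i j
  simp [blockTrace_apply, CStarMatrix.star_apply]

/-! ### Contractivity of the block traces -/

section Compression

open scoped Matrix.Norms.L2Operator

/-- A principal submatrix is a compression `V⋆ a V`, where `V` is the isometry selecting the
coordinates in the image of `f`. -/
theorem l2_norm_submatrix_le {m n : ℕ} (a : Matrix (Fin n) (Fin n) ℂ) {f : Fin m → Fin n}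
    (hf : Function.Injective f) : ‖a.submatrix f f‖ ≤ ‖a‖ := by
  let V : Matrix (Fin n) (Fin m) ℂ := (1 : Matrix (Fin n) (Fin n) ℂ).submatrix id f
  have hV : V.conjTranspose * V = 1 := by
    ext i j
    simp [V, Matrix.mul_apply, Matrix.one_apply, hf.eq_iff]
  have hVn : ‖V‖ ≤ 1 := by
    have h := Matrix.l2_opNorm_conjTranspose_mul_self V
    rw [hV] at h
    have h1 := Matrix.l2_opNorm_conjTranspose_mul_self (1 : Matrix (Fin m) (Fin m) ℂ)
    rw [Matrix.conjTranspose_one, one_mul] at h1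
    -- From `‖1‖ = ‖1‖²`; only an inequality, because `m = 0` gives norm zero.
    have h2 : ‖(1 : Matrix (Fin m) (Fin m) ℂ)‖ ≤ 1 := by
      by_contra h3
      nlinarith
    nlinarith [norm_nonneg V]
  have h : a.submatrix f f = V.conjTranspose * a * V := by
    ext i j
    simp [V, Matrix.mul_apply, Matrix.one_apply]
  rw [h]
  calc ‖V.conjTranspose * a * V‖ ≤ ‖V.conjTranspose‖ * ‖a‖ * ‖V‖ :=
        (Matrix.l2_opNorm_mul _ _).trans
          (mul_le_mul_of_nonneg_right (Matrix.l2_opNorm_mul _ _) (norm_nonneg _))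
    _ ≤ 1 * ‖a‖ * 1 := by
        rw [Matrix.l2_opNorm_conjTranspose]
        gcongr
    _ = ‖a‖ := by ring

/-- An injective ⋆-homomorphism of C⋆-algebras is isometric, which identifies the C⋆-norm with the
operator norm. -/
theorem norm_eq_l2_norm {n : ℕ} (a : MatAlg n) :
    ‖a‖ = ‖CStarMatrix.ofMatrix.symm a‖ := by
  let e := CStarMatrix.ofMatrixStarAlgEquiv (n := Fin n) (A := ℂ)
  have := NonUnitalStarAlgHom.norm_map e e.injective (CStarMatrix.ofMatrix.symm a)
  exact this

theorem norm_submatrix_le {m n : ℕ} (a : MatAlg n) {f : Fin m → Fin n}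
    (hf : Function.Injective f) :
    ‖(CStarMatrix.ofMatrix (Matrix.of fun i j => a (f i) (f j)) : MatAlg m)‖ ≤ ‖a‖ := by
  rw [norm_eq_l2_norm, norm_eq_l2_norm]
  exact l2_norm_submatrix_le (CStarMatrix.ofMatrix.symm a) hf

end Compression

theorem norm_blockTrace_le {k l : ℕ} (a : MatAlg l) : ‖blockTrace k l a‖ ≤ ‖a‖ := by
  have h : blockTrace k l a = ((l / k : ℕ) : ℂ)⁻¹ • ∑ s : Fin (l / k),
      (CStarMatrix.ofMatrix (Matrix.of fun i j => a (blockIndex s i) (blockIndex s j)) :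
        MatAlg k) := by
    ext i j
    rw [blockTrace_apply, CStarMatrix.smul_apply, smul_eq_mul]
    congr 1
    exact (Matrix.sum_apply i j Finset.univ fun s : Fin (l / k) =>
      Matrix.of fun i j => a (blockIndex s i) (blockIndex s j)).symm
  rw [h, norm_smul, norm_inv, Complex.norm_natCast]
  have h1 := norm_sum_le_of_le (Finset.univ : Finset (Fin (l / k)))
    (f := fun s => (CStarMatrix.ofMatrix (Matrix.of fun i j =>
      a (blockIndex s i) (blockIndex s j)) : MatAlg k)) (n := fun _ => ‖a‖)
    fun s _ => norm_submatrix_le a (f := blockIndex s) fun i j hij => by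
      have := blockIndex_mod s i
      rw [hij, blockIndex_mod] at this
      exact Fin.ext this.symm
  rw [Finset.sum_const, Finset.card_univ, Fintype.card_fin, nsmul_eq_mul] at h1
  -- With no block at all the average is zero, as `0⁻¹ = 0`.
  rcases Nat.eq_zero_or_pos (l / k) with h0 | h0
  · simp [h0]
  · have : (0 : ℝ) < (l / k : ℕ) := by exact_mod_cast h0
    rw [inv_mul_le_iff₀ this]
    exact h1

/-! ### Conditional expectations and the trace of a UHF algebra -/

instance (k : ℕ) : FiniteDimensional ℂ (MatAlg k) :=
  inferInstanceAs (FiniteDimensional ℂ (Matrix (Fin k) (Fin k) ℂ))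

section UHF

variable (β : BaireSeq)

/-- The block trace of the elements of the `m`-th matrix algebra, regarded as elements of the
inductive limit. -/
noncomputable def uhfProjStage (n m : ℕ) : MatAlg (boxtimes β m) →ₗ[ℂ] MatAlg (boxtimes β n) :=
  blockTrace (boxtimes β n) (boxtimes β (max m n)) ∘ₗ
    (uhfMap β m (max m n) (le_max_left m n)).toAlgHom.toLinearMap

variable {β}

/-- The choice of `max m n` is immaterial: going further up and averaging back down cancels. This is
the compatibility needed to descend to the inductive limit. -/
theorem uhfProjStage_eq {n m p : ℕ} (hm : m ≤ p) (hn : n ≤ p) (a : MatAlg (boxtimes β m)) :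
    uhfProjStage β n m a = blockTrace (boxtimes β n) (boxtimes β p) (uhfMap β m p hm a) := by
  have hp : max m n ≤ p := max_le hm hn
  have h1 : uhfMap β m p hm a =
      uhfMap β (max m n) p hp (uhfMap β m (max m n) (le_max_left m n) a) :=
    (amplify_amplify _ _ _ _ a).symm
  rw [h1, ← blockTrace_blockTrace (boxtimes_pos β n) (boxtimes_pos β (max m n))
    (boxtimes_dvd β (le_max_right m n)) (boxtimes_dvd β hp)]
  unfold uhfMap
  rw [blockTrace_amplify _ (boxtimes_pos β p)]
  rfl

theorem norm_uhfProjStage_le (n m : ℕ) (a : MatAlg (boxtimes β m)) :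
    ‖uhfProjStage β n m a‖ ≤ ‖a‖ :=
  (norm_blockTrace_le _).trans (norm_uhfMap β m (max m n) (le_max_left m n) a).le

variable (β)

/-- The map of the algebraic inductive limit to the `n`-th matrix algebra given by the block
traces. -/
noncomputable def uhfProjAlg (n : ℕ) : UHFAlg β →ₗ[ℂ] MatAlg (boxtimes β n) :=
  DirectLimit.Module.lift ℂ ℕ (fun n => MatAlg (boxtimes β n)) (uhfMap β) (uhfProjStage β n)
    fun i j hij x => by
      rw [uhfProjStage_eq (le_max_left j n) (le_max_right j n),
        uhfProjStage_eq (hij.trans (le_max_left j n)) (le_max_right j n)]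
      exact congrArg _ (amplify_amplify _ _ _ _ x)

/-- The trace preserving map of `UHF(β)` to the `n`-th matrix algebra. -/
noncomputable def uhfProj (n : ℕ) : UHF β →L[ℂ] MatAlg (boxtimes β n) :=
  (uhfProjAlg β n).extendOfNorm (uhfNorm β).coeHom.toAlgHom.toLinearMap

theorem norm_uhfProjAlg_le (n : ℕ) (x : UHFAlg β) :
    ‖uhfProjAlg β n x‖ ≤ 1 * ‖(uhfNorm β).coeHom.toAlgHom.toLinearMap x‖ := by
  induction x using DirectLimit.induction with
  | _ i x =>
    rw [one_mul]
    exact (norm_uhfProjStage_le n i x).trans (norm_uhfHom β i x).ge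

variable {β}

theorem norm_uhfProj_le (n : ℕ) (x : UHF β) : ‖uhfProj β n x‖ ≤ ‖x‖ := by
  have h := LinearMap.norm_extendOfNorm_apply_le (uhfNorm β).denseRange_coe 1
    (norm_uhfProjAlg_le β n) x
  rwa [one_mul] at h

theorem uhfProj_uhfHom {n m : ℕ} (h : n ≤ m) (a : MatAlg (boxtimes β m)) :
    uhfProj β n (uhfHom β m a) = blockTrace (boxtimes β n) (boxtimes β m) a := by
  have h1 := LinearMap.extendOfNorm_eq (uhfNorm β).denseRange_coe ⟨1, norm_uhfProjAlg_le β n⟩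
    (⟦⟨m, a⟩⟧ : UHFAlg β)
  have h2 : uhfProjStage β n m a = blockTrace (boxtimes β n) (boxtimes β m) a := by
    rw [uhfProjStage_eq le_rfl h]
    exact congrArg _ (amplify_self _ a)
  exact h1.trans h2

theorem uhfProj_uhfHom_self (n : ℕ) (a : MatAlg (boxtimes β n)) :
    uhfProj β n (uhfHom β n a) = a := by
  rw [uhfProj_uhfHom le_rfl]
  conv_lhs => rw [← amplify_self (boxtimes_pos β n) a]
  exact blockTrace_amplify _ (boxtimes_pos β n) _ a

-- A closed condition propagates from the dense union of the matrix stages; an element of an early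
-- stage also lives in every later one, so stages before `n` can be skipped.
@[elab_as_elim]
theorem UHF.induction_on {p : UHF β → Prop} (n : ℕ) (x : UHF β) (hp : IsClosed {x | p x})
    (h : ∀ m, n ≤ m → ∀ a, p (uhfHom β m a)) : p x := by
  have hd := dense_iUnion_range_uhfHom β
  have : (⋃ n, Set.range (uhfHom β n)) ⊆ {x | p x} := by
    intro y hy
    obtain ⟨m, a, rfl⟩ := Set.mem_iUnion.mp hy
    change p _
    rw [← uhfHom_map β (le_max_right n m)]
    exact h _ (le_max_left n m) _
  exact (hp.closure_subset_iff.mpr this) (hd x)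

variable (β) in
/-- The canonical map `M_{⊠β(n)}(ℂ) → UHF(β)` as a continuous linear map. -/
noncomputable def uhfHomL (n : ℕ) : MatAlg (boxtimes β n) →L[ℂ] UHF β :=
  (uhfHom β n).toAlgHom.toLinearMap.mkContinuous 1 fun a => by
    rw [one_mul]
    exact (norm_uhfHom β n a).le

theorem blockTrace_uhfProj {n m : ℕ} (h : n ≤ m) (x : UHF β) :
    blockTrace (boxtimes β n) (boxtimes β m) (uhfProj β m x) = uhfProj β n x := by
  have hc : Continuous (blockTrace (boxtimes β n) (boxtimes β m)) :=
    AddMonoidHomClass.continuous_of_bound _ 1 fun a => by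
      rw [one_mul]; exact norm_blockTrace_le a
  refine UHF.induction_on m x (isClosed_eq (hc.comp (uhfProj β m).continuous)
    (uhfProj β n).continuous) fun p hp a => ?_
  rw [uhfProj_uhfHom hp, uhfProj_uhfHom (h.trans hp),
    blockTrace_blockTrace (boxtimes_pos β n) (boxtimes_pos β m) (boxtimes_dvd β h)
      (boxtimes_dvd β hp)]

theorem uhfProj_star (n : ℕ) (x : UHF β) : uhfProj β n (star x) = star (uhfProj β n x) := by
  refine UHF.induction_on n x (isClosed_eq ((uhfProj β n).continuous.comp continuous_star)
    (continuous_star.comp (uhfProj β n).continuous)) fun p hp a => ?_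
  rw [← map_star, uhfProj_uhfHom hp, uhfProj_uhfHom hp, blockTrace_star]

theorem uhfProj_uhfHom_mul (n : ℕ) (b : MatAlg (boxtimes β n)) (x : UHF β) :
    uhfProj β n (uhfHom β n b * x) = b * uhfProj β n x := by
  refine UHF.induction_on n x (isClosed_eq ((uhfProj β n).continuous.comp
    (continuous_const.mul continuous_id)) (continuous_const.mul (uhfProj β n).continuous))
    fun p hp a => ?_
  rw [← uhfHom_map β hp b, ← map_mul, uhfProj_uhfHom hp, uhfProj_uhfHom hp]
  exact blockTrace_amplify_mul _ _ b a

variable (β) in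
/-- The conditional expectation of `UHF(β)` onto its `n`-th matrix algebra. -/
noncomputable def uhfExp (n : ℕ) : UHF β →L[ℂ] UHF β := uhfHomL β n ∘L uhfProj β n

theorem uhfExp_apply (n : ℕ) (x : UHF β) : uhfExp β n x = uhfHom β n (uhfProj β n x) := rfl

theorem norm_uhfExp_le (n : ℕ) (x : UHF β) : ‖uhfExp β n x‖ ≤ ‖x‖ := by
  rw [uhfExp_apply, norm_uhfHom]
  exact norm_uhfProj_le n x

theorem uhfExp_uhfHom {n m : ℕ} (h : m ≤ n) (a : MatAlg (boxtimes β m)) :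
    uhfExp β n (uhfHom β m a) = uhfHom β m a := by
  rw [← uhfHom_map β h, uhfExp_apply, uhfProj_uhfHom_self]

theorem uhfExp_uhfExp_of_le {n m : ℕ} (h : m ≤ n) (x : UHF β) :
    uhfExp β n (uhfExp β m x) = uhfExp β m x := by
  rw [uhfExp_apply m, uhfExp_uhfHom h]

theorem uhfExp_uhfExp_of_ge {n m : ℕ} (h : n ≤ m) (x : UHF β) :
    uhfExp β n (uhfExp β m x) = uhfExp β n x := by
  rw [uhfExp_apply n, uhfExp_apply m, uhfProj_uhfHom h, blockTrace_uhfProj h, ← uhfExp_apply]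

theorem uhfExp_star (n : ℕ) (x : UHF β) : uhfExp β n (star x) = star (uhfExp β n x) := by
  rw [uhfExp_apply, uhfExp_apply, uhfProj_star, map_star]

theorem uhfExp_one (n : ℕ) : uhfExp β n 1 = 1 := by
  rw [← map_one (uhfHom β n), uhfExp_uhfHom le_rfl]

theorem uhfExp_mul (n : ℕ) (x y : UHF β) :
    uhfExp β n (uhfExp β n x * uhfExp β n y) = uhfExp β n x * uhfExp β n y := by
  rw [uhfExp_apply n x, uhfExp_apply n y, ← map_mul, uhfExp_uhfHom le_rfl]

theorem isCondExp_uhfExp (n : ℕ) : IsCondExp (uhfSub β n) (uhfExp β n) where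
  map_mem x := ⟨uhfProj β n x, rfl⟩
  map_eq := by
    rintro _ ⟨a, rfl⟩
    exact uhfExp_uhfHom le_rfl a
  contractive := norm_uhfExp_le n

/-- The expectations are eventually the identity on each matrix stage; contractivity carries the
convergence to the closure of the union. -/
theorem tendsto_uhfExp (x : UHF β) : Filter.Tendsto (fun n => uhfExp β n x) Filter.atTop (𝓝 x) := by
  rw [Metric.tendsto_atTop]
  intro ε hε
  obtain ⟨y, hy, hxy⟩ := Metric.dense_iff.mp (dense_iUnion_range_uhfHom β) x (ε / 2) (half_pos hε)
  obtain ⟨m, a, rfl⟩ := Set.mem_iUnion.mp hxy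
  rw [Metric.mem_ball, dist_eq_norm] at hy
  refine ⟨m, fun n hn => ?_⟩
  have h1 : uhfExp β n x - x =
      (uhfHom β m a - x) - uhfExp β n (uhfHom β m a - x) := by
    rw [map_sub, uhfExp_uhfHom hn]
    abel
  rw [dist_eq_norm, h1]
  calc _ ≤ ‖uhfHom β m a - x‖ + ‖uhfExp β n (uhfHom β m a - x)‖ := norm_sub_le _ _
    _ ≤ ‖uhfHom β m a - x‖ + ‖uhfHom β m a - x‖ := by
      gcongr
      exact norm_uhfExp_le n _
    _ < ε := by linarith

/-! ### The tracial state of a UHF algebra -/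

variable (β) in
/-- The tracial state of `UHF(β)`. -/
noncomputable def uhfTrace : WeakDual ℂ (UHF β) :=
  StrongDual.toWeakDual (LinearMap.toContinuousLinearMap (normTrace (boxtimes β 0)) ∘L uhfProj β 0)

/-- The trace is read off at the `1 × 1` stage; the adjunction tested against `1` shows that any
stage computes it. -/
theorem uhfTrace_apply (n : ℕ) (x : UHF β) :
    uhfTrace β x = normTrace (boxtimes β n) (uhfProj β n x) := by
  change normTrace (boxtimes β 0) (uhfProj β 0 x) = _
  have h := normTrace_mul_amplify (boxtimes_pos β 0) (boxtimes_dvd β (Nat.zero_le n))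
    (uhfProj β n x) 1
  rw [map_one, mul_one, mul_one, blockTrace_uhfProj (Nat.zero_le n)] at h
  exact h.symm

theorem uhfTrace_uhfHom (n : ℕ) (a : MatAlg (boxtimes β n)) :
    uhfTrace β (uhfHom β n a) = normTrace (boxtimes β n) a := by
  rw [uhfTrace_apply n, uhfProj_uhfHom_self]

theorem uhfTrace_uhfExp (n : ℕ) (x : UHF β) : uhfTrace β (uhfExp β n x) = uhfTrace β x := by
  rw [uhfExp_apply, uhfTrace_uhfHom, uhfTrace_apply n]

theorem uhfTrace_uhfHom_mul (n : ℕ) (b : MatAlg (boxtimes β n)) (x : UHF β) :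
    uhfTrace β (uhfHom β n b * x) = normTrace (boxtimes β n) (b * uhfProj β n x) := by
  rw [uhfTrace_apply n, uhfProj_uhfHom_mul]

theorem isTracialState_uhfTrace : IsTracialState (uhfTrace β) := by
  have hc : Continuous (uhfTrace β) := map_continuous _
  refine ⟨⟨fun x => ?_, ?_⟩, fun x y => ?_⟩
  · refine UHF.induction_on 0 x (isClosed_Ici.preimage
      (hc.comp (continuous_star.mul continuous_id))) fun n _ a => ?_
    rw [← map_star, ← map_mul, uhfTrace_uhfHom]
    exact normTrace_star_mul_self_nonneg a
  · rw [← map_one (uhfHom β 0), uhfTrace_uhfHom, normTrace_one (boxtimes_pos β 0)]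
  · refine UHF.induction_on 0 x (isClosed_eq (hc.comp (continuous_id.mul continuous_const))
      (hc.comp (continuous_const.mul continuous_id))) fun n _ a => ?_
    refine UHF.induction_on n y (isClosed_eq (hc.comp (continuous_const.mul continuous_id))
      (hc.comp (continuous_id.mul continuous_const))) fun m hm b => ?_
    rw [← uhfHom_map β hm a, ← map_mul, ← map_mul, uhfTrace_uhfHom, uhfTrace_uhfHom,
      normTrace_mul_comm]

theorem uhfTrace_nonneg (x : UHF β) : 0 ≤ uhfTrace β (star x * x) :=
  isTracialState_uhfTrace.1.1 x

/-- Pythagoras in the trace inner product: with `b = E_n x`, `0 ≤ τ((x - b)⋆(x - b)) = τ(x⋆x) -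
τ(b⋆b) = -τ(b⋆b)`, so `b = 0` by faithfulness on matrices. -/
theorem uhfExp_eq_zero_of_uhfTrace {x : UHF β} (h : uhfTrace β (star x * x) = 0) (n : ℕ) :
    uhfExp β n x = 0 := by
  set b := uhfProj β n x with hb
  have h1 : uhfTrace β (star (uhfHom β n b) * x) = normTrace (boxtimes β n) (star b * b) := by
    rw [← map_star, uhfTrace_uhfHom_mul]
  have h2 : uhfTrace β (star x * uhfHom β n b) = normTrace (boxtimes β n) (star b * b) := by
    rw [isTracialState_uhfTrace.2, uhfTrace_uhfHom_mul, uhfProj_star, ← hb, normTrace_mul_comm]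
  have h3 : uhfTrace β (star (uhfHom β n b) * uhfHom β n b) =
      normTrace (boxtimes β n) (star b * b) := by
    rw [← map_star, ← map_mul, uhfTrace_uhfHom]
  have h4 := uhfTrace_nonneg (x - uhfHom β n b)
  rw [star_sub, sub_mul, mul_sub, mul_sub, map_sub, map_sub, map_sub, h, h1, h2, h3] at h4
  have h5 := normTrace_star_mul_self_nonneg b
  have h6 : normTrace (boxtimes β n) (star b * b) = 0 :=
    le_antisymm (by simpa using h4) h5
  rw [uhfExp_apply, ← hb, eq_zero_of_normTrace_star_mul_self h6, map_zero]

theorem isFaithfulState_uhfTrace : IsFaithfulState (uhfTrace β) := by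
  intro x hx
  refine tendsto_nhds_unique (tendsto_uhfExp x) ?_
  simp only [uhfExp_eq_zero_of_uhfTrace hx]
  exact tendsto_const_nhds

end UHF

/-! ### Uniqueness of the trace and of the conditional expectations -/

/-- Cycling products of matrix units kills the off-diagonal entries and makes `f` agree on all
diagonal ones; `f 1 = 1` fixes the remaining constant. -/
theorem eq_normTrace_of_mul_comm {k : ℕ} (f : MatAlg k →ₗ[ℂ] ℂ)
    (hf : ∀ a b, f (a * b) = f (b * a)) (h1 : f 1 = 1) (hk : 0 < k) (a : MatAlg k) :
    f a = normTrace k a := by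
  let e : Fin k → Fin k → ℂ → MatAlg k := fun i j c => CStarMatrix.ofMatrix (Matrix.single i j c)
  have hmul : ∀ i j l c d, e i j c * e j l d = e i l (c * d) := fun i j l c d =>
    Matrix.single_mul_single_same c i j l d
  have hoff : ∀ i j, i ≠ j → ∀ c, f (e i j c) = 0 := by
    intro i j hij c
    have h2 : e i j c * e i i 1 = 0 := Matrix.single_mul_single_of_ne c i j i hij.symm 1
    have h3 : e i i 1 * e i j c = e i j c := by rw [hmul, one_mul]
    rw [← h3, hf, h2, map_zero]
  have hdiag : ∀ i j c, f (e i i c) = f (e j j c) := by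
    intro i j c
    have h2 : e i j c * e j i 1 = e i i c := by rw [hmul, mul_one]
    have h3 : e j i 1 * e i j c = e j j c := by rw [hmul, one_mul]
    rw [← h2, hf, h3]
  let i₀ : Fin k := ⟨0, hk⟩
  have hsmul : ∀ i c, f (e i i c) = c * f (e i₀ i₀ 1) := by
    intro i c
    have : e i₀ i₀ c = c • e i₀ i₀ 1 := by
      have := Matrix.smul_single c i₀ i₀ (1 : ℂ)
      rw [smul_eq_mul, mul_one] at this
      exact this.symm
    rw [hdiag i i₀, this, map_smul, smul_eq_mul]
  have hsum : ∀ x : MatAlg k, f x = (∑ i, x i i) * f (e i₀ i₀ 1) := by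
    intro x
    have hx : x = ∑ i, ∑ j, e i j (x i j) := Matrix.matrix_eq_sum_single x
    conv_lhs => rw [hx]
    rw [map_sum, Finset.sum_mul]
    refine Finset.sum_congr rfl fun i _ => ?_
    rw [map_sum, Finset.sum_eq_single i, hsmul]
    · intro j _ hj
      exact hoff i j hj.symm _
    · simp
  have hc : (k : ℂ) * f (e i₀ i₀ 1) = 1 := by
    refine Eq.trans ?_ ((hsum 1).symm.trans h1)
    simp
  rw [hsum, normTrace_apply, mul_comm, eq_inv_of_mul_eq_one_right hc]

theorem eq_uhfTrace {β : BaireSeq} {σ : WeakDual ℂ (UHF β)} (hσ : IsTracialState σ) :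
    σ = uhfTrace β := by
  refine DFunLike.ext _ _ fun x => ?_
  refine UHF.induction_on 0 x (isClosed_eq (map_continuous σ) (map_continuous _)) fun n _ a => ?_
  rw [uhfTrace_uhfHom]
  refine eq_normTrace_of_mul_comm
    ((σ : UHF β →ₗ[ℂ] ℂ) ∘ₗ (uhfHom β n).toAlgHom.toLinearMap) (fun a b => ?_) ?_
    (boxtimes_pos β n) a
  · change σ (uhfHom β n (a * b)) = σ (uhfHom β n (b * a))
    rw [map_mul (uhfHom β n), map_mul (uhfHom β n), hσ.2]
  · change σ (uhfHom β n 1) = 1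
    rw [map_one, hσ.1.2]

/-! ### Contractive projections commute with multiplication by projections (Tomiyama) -/

section Tomiyama

variable {A : Type u} [CStarAlgebra A] {B : StarSubalgebra ℂ A} {F : A →L[ℂ] A}

theorem norm_le_one_of_projection {p : A} (hp : IsSelfAdjoint p) (hpp : p * p = p) : ‖p‖ ≤ 1 := by
  have h := CStarRing.norm_star_mul_self (x := p)
  rw [hp.star_eq, hpp] at h
  by_contra h3
  nlinarith

/-- `IsCondExp` demands no module property, so it is extracted from contractivity. The element `c =
(1 - p) F(p a)` is fixed by `F`, hence `p a + t c` is sent by `(1 - p) F` to `(1 + t) c`, while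
orthogonality of `p a` and `c` gives `‖p a + t c‖² ≤ ‖p a‖² + t² ‖c‖²`. The `t²` terms cancel and
the linear term must vanish. -/
theorem IsCondExp.compl_mul_map_mul (hF : IsCondExp B F) {p : A} (hpB : p ∈ B)
    (hp : IsSelfAdjoint p) (hpp : p * p = p) (a : A) : (1 - p) * F (p * a) = 0 := by
  set c := (1 - p) * F (p * a) with hc
  have hq : IsSelfAdjoint (1 - p) := (IsSelfAdjoint.one A).sub hp
  have hqq : (1 - p) * (1 - p) = 1 - p := by
    rw [mul_sub, sub_mul, sub_mul, hpp]; simp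
  have hpq : p * (1 - p) = 0 := by rw [mul_sub, hpp]; simp
  have hqc : (1 - p) * c = c := by rw [hc, ← mul_assoc, hqq]
  have hpc : p * c = 0 := by rw [hc, ← mul_assoc, hpq, zero_mul]
  have hcB : c ∈ B := B.mul_mem (B.sub_mem B.one_mem hpB) (hF.map_mem _)
  have key : ∀ t : ℝ, 0 ≤ t → (1 + 2 * t) * ‖c‖ ^ 2 ≤ ‖p * a‖ ^ 2 := by
    intro t ht
    set x := p * a + (t : ℂ) • c with hx
    have h1 : (1 - p) * F x = ((1 + t : ℝ) : ℂ) • c := by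
      rw [hx, map_add, map_smul, hF.map_eq c hcB, mul_add, ← hc, mul_smul_comm, hqc]
      push_cast
      rw [add_smul, one_smul]
    have h2 : (1 + t) * ‖c‖ ≤ ‖x‖ := by
      calc (1 + t) * ‖c‖ = ‖(1 - p) * F x‖ := by
            rw [h1, norm_smul, Complex.norm_real, Real.norm_of_nonneg (by positivity)]
        _ ≤ ‖1 - p‖ * ‖F x‖ := norm_mul_le _ _
        _ ≤ 1 * ‖x‖ := mul_le_mul (norm_le_one_of_projection hq hqq) (hF.contractive x)
            (norm_nonneg _) zero_le_one
        _ = ‖x‖ := one_mul _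
    have h3 : star x * x = star (p * a) * (p * a) + ((t : ℂ) * t) • (star c * c) := by
      have e1 : star (p * a) * c = 0 := by
        rw [star_mul, hp.star_eq, mul_assoc, hpc, mul_zero]
      have e2 : star c * (p * a) = 0 := by
        have : star (star (p * a) * c) = 0 := by rw [e1, star_zero]
        rwa [star_mul, star_star] at this
      rw [hx, star_add, star_smul, add_mul, mul_add, mul_add, mul_smul_comm, e1, smul_mul_assoc,
        e2, smul_mul_assoc, mul_smul_comm, smul_smul]
      simp
    have h4 : ‖x‖ ^ 2 ≤ ‖p * a‖ ^ 2 + t ^ 2 * ‖c‖ ^ 2 := by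
      rw [sq, ← CStarRing.norm_star_mul_self, h3]
      refine (norm_add_le _ _).trans ?_
      rw [norm_smul, CStarRing.norm_star_mul_self, CStarRing.norm_star_mul_self,
        norm_mul (t : ℂ), Complex.norm_real, Real.norm_of_nonneg ht]
      exact le_of_eq (by ring)
    have h5 : ((1 + t) * ‖c‖) ^ 2 ≤ ‖x‖ ^ 2 := pow_le_pow_left₀ (by positivity) h2 2
    nlinarith
  by_contra h0
  have hc0 : 0 < ‖c‖ ^ 2 := by positivity
  -- This `t` turns the bound into `‖c‖² + 2‖p a‖² ≤ ‖p a‖²`.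
  have h1 := key (‖p * a‖ ^ 2 / ‖c‖ ^ 2) (by positivity)
  have h2 : ‖p * a‖ ^ 2 / ‖c‖ ^ 2 * ‖c‖ ^ 2 = ‖p * a‖ ^ 2 := div_mul_cancel₀ _ hc0.ne'
  nlinarith [sq_nonneg ‖p * a‖]

/-- The previous lemma for `p` gives `F(p a) = p F(p a)`, and for `1 - p` it gives `p F(a) = p F(p
a)`. -/
theorem IsCondExp.map_projection_mul (hF : IsCondExp B F) {p : A} (hpB : p ∈ B)
    (hp : IsSelfAdjoint p) (hpp : p * p = p) (a : A) : F (p * a) = p * F a := by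
  have h1 := hF.compl_mul_map_mul hpB hp hpp a
  have hqq : (1 - p) * (1 - p) = 1 - p := by
    rw [mul_sub, sub_mul, sub_mul, hpp]; simp
  have h2 := hF.compl_mul_map_mul (B.sub_mem B.one_mem hpB) ((IsSelfAdjoint.one A).sub hp) hqq a
  rw [sub_sub_cancel, sub_mul, one_mul, map_sub, mul_sub, sub_eq_zero] at h2
  rw [sub_mul, one_mul, sub_eq_zero] at h1
  rw [h1, h2]

end Tomiyama

/-- The rank-one projection onto `ℂ v` yields `⟨v, x v⟩ = 0` for every `v`; over `ℂ` polarization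
then gives `x = 0`. -/
theorem eq_zero_of_normTrace_projection_mul {k : ℕ} {x : MatAlg k}
    (h : ∀ p : MatAlg k, IsSelfAdjoint p → p * p = p → normTrace k (p * x) = 0) : x = 0 := by
  have h1 : Matrix.toEuclideanLin (CStarMatrix.ofMatrix.symm x) = 0 := by
    rw [← inner_map_self_eq_zero]
    intro v
    by_cases hv : v = 0
    · simp [hv]
    have hn : (∑ i, v i * star (v i)) = ((‖v‖ ^ 2 : ℝ) : ℂ) := by
      rw [EuclideanSpace.norm_sq_eq]
      push_cast
      exact Finset.sum_congr rfl fun i _ => Complex.mul_conj' _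
    have hn0 : ((‖v‖ ^ 2 : ℝ) : ℂ) ≠ 0 := by
      have : ‖v‖ ≠ 0 := norm_ne_zero_iff.mpr hv
      exact_mod_cast pow_ne_zero 2 this
    set c : ℂ := ((‖v‖ ^ 2 : ℝ) : ℂ)⁻¹ with hc
    have hcs : star c = c := by
      rw [hc, star_inv₀]
      simp
    let p : MatAlg k := CStarMatrix.ofMatrix (Matrix.of fun i j => c * (v i * star (v j)))
    have hpa : ∀ i j, p i j = c * (v i * star (v j)) := fun _ _ => rfl
    have hp : IsSelfAdjoint p := by
      ext i j
      rw [CStarMatrix.star_apply, hpa, hpa, star_mul', star_mul', hcs, star_star, mul_comm (star _)]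
    have hpp : p * p = p := by
      ext i j
      simp only [CStarMatrix.mul_apply, hpa]
      calc ∑ l, c * (v i * star (v l)) * (c * (v l * star (v j)))
          = c * (v i * star (v j)) * (c * ∑ l, v l * star (v l)) := by
            rw [Finset.mul_sum, Finset.mul_sum]
            exact Finset.sum_congr rfl fun l _ => by ring
        _ = c * (v i * star (v j)) := by rw [hn, hc, inv_mul_cancel₀ hn0, mul_one]
    have h2 := h p hp hpp
    rw [normTrace_mul] at h2
    obtain ⟨i₀⟩ : Nonempty (Fin k) := by
      by_contra h3
      rw [not_nonempty_iff] at h3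
      exact hv (Subsingleton.elim _ _)
    have hk : (k : ℂ)⁻¹ ≠ 0 := inv_ne_zero (by exact_mod_cast i₀.pos.ne')
    have h3 := (mul_eq_zero.mp h2).resolve_left hk
    have h4 : c * ∑ i, ∑ j, v i * star (v j) * x j i = 0 := by
      rw [← h3, Finset.mul_sum]
      refine Finset.sum_congr rfl fun i _ => ?_
      rw [Finset.mul_sum]
      exact Finset.sum_congr rfl fun j _ => by rw [hpa]; ring
    have h5 := (mul_eq_zero.mp h4).resolve_left (inv_ne_zero hn0)
    have h6 : inner ℂ v (Matrix.toEuclideanLin (CStarMatrix.ofMatrix.symm x) v) = 0 := by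
      rw [← h5, Finset.sum_comm, PiLp.inner_apply]
      refine Finset.sum_congr rfl fun j _ => ?_
      rw [Matrix.toLpLin_apply]
      change (∑ i, x j i * v i) * star (v j) = _
      rw [Finset.sum_mul]
      exact Finset.sum_congr rfl fun i _ => by ring
    rw [← inner_conj_symm, h6, map_zero]
  have h2 : CStarMatrix.ofMatrix.symm x = 0 := by
    rwa [LinearEquiv.map_eq_zero_iff] at h1
  exact h2

/-- For a projection `p` of the `n`-th algebra, `τ(p F(a)) = τ(F(p a)) = τ(p a)`, which is also `τ(p
E_n(a))`. Hence `F(a) - E_n(a)`, a matrix, is trace-orthogonal to all projections. -/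
theorem eq_uhfExp {β : BaireSeq} {n : ℕ} {F : UHF β →L[ℂ] UHF β} (hF : IsCondExp (uhfSub β n) F)
    (hτ : ∀ a, uhfTrace β (F a) = uhfTrace β a) : F = uhfExp β n := by
  ext a
  obtain ⟨y, hy⟩ := hF.map_mem a
  have hy' : uhfHom β n y = F a := hy
  rw [← hy', uhfExp_apply]
  congr 1
  rw [← sub_eq_zero]
  refine eq_zero_of_normTrace_projection_mul fun p hp hpp => ?_
  have h1 : uhfTrace β (uhfHom β n p * F a) = uhfTrace β (uhfHom β n p * a) := by
    have h2 : uhfHom β n p ∈ uhfSub β n := ⟨p, rfl⟩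
    rw [← hF.map_projection_mul h2 (hp.map (uhfHom β n)) (by rw [← map_mul, hpp]), hτ]
  rw [uhfTrace_uhfHom_mul, uhfTrace_uhfHom_mul, ← hy', uhfProj_uhfHom_self] at h1
  rw [mul_sub, map_sub, h1, sub_self]

/-! ### States -/

section States

variable {A : Type u} [CStarAlgebra A]

/-- Apply `φ` to `-‖a‖ ≤ a ≤ ‖a‖` in the spectral order. -/
theorem stateSpace_apply_selfAdjoint {φ : WeakDual ℂ A} (hφ : φ ∈ stateSpace A) {a : A}
    (ha : IsSelfAdjoint a) : ∃ r : ℝ, φ a = r ∧ |r| ≤ ‖a‖ := by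
  let _ := CStarAlgebra.spectralOrder A
  let _ := CStarAlgebra.spectralOrderedRing A
  have hpos : ∀ b : A, 0 ≤ b → 0 ≤ φ b := by
    intro b hb
    obtain ⟨c, rfl⟩ := CStarAlgebra.nonneg_iff_eq_star_mul_self.mp hb
    exact hφ.1 c
  have hn : φ (algebraMap ℝ A ‖a‖) = (‖a‖ : ℂ) := by
    rw [IsScalarTower.algebraMap_apply ℝ ℂ A, Algebra.algebraMap_eq_smul_one, map_smul, hφ.2]
    simp
  have h1 := hpos _ (sub_nonneg.mpr ha.le_algebraMap_norm_self)
  have h2 := hpos _ (sub_nonneg.mpr ha.neg_algebraMap_norm_le_self)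
  rw [map_sub, hn] at h1
  rw [sub_neg_eq_add, map_add, hn] at h2
  obtain ⟨h1r, h1i⟩ := Complex.nonneg_iff.mp h1
  obtain ⟨h2r, h2i⟩ := Complex.nonneg_iff.mp h2
  simp only [Complex.sub_re, Complex.ofReal_re, Complex.sub_im, Complex.ofReal_im,
    Complex.add_re] at h1r h1i h2r
  refine ⟨(φ a).re, Complex.ext rfl (by simp; linarith), abs_le.mpr ⟨by linarith, by linarith⟩⟩

/-- Rotating `a` by a phase makes `φ a` real and nonnegative, so only the real part of `a`
contributes. -/
theorem norm_stateSpace_apply_le {φ : WeakDual ℂ A} (hφ : φ ∈ stateSpace A) (a : A) :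
    ‖φ a‖ ≤ ‖a‖ := by
  by_cases h0 : φ a = 0
  · rw [h0, norm_zero]; exact norm_nonneg a
  have hn : (‖φ a‖ : ℂ) ≠ 0 := by exact_mod_cast norm_ne_zero_iff.mpr h0
  set c : ℂ := star (φ a) / ‖φ a‖ with hc
  have hcn : ‖c‖ = 1 := by
    rw [hc, norm_div, norm_star, Complex.norm_real, norm_norm,
      div_self (norm_ne_zero_iff.mpr h0)]
  have hφc : φ (c • a) = (‖φ a‖ : ℂ) := by
    rw [map_smul, smul_eq_mul, hc, div_mul_eq_mul_div, div_eq_iff hn]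
    exact (Complex.conj_mul' _).trans (sq _)
  obtain ⟨r, hr, hrn⟩ := stateSpace_apply_selfAdjoint hφ (realPart (c • a)).2
  obtain ⟨s, hs, -⟩ := stateSpace_apply_selfAdjoint hφ (imaginaryPart (c • a)).2
  have h1 : φ (c • a) = r + Complex.I * s := by
    conv_lhs => rw [← realPart_add_I_smul_imaginaryPart (c • a)]
    rw [map_add φ, map_smul φ, hr, hs, smul_eq_mul]
  rw [hφc] at h1
  have h2 : ‖φ a‖ = r := by simpa using congrArg Complex.re h1
  rw [h2]
  calc r ≤ |r| := le_abs_self r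
    _ ≤ ‖realPart (c • a)‖ := hrn
    _ ≤ ‖c • a‖ := realPart.norm_le _
    _ = ‖a‖ := by rw [norm_smul, hcn, one_mul]

/-- For `h = a⋆a`, comparing `φ(h + it)` with `‖h + it‖² ≤ ‖h‖² + t²` for all real `t` forces `φ h`
to be real, and `‖‖h‖ - h‖ ≤ ‖h‖` forces `φ h ≥ 0`. This makes `φ ∘ P` a state when `P` is merely a
unital contraction. -/
theorem mem_stateSpace_of_norm_le {φ : WeakDual ℂ A} (hφ : ∀ a, ‖φ a‖ ≤ ‖a‖) (h1 : φ 1 = 1) :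
    φ ∈ stateSpace A := by
  let _ := CStarAlgebra.spectralOrder A
  let _ := CStarAlgebra.spectralOrderedRing A
  refine ⟨fun a => ?_, h1⟩
  set h := star a * a with hh
  have hsa : IsSelfAdjoint h := IsSelfAdjoint.star_mul_self a
  have h0 : 0 ≤ h := star_mul_self_nonneg a
  have hone : ‖(1 : A)‖ ≤ 1 := by
    have := CStarRing.norm_star_mul_self (x := (1 : A))
    rw [star_one, mul_one] at this
    by_contra h3
    nlinarith
  have him : (φ h).im = 0 := by
    have key : ∀ t : ℝ, ((φ h).im + t) ^ 2 ≤ ‖h‖ ^ 2 + t ^ 2 := by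
      intro t
      set x : A := h + (t * Complex.I) • (1 : A) with hx
      have hx1 : φ x = φ h + t * Complex.I := by
        rw [hx, map_add, map_smul, h1, smul_eq_mul, mul_one]
      have hx2 : star x * x = h * h + ((t ^ 2 : ℝ) : ℂ) • (1 : A) := by
        rw [hx, star_add, hsa.star_eq, star_smul, star_one, add_mul, mul_add, mul_add]
        simp only [smul_mul_assoc, mul_smul_comm, one_mul, mul_one, smul_smul]
        have e1 : star ((t : ℂ) * Complex.I) = -(t * Complex.I) := by simp
        have e2 : (t : ℂ) * Complex.I * -(t * Complex.I) = ((t ^ 2 : ℝ) : ℂ) := by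
          push_cast
          linear_combination (-(t : ℂ) ^ 2) * Complex.I_mul_I
        rw [e1, e2, neg_smul]
        abel
      have hx3 : ‖x‖ ^ 2 ≤ ‖h‖ ^ 2 + t ^ 2 := by
        rw [sq, ← CStarRing.norm_star_mul_self, hx2]
        refine (norm_add_le _ _).trans ?_
        rw [norm_smul, Complex.norm_real, Real.norm_of_nonneg (sq_nonneg t)]
        have := norm_mul_le h h
        nlinarith [sq_nonneg t]
      have hx4 : |(φ h).im + t| ≤ ‖x‖ := by
        have e := Complex.abs_im_le_norm (φ x)
        rw [hx1] at e
        have e2 : (φ h + t * Complex.I).im = (φ h).im + t := by simp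
        rw [e2, ← hx1] at e
        exact e.trans (hφ x)
      rw [← sq_abs]
      exact (pow_le_pow_left₀ (abs_nonneg _) hx4 2).trans hx3
    by_contra hne
    -- Chosen so that the cross term `2 t Im φ(h)` equals `‖h‖² + 1` and exceeds the bound.
    have hk := key ((‖h‖ ^ 2 + 1) / (2 * (φ h).im))
    have e : 2 * (φ h).im * ((‖h‖ ^ 2 + 1) / (2 * (φ h).im)) = ‖h‖ ^ 2 + 1 := by
      field_simp
    nlinarith [sq_nonneg (φ h).im]
  have hle : ‖algebraMap ℝ A ‖h‖ - h‖ ≤ ‖h‖ := by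
    refine (CStarAlgebra.norm_le_norm_of_nonneg_of_le (b := algebraMap ℝ A ‖h‖)
      (sub_nonneg.mpr hsa.le_algebraMap_norm_self) (sub_le_self _ h0)).trans ?_
    rw [Algebra.algebraMap_eq_smul_one, norm_smul, norm_norm]
    exact mul_le_of_le_one_right (norm_nonneg _) hone
  have hn : φ (algebraMap ℝ A ‖h‖) = (‖h‖ : ℂ) := by
    rw [IsScalarTower.algebraMap_apply ℝ ℂ A, Algebra.algebraMap_eq_smul_one, map_smul, h1]
    simp
  have h2 := (Complex.re_le_norm _).trans ((hφ _).trans hle)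
  rw [map_sub, hn, Complex.sub_re, Complex.ofReal_re] at h2
  exact Complex.nonneg_iff.mpr ⟨by linarith, him.symm⟩

theorem isClosed_stateSpace : IsClosed (stateSpace A) := by
  have h : stateSpace A = (⋂ a : A, {φ | 0 ≤ φ (star a * a)}) ∩ {φ | φ 1 = 1} := by
    ext φ
    simp [stateSpace]
  rw [h]
  refine IsClosed.inter (isClosed_iInter fun a => ?_) ?_
  · exact isClosed_Ici.preimage (WeakDual.eval_continuous (star a * a))
  · exact isClosed_eq (WeakDual.eval_continuous 1) continuous_const

theorem isCompact_stateSpace : IsCompact (stateSpace A) := by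
  refine (WeakDual.isCompact_closedBall (𝕜 := ℂ) (E := A) 0 1).of_isClosed_subset
    isClosed_stateSpace fun φ hφ => ?_
  rw [Set.mem_preimage, mem_closedBall_zero_iff]
  refine ContinuousLinearMap.opNorm_le_bound _ zero_le_one fun a => ?_
  rw [one_mul]
  exact norm_stateSpace_apply_le hφ a

theorem dualMap_apply {D : Type u} [CStarAlgebra D] (f : A →⋆ₐ[ℂ] D) (φ : WeakDual ℂ D) (a : A) :
    dualMap f φ a = φ (f a) := rfl

theorem dualMap_mem_stateSpace {D : Type u} [CStarAlgebra D] (f : A →⋆ₐ[ℂ] D) {φ : WeakDual ℂ D}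
    (hφ : φ ∈ stateSpace D) : dualMap f φ ∈ stateSpace A := by
  refine ⟨fun a => ?_, ?_⟩
  · rw [dualMap_apply, map_mul, map_star]
    exact hφ.1 _
  · rw [dualMap_apply, map_one, hφ.2]

theorem weakDual_ext_selfAdjoint {φ ψ : WeakDual ℂ A} (h : ∀ a : selfAdjoint A, φ a = ψ a) :
    φ = ψ := by
  refine DFunLike.ext _ _ fun a => ?_
  rw [← realPart_add_I_smul_imaginaryPart a, map_add, map_add, map_smul, map_smul, h, h]

end States

/-! ### Lip-norms with totally bounded balls -/

section LipBall

variable {A : Type u} [CStarAlgebra A]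

/-- A seminorm with values in `[0, ∞]` on the self-adjoint part of `A` whose unit ball is totally
bounded modulo the scalars. -/
structure IsTotallyBoundedLip (L : selfAdjoint A → ℝ≥0∞) : Prop where
  add_le : ∀ a b, L (a + b) ≤ L a + L b
  smul : ∀ (r : ℝ) (a), L (r • a) = ENNReal.ofReal |r| * L a
  dense_dom : Dense {a | L a ≠ ∞}
  eq_zero_iff : ∀ a, L a = 0 ↔ ∃ r : ℝ, (a : A) = (r : ℂ) • 1
  lowerSemicontinuous : LowerSemicontinuous L
  totallyBounded : ∃ R : ℝ, (∀ a, L a ≤ 1 → ∃ r : ℝ, ‖a - r • 1‖ ≤ R) ∧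
    TotallyBounded {a | L a ≤ 1 ∧ ‖a‖ ≤ R}

variable {L : selfAdjoint A → ℝ≥0∞}

theorem mongeKantorovich_self (φ : WeakDual ℂ A) : mongeKantorovich L φ φ = 0 := by
  simp [mongeKantorovich]

theorem mongeKantorovich_comm (φ ψ : WeakDual ℂ A) :
    mongeKantorovich L φ ψ = mongeKantorovich L ψ φ := by
  simp only [mongeKantorovich, edist_comm]

theorem mongeKantorovich_triangle (φ ψ χ : WeakDual ℂ A) :
    mongeKantorovich L φ χ ≤ mongeKantorovich L φ ψ + mongeKantorovich L ψ χ :=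
  iSup₂_le fun a ha => (edist_triangle _ (ψ a) _).trans
    (add_le_add (le_iSup₂_of_le a ha le_rfl) (le_iSup₂_of_le a ha le_rfl))

theorem continuous_of_eventually_dist_lt {S M : Type*} [TopologicalSpace S] [MetricSpace M]
    {f : S → M} (hf : ∀ x, ∀ ε > 0, ∀ᶠ y in 𝓝 x, dist (f y) (f x) < ε) : Continuous f :=
  continuous_iff_continuousAt.mpr fun x => Metric.tendsto_nhds.mpr (hf x)

/-- A continuous bijection from a compact space to a Hausdorff one is a homeomorphism. -/
theorem topology_eq_induced_of_compact {S M : Type*} [t : TopologicalSpace S] [CompactSpace S]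
    [MetricSpace M] (e : S ≃ M) (he : Continuous e) :
    t = TopologicalSpace.induced e inferInstance :=
  (he.isClosedEmbedding e.injective).isInducing.eq_induced

namespace IsTotallyBoundedLip

variable (hL : IsTotallyBoundedLip L)
include hL

theorem apply_sub_smul_one_le (a : selfAdjoint A) (r : ℝ) : L (a - r • 1) ≤ L a := by
  have h1 : L 1 = 0 := (hL.eq_zero_iff 1).mpr ⟨1, by simp⟩
  have h2 := hL.add_le a ((-r) • 1)
  rwa [hL.smul, h1, mul_zero, add_zero, neg_smul, ← sub_eq_add_neg] at h2

/-- States agree on scalars, so subtracting a scalar changes nothing and only the part of the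
Lip-ball of norm at most `R` has to be tested. -/
theorem edist_apply_le {φ ψ : WeakDual ℂ A} (hφ : φ ∈ stateSpace A) (hψ : ψ ∈ stateSpace A)
    {c : ℝ≥0∞} (R : ℝ) (hR : ∀ a, L a ≤ 1 → ∃ r : ℝ, ‖a - r • 1‖ ≤ R)
    (hc : ∀ a : selfAdjoint A, L a ≤ 1 → ‖a‖ ≤ R → edist (φ a) (ψ a) ≤ c) :
    mongeKantorovich L φ ψ ≤ c := by
  refine iSup₂_le fun a ha => ?_
  obtain ⟨r, hr⟩ := hR a ha
  have h := hc _ ((hL.apply_sub_smul_one_le a r).trans ha) hr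
  have e : ((a - r • 1 : selfAdjoint A) : A) = (a : A) - (r : ℂ) • 1 := by simp
  rwa [e, map_sub, map_sub, map_smul, map_smul, hφ.2, hψ.2, edist_sub_right] at h

theorem mongeKantorovich_ne_top {φ ψ : WeakDual ℂ A} (hφ : φ ∈ stateSpace A)
    (hψ : ψ ∈ stateSpace A) : mongeKantorovich L φ ψ ≠ ∞ := by
  obtain ⟨R, hR, -⟩ := hL.totallyBounded
  refine ne_top_of_le_ne_top (ENNReal.ofReal_ne_top (r := R + R))
    (hL.edist_apply_le hφ hψ R hR fun a _ ha => ?_)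
  rw [edist_dist]
  refine ENNReal.ofReal_le_ofReal ((dist_le_norm_add_norm _ _).trans (add_le_add ?_ ?_))
  · exact (norm_stateSpace_apply_le hφ _).trans ha
  · exact (norm_stateSpace_apply_le hψ _).trans ha

/-- Rescaling extends equality from the unit ball of `L` to its domain, and density extends it to
all self-adjoint elements. -/
theorem eq_of_mongeKantorovich_eq_zero {φ ψ : WeakDual ℂ A} (h : mongeKantorovich L φ ψ = 0) :
    φ = ψ := by
  have h1 : ∀ a, L a ≤ 1 → φ a = ψ a := by
    intro a ha
    rw [← edist_eq_zero, ← nonpos_iff_eq_zero, ← h]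
    exact le_iSup₂_of_le (f := fun (a : selfAdjoint A) (_ : L a ≤ 1) => edist (φ a) (ψ a)) a ha
      le_rfl
  have h2 : ∀ a, L a ≠ ∞ → φ a = ψ a := by
    intro a ha
    set r : ℝ := ((L a).toReal + 1)⁻¹ with hr
    have hr0 : 0 < r := by positivity
    have hra : L (r • a) ≤ 1 := by
      rw [hL.smul, abs_of_pos hr0, ← ENNReal.ofReal_toReal ha, ← ENNReal.ofReal_mul hr0.le]
      rw [← ENNReal.ofReal_one]
      refine ENNReal.ofReal_le_ofReal ?_
      rw [hr, inv_mul_le_iff₀ (by positivity)]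
      linarith
    have h3 := h1 _ hra
    have e : ((r • a : selfAdjoint A) : A) = (r : ℂ) • (a : A) := by simp
    rw [e, map_smul, map_smul] at h3
    exact smul_right_injective ℂ (by exact_mod_cast hr0.ne' : (r : ℂ) ≠ 0) h3
  refine weakDual_ext_selfAdjoint fun a => ?_
  have hcl : IsClosed {a : selfAdjoint A | φ a = ψ a} :=
    isClosed_eq ((map_continuous φ).comp continuous_subtype_val)
      ((map_continuous ψ).comp continuous_subtype_val)
  exact hcl.closure_subset_iff.mpr h2 (hL.dense_dom a)

/-- A finite `ε/4`-net of the bounded Lip-ball turns weak⋆ closeness at finitely many elements into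
closeness that is uniform over the ball, states being contractive. -/
theorem mongeKantorovich_nhds (φ : stateSpace A) {ε : ℝ} (hε : 0 < ε) :
    ∀ᶠ ψ : stateSpace A in 𝓝 φ, mongeKantorovich L ψ φ ≤ ENNReal.ofReal ε := by
  obtain ⟨R, hR, htb⟩ := hL.totallyBounded
  obtain ⟨t, ht, hcov⟩ := Metric.totallyBounded_iff.mp htb (ε / 4) (by positivity)
  have hev : ∀ᶠ ψ : stateSpace A in 𝓝 φ, ∀ b ∈ t, dist ((ψ : WeakDual ℂ A) b) ((φ : WeakDual ℂ A) b)
      < ε / 4 := by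
    rw [Filter.eventually_all_finite ht]
    intro b _
    have hc : Continuous fun ψ : stateSpace A => (ψ : WeakDual ℂ A) b :=
      (WeakDual.eval_continuous (b : A)).comp continuous_subtype_val
    exact (hc.tendsto φ).eventually (Metric.ball_mem_nhds _ (by positivity))
  filter_upwards [hev] with ψ hψ
  refine hL.edist_apply_le ψ.2 φ.2 R hR fun a ha haR => ?_
  obtain ⟨b, hb, hab⟩ := Set.mem_iUnion₂.mp (hcov ⟨ha, haR⟩)
  rw [Metric.mem_ball, dist_eq_norm] at hab
  have hab' : ‖(a : A) - b‖ < ε / 4 := hab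
  rw [edist_dist]
  refine ENNReal.ofReal_le_ofReal ?_
  have h1 : dist ((ψ : WeakDual ℂ A) a) ((ψ : WeakDual ℂ A) b) ≤ ‖(a : A) - b‖ := by
    rw [dist_eq_norm, ← map_sub]
    exact norm_stateSpace_apply_le ψ.2 _
  have h2 : dist ((φ : WeakDual ℂ A) b) ((φ : WeakDual ℂ A) a) ≤ ‖(a : A) - b‖ := by
    rw [dist_comm, dist_eq_norm, ← map_sub]
    exact norm_stateSpace_apply_le φ.2 _
  have h3 := hψ b hb
  have h4 := dist_triangle4 ((ψ : WeakDual ℂ A) a) ((ψ : WeakDual ℂ A) b)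
    ((φ : WeakDual ℂ A) b) ((φ : WeakDual ℂ A) a)
  linarith

/-- Rieffel's criterion: the identity from the weak⋆ compact state space to the Monge–Kantorovich
metric space is continuous, hence a homeomorphism. -/
theorem metrizes : ∃ m : MetricSpace (stateSpace A),
    m.toUniformSpace.toTopologicalSpace = instTopologicalSpaceSubtype ∧
      ∀ φ ψ : stateSpace A, ENNReal.ofReal (m.dist φ ψ) = mongeKantorovich L φ ψ := by
  let m : MetricSpace (stateSpace A) :=
    { dist := fun φ ψ => (mongeKantorovich L φ ψ).toReal
      dist_self := fun φ => by rw [mongeKantorovich_self, ENNReal.toReal_zero]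
      dist_comm := fun φ ψ => by rw [mongeKantorovich_comm]
      dist_triangle := fun φ ψ χ => by
        rw [← ENNReal.toReal_add (hL.mongeKantorovich_ne_top φ.2 ψ.2)
          (hL.mongeKantorovich_ne_top ψ.2 χ.2)]
        exact ENNReal.toReal_mono (ENNReal.add_ne_top.mpr
          ⟨hL.mongeKantorovich_ne_top φ.2 ψ.2, hL.mongeKantorovich_ne_top ψ.2 χ.2⟩)
          (mongeKantorovich_triangle _ _ _)
      eq_of_dist_eq_zero := fun {φ ψ} h => Subtype.ext <| hL.eq_of_mongeKantorovich_eq_zero <|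
        ((ENNReal.toReal_eq_zero_iff _).mp h).resolve_right
          (hL.mongeKantorovich_ne_top φ.2 ψ.2) }
  have hdist : ∀ φ ψ : stateSpace A, m.dist φ ψ = (mongeKantorovich L φ ψ).toReal :=
    fun _ _ => rfl
  refine ⟨m, ?_, fun φ ψ => by
    rw [hdist, ENNReal.ofReal_toReal (hL.mongeKantorovich_ne_top φ.2 ψ.2)]⟩
  have := isCompact_iff_compactSpace.mp (isCompact_stateSpace (A := A))
  have hcont : @Continuous _ _ instTopologicalSpaceSubtype
      m.toUniformSpace.toTopologicalSpace (Equiv.refl (stateSpace A)) := by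
    refine @continuous_of_eventually_dist_lt _ _ _ m _ fun φ ε hε => ?_
    filter_upwards [hL.mongeKantorovich_nhds φ (half_pos hε)] with ψ hψ
    change m.dist ψ φ < ε
    rw [hdist]
    have := ENNReal.toReal_mono ENNReal.ofReal_ne_top hψ
    rw [ENNReal.toReal_ofReal (half_pos hε).le] at this
    linarith
  have h := @topology_eq_induced_of_compact _ _ _ _ m (Equiv.refl (stateSpace A)) hcont
  exact (h.trans (@induced_id _ m.toUniformSpace.toTopologicalSpace)).symm

theorem isLipNorm : IsLipNorm L where
  add_le := hL.add_le
  smul := hL.smul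
  dense_dom := hL.dense_dom
  eq_zero_iff := hL.eq_zero_iff
  metrizes := hL.metrizes
  lowerSemicontinuous := hL.lowerSemicontinuous

end IsTotallyBoundedLip

end LipBall

/-! ### Retractions of Lip-norms -/

section Retraction

variable {A B : Type u} [CStarAlgebra A] [CStarAlgebra B]

/-- The map induced by a ⋆-homomorphism between self-adjoint parts. -/
def saMap (f : A →⋆ₐ[ℂ] B) (a : selfAdjoint A) : selfAdjoint B := ⟨f a, a.2.map f⟩

theorem coe_saMap (f : A →⋆ₐ[ℂ] B) (a : selfAdjoint A) : (saMap f a : B) = f a := rfl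

/-- A contractive linear retraction of `A` onto a copy of `B` which decreases Lip-norms and moves
the elements of the unit ball of the Lip-norm at most by `ε`. -/
structure LipRetraction (LA : selfAdjoint A → ℝ≥0∞) (LB : selfAdjoint B → ℝ≥0∞) (ε : ℝ≥0∞) where
  incl : B →⋆ₐ[ℂ] A
  proj : A →L[ℂ] B
  proj_incl : ∀ b, proj (incl b) = b
  norm_proj_le : ∀ a, ‖proj a‖ ≤ ‖a‖
  proj_star : ∀ a, proj (star a) = star (proj a)
  lip_incl : ∀ b, LA (saMap incl b) = LB b
  lip_proj : ∀ (a : selfAdjoint A) (b : selfAdjoint B), (b : B) = proj a → LB b ≤ LA a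
  enorm_sub_le : ∀ a : selfAdjoint A, LA a ≤ 1 → ‖(a : A) - incl (proj a)‖ₑ ≤ ε

namespace LipRetraction

variable {LA : selfAdjoint A → ℝ≥0∞} {LB : selfAdjoint B → ℝ≥0∞} {ε : ℝ≥0∞}
  (ρ : LipRetraction LA LB ε)

include ρ

theorem incl_injective : Function.Injective ρ.incl :=
  Function.LeftInverse.injective ρ.proj_incl

theorem norm_incl (b : B) : ‖ρ.incl b‖ = ‖b‖ :=
  NonUnitalStarAlgHom.norm_map ρ.incl ρ.incl_injective b

theorem isometry_saMap : Isometry (saMap ρ.incl) := by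
  refine Isometry.of_dist_eq fun a b => ?_
  rw [Subtype.dist_eq, Subtype.dist_eq, dist_eq_norm, dist_eq_norm, coe_saMap, coe_saMap, ← map_sub,
    ρ.norm_incl]

/-- The map induced by the retraction between self-adjoint parts. -/
noncomputable def saProj (a : selfAdjoint A) : selfAdjoint B :=
  ⟨ρ.proj a, by
    rw [selfAdjoint.mem_iff, ← ρ.proj_star, a.2.star_eq]⟩

theorem lip_saProj_le (a : selfAdjoint A) : LB (ρ.saProj a) ≤ LA a := ρ.lip_proj a _ rfl

/-- Since `LB` is the restriction of `LA` along an isometric embedding, most properties restrict.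
Density of the domain does not; it is pushed forward by the surjection `saProj`, which does not
increase the seminorm. -/
theorem isTotallyBoundedLip (hL : IsTotallyBoundedLip LA) : IsTotallyBoundedLip LB where
  add_le a b := by
    rw [← ρ.lip_incl, ← ρ.lip_incl, ← ρ.lip_incl]
    convert hL.add_le (saMap ρ.incl a) (saMap ρ.incl b) using 2
    exact Subtype.ext (map_add ρ.incl _ _)
  smul r a := by
    rw [← ρ.lip_incl, ← ρ.lip_incl, ← hL.smul]
    congr 1
    refine Subtype.ext ?_
    change ρ.incl (r • (a : B)) = r • ρ.incl a
    rw [← Complex.coe_smul, ← Complex.coe_smul, map_smul]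
  dense_dom := by
    have hs : Function.Surjective ρ.saProj := fun b =>
      ⟨saMap ρ.incl b, Subtype.ext (ρ.proj_incl b)⟩
    have hc : Continuous ρ.saProj :=
      (ρ.proj.continuous.comp continuous_subtype_val).subtype_mk _
    refine (hs.denseRange.dense_image hc hL.dense_dom).mono ?_
    rintro _ ⟨a, ha, rfl⟩
    exact ne_top_of_le_ne_top ha (ρ.lip_saProj_le a)
  eq_zero_iff a := by
    rw [← ρ.lip_incl, hL.eq_zero_iff]
    refine exists_congr fun r => ?_
    rw [coe_saMap, ← ρ.incl_injective.eq_iff, map_smul, map_one]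
  lowerSemicontinuous := by
    have h : LB = LA ∘ saMap ρ.incl := funext fun b => (ρ.lip_incl b).symm
    rw [h]
    exact hL.lowerSemicontinuous.comp ρ.isometry_saMap.continuous
  totallyBounded := by
    obtain ⟨R, hR, htb⟩ := hL.totallyBounded
    refine ⟨R, fun b hb => ?_, ?_⟩
    · obtain ⟨r, hr⟩ := hR (saMap ρ.incl b) (by rwa [ρ.lip_incl])
      refine ⟨r, ?_⟩
      have e : saMap ρ.incl b - r • 1 = saMap ρ.incl (b - r • 1) := by
        refine Subtype.ext ?_
        change ρ.incl (b : B) - r • (1 : A) = ρ.incl ((b : B) - r • (1 : B))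
        rw [map_sub, ← Complex.coe_smul, ← Complex.coe_smul, map_smul, map_one]
      rw [e] at hr
      exact (ρ.norm_incl _).ge.trans hr
    · refine (totallyBounded_preimage ρ.isometry_saMap.isUniformInducing htb).subset ?_
      rintro b ⟨hb, hbR⟩
      exact ⟨by rwa [ρ.lip_incl], (ρ.norm_incl b).le.trans hbR⟩

theorem isQuasiLeibniz {C : ℝ≥0} (hL : IsQuasiLeibniz C LA) : IsQuasiLeibniz C LB := by
  intro a b c
  have hn : ∀ x : B, ‖ρ.incl x‖ₑ = ‖x‖ₑ := fun x => by
    rw [enorm_eq_nnnorm, enorm_eq_nnnorm]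
    exact congrArg _ (NNReal.eq (ρ.norm_incl x))
  have h := hL (saMap ρ.incl a) (saMap ρ.incl b) (saMap ρ.incl c)
  simp only [ρ.lip_incl, coe_saMap, hn] at h
  refine ⟨fun hc => h.1 ?_, fun hc => h.2 ?_⟩
  · rw [hc, map_smul, map_add, map_mul, map_mul]
  · rw [hc, map_smul, map_sub, map_mul, map_mul]

/-- A state `φ` of `B` extends to `A` as `φ ∘ proj`, which is contractive and unital. -/
theorem dualMap_incl_surjOn :
    stateSpace B ⊆ dualMap ρ.incl '' stateSpace A := by
  intro φ hφ
  refine ⟨StrongDual.toWeakDual ((WeakDual.toStrongDual φ).comp ρ.proj), ?_, ?_⟩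
  · refine mem_stateSpace_of_norm_le (fun a => ?_) ?_
    · exact (norm_stateSpace_apply_le hφ _).trans (ρ.norm_proj_le a)
    · change φ (ρ.proj 1) = 1
      rw [← map_one ρ.incl, ρ.proj_incl, hφ.2]
  · refine DFunLike.ext _ _ fun b => ?_
    change φ (ρ.proj (ρ.incl b)) = φ b
    rw [ρ.proj_incl]

end LipRetraction

theorem levelSet_one (D : Type u) [CStarAlgebra D] : levelSet (1 : D) = stateSpace D := by
  ext φ
  simp [levelSet]

theorem hausdorffOf_le {S T : Type*} {d : S → T → ℝ≥0∞} {s : Set S} {t : Set T} {ε : ℝ≥0∞}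
    (h1 : ∀ x ∈ s, ∃ y ∈ t, d x y ≤ ε) (h2 : ∀ y ∈ t, ∃ x ∈ s, d x y ≤ ε) :
    hausdorffOf d s t ≤ ε := by
  refine max_le (iSup₂_le fun x hx => ?_) (iSup₂_le fun y hy => ?_)
  · obtain ⟨y, hy, h⟩ := h1 x hx
    exact (iInf₂_le y hy).trans h
  · obtain ⟨x, hx, h⟩ := h2 y hy
    exact (iInf₂_le x hx).trans h

/-- With pivot `1` the level set is the whole state space, so each Hausdorff distance compares a
state space with itself. -/
theorem Bridge.height_eq_zero (γ : Bridge A B) {LA : selfAdjoint A → ℝ≥0∞}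
    {LB : selfAdjoint B → ℝ≥0∞} (hω : γ.ω = 1)
    (hA : stateSpace A ⊆ dualMap γ.left '' stateSpace γ.D)
    (hB : stateSpace B ⊆ dualMap γ.right '' stateSpace γ.D) : γ.height LA LB = 0 := by
  have key : ∀ {E : Type u} [CStarAlgebra E] (L : selfAdjoint E → ℝ≥0∞) (f : E →⋆ₐ[ℂ] γ.D),
      stateSpace E ⊆ dualMap f '' stateSpace γ.D →
      hausdorffOf (mongeKantorovich L) (stateSpace E) (dualMap f '' levelSet γ.ω) ≤ 0 := by
    intro E _ L f hf
    rw [hω, levelSet_one]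
    refine hausdorffOf_le (fun φ hφ => ⟨φ, hf hφ, (mongeKantorovich_self φ).le⟩) ?_
    rintro _ ⟨φ, hφ, rfl⟩
    exact ⟨_, dualMap_mem_stateSpace f hφ, (mongeKantorovich_self _).le⟩
  exact le_antisymm (max_le (key LA _ hA) (key LB _ hB)) (zero_le)

namespace LipRetraction

variable {LA : selfAdjoint A → ℝ≥0∞} {LB : selfAdjoint B → ℝ≥0∞} {ε : ℝ≥0∞}
  (ρ : LipRetraction LA LB ε)

/-- The bridge from `A` to `B` in `A` with pivot `1`. -/
def bridge (h : (stateSpace A).Nonempty) : Bridge A B where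
  D := A
  left := StarAlgHom.id ℂ A
  left_injective := Function.injective_id
  right := ρ.incl
  right_injective := ρ.incl_injective
  ω := 1
  levelSet_nonempty := by rwa [levelSet_one]

/-- The bridge from `B` to `A` in `A` with pivot `1`. -/
def bridgeSymm (h : (stateSpace A).Nonempty) : Bridge B A where
  D := A
  left := ρ.incl
  left_injective := ρ.incl_injective
  right := StarAlgHom.id ℂ A
  right_injective := Function.injective_id
  ω := 1
  levelSet_nonempty := by rwa [levelSet_one]

theorem stateSpace_subset_dualMap_id :
    stateSpace A ⊆ dualMap (StarAlgHom.id ℂ A) '' stateSpace A :=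
  fun φ hφ => ⟨φ, hφ, DFunLike.ext _ _ fun _ => rfl⟩

/-- The height vanishes and the bridge seminorm is `‖a - incl b‖`. An element `a` is matched with
`proj a` at cost `ε`, and `b` with `incl b` at no cost. -/
theorem length_bridge_le (h : (stateSpace A).Nonempty) : (ρ.bridge h).length LA LB ≤ ε := by
  refine max_le ?_ ?_
  · rw [(ρ.bridge h).height_eq_zero rfl stateSpace_subset_dualMap_id ρ.dualMap_incl_surjOn]
    exact zero_le
  · have hb : ∀ (a : A) (b : B), (ρ.bridge h).bridgeNorm a b = ‖a - ρ.incl b‖ₑ := by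
      intro a b
      change ‖a * 1 - 1 * ρ.incl b‖ₑ = _
      rw [mul_one, one_mul]
    refine hausdorffOf_le (fun a ha => ⟨ρ.saProj a, (ρ.lip_saProj_le a).trans ha, ?_⟩)
      (fun b hb' => ⟨saMap ρ.incl b, (ρ.lip_incl b).le.trans hb', ?_⟩)
    · rw [hb]
      exact ρ.enorm_sub_le a ha
    · rw [hb, coe_saMap, sub_self, enorm_zero]
      exact zero_le

theorem length_bridgeSymm_le (h : (stateSpace A).Nonempty) :
    (ρ.bridgeSymm h).length LB LA ≤ ε := by
  refine max_le ?_ ?_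
  · rw [(ρ.bridgeSymm h).height_eq_zero rfl ρ.dualMap_incl_surjOn stateSpace_subset_dualMap_id]
    exact zero_le
  · have hb : ∀ (a : A) (b : B), (ρ.bridgeSymm h).bridgeNorm b a = ‖a - ρ.incl b‖ₑ := by
      intro a b
      change ‖ρ.incl b * 1 - 1 * a‖ₑ = _
      rw [mul_one, one_mul, ← enorm_neg, neg_sub]
    refine hausdorffOf_le (fun b hb' => ⟨saMap ρ.incl b, (ρ.lip_incl b).le.trans hb', ?_⟩)
      (fun a ha => ⟨ρ.saProj a, (ρ.lip_saProj_le a).trans ha, ?_⟩)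
    · rw [hb, coe_saMap, sub_self, enorm_zero]
      exact zero_le
    · rw [hb]
      exact ρ.enorm_sub_le a ha

end LipRetraction

end Retraction

/-- The trek passes from `P` to `M` inside `P`, and from `M` to `Q` inside `Q`. -/
theorem qpropinquity_le_of_retractions {C : ℝ≥0} {P M Q : LipPair.{u}} (hP : P.IsQCQMS C)
    (hM : M.IsQCQMS C) (hQ : Q.IsQCQMS C) {ε δ : ℝ≥0∞} (ρ : LipRetraction P.lip M.lip ε)
    (σ : LipRetraction Q.lip M.lip δ) (hPs : (stateSpace P.carrier).Nonempty)
    (hQs : (stateSpace Q.carrier).Nonempty) : qpropinquity C P Q ≤ ε + δ :=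
  (iInf_le _ (Trek.cons hP (ρ.bridge hPs) (Trek.single hM hQ (σ.bridgeSymm hQs)))).trans
    (add_le_add (ρ.length_bridge_le hPs) (σ.length_bridgeSymm_le hQs))

/-- A trek contains at least one bridge, so the identity bridge has to be exhibited. -/
theorem qpropinquity_self {C : ℝ≥0} {P : LipPair.{u}} (hP : P.IsQCQMS C)
    (hPs : (stateSpace P.carrier).Nonempty) : qpropinquity C P P = 0 := by
  let ρ : LipRetraction P.lip P.lip 0 :=
    { incl := StarAlgHom.id ℂ _
      proj := ContinuousLinearMap.id ℂ _
      proj_incl := fun _ => rfl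
      norm_proj_le := fun _ => le_rfl
      proj_star := fun _ => rfl
      lip_incl := fun _ => rfl
      lip_proj := fun a b h => by rw [Subtype.ext (a1 := b) (a2 := a) h]
      enorm_sub_le := fun a _ => by simp }
  refine le_antisymm ?_ (zero_le)
  exact (iInf_le _ (Trek.single hP hP (ρ.bridge hPs))).trans (ρ.length_bridge_le hPs)

/-! ### Lipschitz partitions of unity -/

section Partition

variable {X : Type u} [MetricSpace X] [CompactSpace X]

/-- Tent functions of radius `δ` around the centres of a finite cover, divided by their sum;
compactness bounds this sum away from zero, which keeps the quotients Lipschitz. -/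
theorem exists_lipschitz_partition {δ : ℝ} (hδ : 0 < δ) :
    ∃ (t : Finset X) (w : X → C(X, ℝ)), (∀ i, ∃ K : ℝ≥0, LipschitzWith K (w i)) ∧
      (∀ i x, 0 ≤ w i x) ∧ (∀ x, ∑ i ∈ t, w i x = 1) ∧ ∀ i x, w i x ≠ 0 → dist x i < δ := by
  obtain ⟨t', -, ht', hcov⟩ := (isCompact_univ (X := X)).finite_cover_balls hδ
  set t := ht'.toFinset with ht
  let g : X → X → ℝ := fun i x => max 0 (δ - dist x i)
  have hg0 : ∀ i x, 0 ≤ g i x := fun i x => le_max_left _ _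
  have hgl : ∀ i x y, |g i x - g i y| ≤ dist x y := by
    intro i x y
    refine (abs_max_sub_max_le_max _ _ _ _).trans ?_
    rw [sub_self, abs_zero, max_eq_right (abs_nonneg _), sub_sub_sub_cancel_left, abs_sub_comm]
    exact abs_dist_sub_le x y i
  have hgc : ∀ i, Continuous (g i) := fun i =>
    continuous_const.max (continuous_const.sub (continuous_id.dist continuous_const))
  let S : X → ℝ := fun x => ∑ i ∈ t, g i x
  have hSc : Continuous S := continuous_finsetSum _ fun i _ => hgc i
  have hS0 : ∀ x, 0 < S x := by
    intro x
    obtain ⟨i, hi, hxi⟩ := Set.mem_iUnion₂.mp (hcov (Set.mem_univ x))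
    refine Finset.sum_pos' (fun i _ => hg0 i x) ⟨i, ht'.mem_toFinset.mpr hi, ?_⟩
    exact lt_max_of_lt_right (sub_pos.mpr hxi)
  have hgS : ∀ x, ∀ i ∈ t, g i x ≤ S x := fun x i hi =>
    Finset.single_le_sum (f := fun i => g i x) (fun i _ => hg0 i x) hi
  have hSl : ∀ x y, |S x - S y| ≤ t.card * dist x y := by
    intro x y
    change |∑ i ∈ t, g i x - ∑ i ∈ t, g i y| ≤ _
    rw [← Finset.sum_sub_distrib]
    refine (Finset.abs_sum_le_sum_abs _ _).trans ?_
    refine (Finset.sum_le_sum fun i _ => hgl i x y).trans ?_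
    rw [Finset.sum_const, nsmul_eq_mul]
  -- The minimum of `S`; on the empty space any positive number serves.
  obtain ⟨s, hs, hsS⟩ : ∃ s : ℝ, 0 < s ∧ ∀ x, s ≤ S x := by
    rcases isEmpty_or_nonempty X with h | h
    · exact ⟨1, one_pos, fun x => h.elim x⟩
    · obtain ⟨x₀, -, hx₀⟩ := (isCompact_univ (X := X)).exists_isMinOn Set.univ_nonempty
        hSc.continuousOn
      exact ⟨S x₀, hS0 x₀, fun x => hx₀ (Set.mem_univ x)⟩
  classical
  let w : X → C(X, ℝ) := fun i => if i ∈ t then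
    ⟨fun x => g i x / S x, (hgc i).div hSc fun x => (hS0 x).ne'⟩ else 0
  have hw : ∀ i ∈ t, ∀ x, w i x = g i x / S x := by
    intro i hi x
    simp only [w, if_pos hi]
    rfl
  have hw' : ∀ i, i ∉ t → w i = 0 := fun i hi => by simp only [w, if_neg hi]
  refine ⟨t, w, fun i => ?_, fun i x => ?_, fun x => ?_, fun i x h => ?_⟩
  · by_cases hi : i ∈ t
    · have hK : 0 ≤ (1 + t.card) / s := by positivity
      refine ⟨⟨(1 + t.card) / s, hK⟩, LipschitzWith.of_dist_le_mul fun x y => ?_⟩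
      change _ ≤ (1 + t.card) / s * dist x y
      rw [Real.dist_eq, hw i hi, hw i hi]
      have hx := hS0 x
      have hy := hS0 y
      -- A discrete quotient rule: numerator and denominator variations contribute `1/s` and
      -- `t.card/s` to the Lipschitz constant, since `g i y / S y ≤ 1`.
      have e : g i x / S x - g i y / S y =
          (g i x - g i y) / S x + (S y - S x) / S x * (g i y / S y) := by
        field_simp
        ring
      have h1 : |(g i x - g i y) / S x| ≤ dist x y / s := by
        rw [abs_div, abs_of_pos hx]
        exact div_le_div₀ dist_nonneg (hgl i x y) hs (hsS x)
      have h2 : |(S y - S x) / S x| ≤ t.card * dist x y / s := by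
        rw [abs_div, abs_of_pos hx, abs_sub_comm]
        exact div_le_div₀ (by positivity) (hSl x y) hs (hsS x)
      have h3 : |g i y / S y| ≤ 1 := by
        rw [abs_of_nonneg (div_nonneg (hg0 i y) hy.le), div_le_one hy]
        exact hgS y i hi
      calc |g i x / S x - g i y / S y| ≤
          |(g i x - g i y) / S x| + |(S y - S x) / S x| * |g i y / S y| := by
            rw [e, ← abs_mul]
            exact abs_add_le _ _
        _ ≤ dist x y / s + t.card * dist x y / s * 1 := by gcongr
        _ = (1 + t.card) / s * dist x y := by ring
    · exact ⟨0, by rw [hw' i hi]; exact LipschitzWith.const 0⟩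
  · by_cases hi : i ∈ t
    · rw [hw i hi]
      exact div_nonneg (hg0 i x) (hS0 x).le
    · rw [hw' i hi]; rfl
  · rw [Finset.sum_congr rfl fun i hi => hw i hi x, ← Finset.sum_div]
    exact div_self (hS0 x).ne'
  · by_cases hi : i ∈ t
    · rw [hw i hi] at h
      by_contra hd
      refine h ?_
      have : g i x = 0 := max_eq_left (by linarith)
      rw [this, zero_div]
    · rw [hw' i hi] at h
      exact absurd rfl h

/-- One `ε` pays for the oscillation of `f` on `δ`-balls, the other for replacing `f i` by `a i`.
The coefficients are left free so that `E_n (f i)` can be used for the density of the domain, and `f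
i` itself for the tensor product. -/
theorem exists_partition_approx {A : Type v} [NormedAddCommGroup A] [NormedSpace ℂ A] (f : C(X, A))
    {ε : ℝ} (hε : 0 < ε) :
    ∃ (t : Finset X) (w : X → C(X, ℝ)), (∀ i, ∃ K : ℝ≥0, LipschitzWith K (w i)) ∧
      ∀ a : X → A, (∀ i ∈ t, ‖a i - f i‖ ≤ ε) →
        ∀ x, ‖f x - ∑ i ∈ t, ((w i x : ℝ) : ℂ) • a i‖ ≤ 2 * ε := by
  obtain ⟨δ, hδ, hf⟩ := Metric.uniformContinuous_iff.mp
    (CompactSpace.uniformContinuous_of_continuous f.continuous) ε hε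
  obtain ⟨t, w, hwl, hw0, hw1, hwδ⟩ := exists_lipschitz_partition (X := X) hδ
  refine ⟨t, w, hwl, fun a ha x => ?_⟩
  have e : f x - ∑ i ∈ t, ((w i x : ℝ) : ℂ) • a i =
      ∑ i ∈ t, ((w i x : ℝ) : ℂ) • ((f x - f i) - (a i - f i)) := by
    simp only [sub_sub_sub_cancel_right, smul_sub]
    rw [Finset.sum_sub_distrib, ← Finset.sum_smul, ← Complex.ofReal_sum, hw1, Complex.ofReal_one,
      one_smul]
  rw [e]
  calc _ ≤ ∑ i ∈ t, w i x * (2 * ε) := by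
        refine norm_sum_le_of_le _ fun i hi => ?_
        rw [norm_smul, Complex.norm_real, Real.norm_of_nonneg (hw0 i x)]
        by_cases h0 : w i x = 0
        · rw [h0, zero_mul, zero_mul]
        refine mul_le_mul_of_nonneg_left ?_ (hw0 i x)
        have h1 := hf (hwδ i x h0)
        rw [dist_eq_norm] at h1
        have h2 := norm_sub_le (f x - f i) (a i - f i)
        have h3 := ha i hi
        linarith
    _ = 2 * ε := by rw [← Finset.sum_mul, hw1, one_mul]

end Partition

/-! ### Lip-norms from towers of conditional expectations -/

/-- A sequence of commuting ⋆-preserving conditional expectations onto finite-dimensional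
subalgebras of `A` which converge to the identity, the first one being onto the scalars, and a null
sequence of weights. -/
structure CondExpTower {A : Type v} [CStarAlgebra A] (E : ℕ → A →L[ℂ] A) (b : ℕ → ℝ) : Prop where
  norm_le : ∀ n a, ‖E n a‖ ≤ ‖a‖
  apply_of_le : ∀ {n m}, m ≤ n → ∀ a, E n (E m a) = E m a
  apply_of_ge : ∀ {n m}, n ≤ m → ∀ a, E n (E m a) = E n a
  map_star : ∀ n a, E n (star a) = star (E n a)
  map_one : ∀ n, E n 1 = 1
  map_mul : ∀ n a c, E n (E n a * E n c) = E n a * E n c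
  tendsto : ∀ a, Filter.Tendsto (fun n => E n a) Filter.atTop (𝓝 a)
  finiteDimensional : ∀ n, FiniteDimensional ℂ (E n : A →ₗ[ℂ] A).range
  scalar : ∀ a, ∃ c : ℂ, E 0 a = c • 1
  pos : ∀ n, 0 < b n
  tendsto_weight : Filter.Tendsto b Filter.atTop (𝓝 0)

/-! ### Lipschitz constants and Leibniz estimates in `C(X, A)` -/

section LipConst

variable {A : Type v} [CStarAlgebra A] {X : Type u} [MetricSpace X]

theorem lipConst_le_iff {f : C(X, A)} {K : ℝ≥0∞} :
    lipConst f ≤ K ↔ ∀ x y, edist (f x) (f y) ≤ K * edist x y := by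
  refine iSup₂_le_iff.trans (forall₂_congr fun x y => ?_)
  by_cases hxy : x = y
  · simp [hxy]
  · exact ENNReal.div_le_iff_le_mul (Or.inl (edist_pos.mpr hxy).ne') (Or.inl (edist_ne_top x y))

theorem edist_le_lipConst (f : C(X, A)) (x y : X) :
    edist (f x) (f y) ≤ lipConst f * edist x y := lipConst_le_iff.mp le_rfl x y

theorem lipConst_add_le (f g : C(X, A)) : lipConst (f + g) ≤ lipConst f + lipConst g :=
  lipConst_le_iff.mpr fun x y => by
    rw [add_mul]
    exact (edist_add_add_le _ _ _ _).trans
      (add_le_add (edist_le_lipConst f x y) (edist_le_lipConst g x y))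

theorem lipConst_smul (c : ℂ) (f : C(X, A)) : lipConst (c • f) = ‖c‖ₑ * lipConst f := by
  unfold lipConst
  simp only [ENNReal.mul_iSup]
  refine iSup_congr fun x => iSup_congr fun y => ?_
  rw [ContinuousMap.smul_apply, ContinuousMap.smul_apply, edist_smul₀, ENNReal.smul_def,
    smul_eq_mul, mul_div_assoc]
  rfl

theorem lowerSemicontinuous_lipConst : LowerSemicontinuous (lipConst : C(X, A) → ℝ≥0∞) := by
  refine lowerSemicontinuous_iSup fun x => lowerSemicontinuous_iSup fun y => ?_
  by_cases hxy : x = y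
  · simp only [hxy, edist_self, ENNReal.zero_div]
    exact continuous_const.lowerSemicontinuous
  · refine Continuous.lowerSemicontinuous ?_
    exact (ENNReal.continuous_div_const _ (edist_pos.mpr hxy).ne').comp
      ((continuous_eval_const x).edist (continuous_eval_const y))

theorem extendExp_apply (E : A →L[ℂ] A) (f : C(X, A)) (x : X) : extendExp E f x = E (f x) := rfl

theorem extendExp_add (E : A →L[ℂ] A) (f g : C(X, A)) :
    extendExp E (f + g) = extendExp E f + extendExp E g :=
  ContinuousMap.ext fun _ => map_add E _ _

theorem extendExp_sub (E : A →L[ℂ] A) (f g : C(X, A)) :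
    extendExp E (f - g) = extendExp E f - extendExp E g :=
  ContinuousMap.ext fun _ => map_sub E _ _

theorem extendExp_smul (E : A →L[ℂ] A) (c : ℂ) (f : C(X, A)) :
    extendExp E (c • f) = c • extendExp E f :=
  ContinuousMap.ext fun _ => map_smul E _ _

theorem continuous_extendExp (E : A →L[ℂ] A) :
    Continuous (extendExp E : C(X, A) → C(X, A)) :=
  ContinuousMap.continuous_postcomp _

theorem isSelfAdjoint_coe_apply (f : selfAdjoint C(X, A)) (x : X) :
    IsSelfAdjoint ((f : C(X, A)) x) := by
  have := DFunLike.congr_fun f.2.star_eq x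
  exact this

/-- Average `c • 1` with its adjoint. Deducing that `c` is real would fail in the zero algebra. -/
theorem smul_one_eq_re {B : Type v} [CStarAlgebra B] {c : ℂ} (hc : IsSelfAdjoint (c • (1 : B))) :
    c • (1 : B) = (c.re : ℂ) • 1 := by
  have h1 : star c • (1 : B) = c • 1 := by
    have := hc.star_eq
    rwa [star_smul, star_one] at this
  have h2 : (c.re : ℂ) = (1 / 2 : ℂ) * (c + star c) := by
    have := Complex.add_conj c
    rw [show star c = (starRingEnd ℂ) c from rfl, this]
    push_cast
    ring
  rw [h2, mul_smul, add_smul, h1, ← two_smul ℂ, smul_smul]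
  norm_num

variable [CompactSpace X]

theorem norm_extendExp_le {E : A →L[ℂ] A} (hE : ∀ a, ‖E a‖ ≤ ‖a‖) (f : C(X, A)) :
    ‖extendExp E f‖ ≤ ‖f‖ :=
  (ContinuousMap.norm_le _ (norm_nonneg f)).mpr fun x => (hE _).trans (f.norm_coe_le_norm x)

/-- The product `p = E(f) E(g)` is fixed by `E`, so the left side is `(f g - p) - E(f g - p)`, at
most `2 ‖f g - p‖`. This is the source of the quasi-Leibniz constant `2`. -/
theorem norm_mul_sub_extendExp_le {E : A →L[ℂ] A} (hE : ∀ a, ‖E a‖ ≤ ‖a‖)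
    (hm : ∀ a c, E (E a * E c) = E a * E c) (f g : C(X, A)) :
    ‖f * g - extendExp E (f * g)‖ ≤
      2 * (‖f - extendExp E f‖ * ‖g‖ + ‖f‖ * ‖g - extendExp E g‖) := by
  set p := extendExp E f * extendExp E g with hp
  have hEp : extendExp E p = p := ContinuousMap.ext fun x => hm _ _
  have e : f * g - extendExp E (f * g) = (f * g - p) - extendExp E (f * g - p) := by
    rw [extendExp_sub, hEp]
    abel
  have h1 : ‖f * g - p‖ ≤ ‖f - extendExp E f‖ * ‖g‖ + ‖f‖ * ‖g - extendExp E g‖ := by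
    have e2 : f * g - p = (f - extendExp E f) * g + extendExp E f * (g - extendExp E g) := by
      rw [hp]
      noncomm_ring
    rw [e2]
    refine (norm_add_le _ _).trans (add_le_add (norm_mul_le _ _) ((norm_mul_le _ _).trans ?_))
    exact mul_le_mul_of_nonneg_right (norm_extendExp_le hE f) (norm_nonneg _)
  have h2 := norm_extendExp_le hE (f * g - p)
  rw [e]
  refine (norm_sub_le _ _).trans ?_
  linarith

/-- The scalars treat both products at once: `s = 1/2, t = 1` is the Jordan product, `s = 1/(2i), t
= -1` the Lie product. -/
theorem norm_commutator_sub_extendExp_le {E : A →L[ℂ] A} (hE : ∀ a, ‖E a‖ ≤ ‖a‖)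
    (hm : ∀ a c, E (E a * E c) = E a * E c) (f g : C(X, A)) {s t : ℂ} (hs : ‖s‖ = 1 / 2)
    (ht : ‖t‖ = 1) :
    ‖s • (f * g + t • (g * f)) - extendExp E (s • (f * g + t • (g * f)))‖ ≤
      2 * (‖f - extendExp E f‖ * ‖g‖ + ‖g - extendExp E g‖ * ‖f‖) := by
  have e : s • (f * g + t • (g * f)) - extendExp E (s • (f * g + t • (g * f))) =
      s • ((f * g - extendExp E (f * g)) + t • (g * f - extendExp E (g * f))) := by
    rw [extendExp_smul, extendExp_add, extendExp_smul]
    module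
  rw [e, norm_smul, hs]
  have h1 := norm_mul_sub_extendExp_le hE hm f g
  have h2 := norm_mul_sub_extendExp_le hE hm g f
  have h3 := norm_add_le (f * g - extendExp E (f * g)) (t • (g * f - extendExp E (g * f)))
  rw [norm_smul, ht, one_mul] at h3
  nlinarith

/-- Both orders of the product satisfy the same Leibniz bound, and `2‖s‖ = 1`, so the constant here
is `1`. -/
theorem lipConst_commutator_le (f g : C(X, A)) {s t : ℂ} (hs : ‖s‖ = 1 / 2) (ht : ‖t‖ = 1) :
    lipConst (s • (f * g + t • (g * f))) ≤ lipConst f * ‖g‖ₑ + lipConst g * ‖f‖ₑ := by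
  have hen : ∀ (h : C(X, A)) (x : X), ‖h x‖ₑ ≤ ‖h‖ₑ := fun h x => by
    rw [← ofReal_norm, ← ofReal_norm]
    exact ENNReal.ofReal_le_ofReal (h.norm_coe_le_norm x)
  have hs' : ‖s‖ₑ * 2 = 1 := by
    rw [← ofReal_norm, hs, ← ENNReal.ofReal_ofNat 2, ← ENNReal.ofReal_mul (by norm_num)]
    norm_num
  have ht' : ‖t‖ₑ = 1 := by rw [← ofReal_norm, ht, ENNReal.ofReal_one]
  have hmul : ∀ (h k : C(X, A)) (x y : X), ‖(h * k) x - (h * k) y‖ₑ ≤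
      (lipConst h * ‖k‖ₑ + lipConst k * ‖h‖ₑ) * edist x y := by
    intro h k x y
    have e : (h * k) x - (h * k) y = (h x - h y) * k x + h y * (k x - k y) := by
      rw [ContinuousMap.mul_apply, ContinuousMap.mul_apply]
      noncomm_ring
    have hm : ∀ a c : A, ‖a * c‖ₑ ≤ ‖a‖ₑ * ‖c‖ₑ := fun a c => by
      rw [← ofReal_norm, ← ofReal_norm, ← ofReal_norm,
        ← ENNReal.ofReal_mul (norm_nonneg _)]
      exact ENNReal.ofReal_le_ofReal (norm_mul_le a c)
    rw [e]
    refine (enorm_add_le _ _).trans ?_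
    calc _ ≤ ‖h x - h y‖ₑ * ‖k x‖ₑ + ‖h y‖ₑ * ‖k x - k y‖ₑ := add_le_add (hm _ _) (hm _ _)
      _ ≤ (lipConst h * edist x y) * ‖k‖ₑ + ‖h‖ₑ * (lipConst k * edist x y) := by
        rw [← edist_eq_enorm_sub, ← edist_eq_enorm_sub]
        gcongr
        · exact edist_le_lipConst h x y
        · exact hen k x
        · exact hen h y
        · exact edist_le_lipConst k x y
      _ = _ := by ring
  refine lipConst_le_iff.mpr fun x y => ?_
  have e : (s • (f * g + t • (g * f))) x - (s • (f * g + t • (g * f))) y =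
      s • (((f * g) x - (f * g) y) + t • ((g * f) x - (g * f) y)) := by
    simp only [ContinuousMap.smul_apply, ContinuousMap.add_apply]
    module
  rw [edist_eq_enorm_sub, e, enorm_smul]
  calc _ ≤ ‖s‖ₑ * ((lipConst f * ‖g‖ₑ + lipConst g * ‖f‖ₑ) * edist x y +
        (lipConst g * ‖f‖ₑ + lipConst f * ‖g‖ₑ) * edist x y) := by
        gcongr
        refine (enorm_add_le _ _).trans ?_
        rw [enorm_smul, ht', one_mul]
        exact add_le_add (hmul f g x y) (hmul g f x y)
    _ = ‖s‖ₑ * 2 * ((lipConst f * ‖g‖ₑ + lipConst g * ‖f‖ₑ) * edist x y) := by ring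
    _ = _ := by rw [hs', one_mul]

end LipConst

/-! ### Seminorm, Leibniz and density properties for a tower of expectations -/

namespace CondExpTower

variable {A : Type v} [CStarAlgebra A] {X : Type u} [MetricSpace X] [CompactSpace X]
  {E : ℕ → A →L[ℂ] A} {b : ℕ → ℝ}

theorem ahLip_add_le (f g : selfAdjoint C(X, A)) :
    ahLip E b (f + g) ≤ ahLip E b f + ahLip E b g := by
  have e : ((f + g : selfAdjoint C(X, A)) : C(X, A)) = (f : C(X, A)) + g := rfl
  unfold ahLip
  rw [add_add_add_comm, e]
  generalize (f : C(X, A)) = f, (g : C(X, A)) = g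
  refine add_le_add (lipConst_add_le _ _) (iSup_le fun n => ?_)
  refine le_trans ?_ (add_le_add (le_iSup (fun n => ‖f - extendExp (E n) f‖ₑ /
    ENNReal.ofReal (b n)) n) (le_iSup (fun n => ‖g - extendExp (E n) g‖ₑ /
    ENNReal.ofReal (b n)) n))
  rw [ENNReal.div_add_div_same]
  refine ENNReal.div_le_div_right ?_ _
  rw [extendExp_add, add_sub_add_comm]
  exact enorm_add_le _ _

theorem ahLip_smul (r : ℝ) (f : selfAdjoint C(X, A)) :
    ahLip E b (r • f) = ENNReal.ofReal |r| * ahLip E b f := by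
  have e : ((r • f : selfAdjoint C(X, A)) : C(X, A)) = (r : ℂ) • (f : C(X, A)) := by
    rw [Complex.coe_smul]; rfl
  have hr : ‖(r : ℂ)‖ₑ = ENNReal.ofReal |r| := by
    rw [← ofReal_norm, Complex.norm_real, Real.norm_eq_abs]
  unfold ahLip
  rw [e, lipConst_smul, mul_add, hr, ENNReal.mul_iSup]
  congr 1
  refine iSup_congr fun n => ?_
  rw [extendExp_smul, ← smul_sub, enorm_smul, hr, mul_div_assoc]

theorem lipConst_le_ahLip (f : selfAdjoint C(X, A)) :
    lipConst (f : C(X, A)) ≤ ahLip E b f := le_self_add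

variable (h : CondExpTower E b)
include h

theorem ofReal_weight_ne_zero (n : ℕ) : ENNReal.ofReal (b n) ≠ 0 :=
  (ENNReal.ofReal_pos.mpr (h.pos n)).ne'

theorem enorm_sub_le_ahLip (f : selfAdjoint C(X, A)) (n : ℕ) :
    ‖(f : C(X, A)) - extendExp (E n) f‖ₑ ≤ ahLip E b f * ENNReal.ofReal (b n) := by
  rw [← ENNReal.div_le_iff (h.ofReal_weight_ne_zero n) ENNReal.ofReal_ne_top]
  exact (le_iSup (fun n => ‖(f : C(X, A)) - extendExp (E n) f‖ₑ /
    ENNReal.ofReal (b n)) n).trans le_add_self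

theorem ahLip_le_iff {f : selfAdjoint C(X, A)} {K : ℝ≥0∞} :
    (⨆ n : ℕ, ‖(f : C(X, A)) - extendExp (E n) f‖ₑ / ENNReal.ofReal (b n)) ≤ K ↔
      ∀ n, ‖(f : C(X, A)) - extendExp (E n) f‖ₑ ≤ K * ENNReal.ofReal (b n) :=
  iSup_le_iff.trans (forall_congr' fun n =>
    ENNReal.div_le_iff (h.ofReal_weight_ne_zero n) ENNReal.ofReal_ne_top)

/-- The Lipschitz summand satisfies the inequality with constant `1` and the weighted summand with
constant `2`, so the sum does with `2`. -/
theorem isQuasiLeibniz_ahLip : IsQuasiLeibniz 2 (ahLip (X := X) E b) := by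
  have key : ∀ (f g k : selfAdjoint C(X, A)) (s t : ℂ), ‖s‖ = 1 / 2 → ‖t‖ = 1 →
      (k : C(X, A)) = s • ((f : C(X, A)) * g + t • ((g : C(X, A)) * f)) →
      ahLip E b k ≤ ((2 : ℝ≥0) : ℝ≥0∞) * (ahLip E b f * ‖(g : C(X, A))‖ₑ +
        ahLip E b g * ‖(f : C(X, A))‖ₑ) := by
    intro f g k s t hs ht hk
    set F : ℝ≥0∞ := ⨆ n : ℕ, ‖(f : C(X, A)) - extendExp (E n) f‖ₑ / ENNReal.ofReal (b n) with hF
    set G : ℝ≥0∞ := ⨆ n : ℕ, ‖(g : C(X, A)) - extendExp (E n) g‖ₑ / ENNReal.ofReal (b n) with hG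
    have h1 : lipConst (k : C(X, A)) ≤ lipConst (f : C(X, A)) * ‖(g : C(X, A))‖ₑ +
        lipConst (g : C(X, A)) * ‖(f : C(X, A))‖ₑ := by
      rw [hk]; exact lipConst_commutator_le _ _ hs ht
    have h2 : (⨆ n : ℕ, ‖(k : C(X, A)) - extendExp (E n) k‖ₑ / ENNReal.ofReal (b n)) ≤
        2 * (F * ‖(g : C(X, A))‖ₑ + G * ‖(f : C(X, A))‖ₑ) := by
      refine h.ahLip_le_iff.mpr fun n => ?_
      have h3 := norm_commutator_sub_extendExp_le (h.norm_le n) (h.map_mul n) (f : C(X, A))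
        (g : C(X, A)) hs ht
      rw [← hk] at h3
      have h4 : ‖(k : C(X, A)) - extendExp (E n) k‖ₑ ≤
          2 * (‖(f : C(X, A)) - extendExp (E n) f‖ₑ * ‖(g : C(X, A))‖ₑ +
            ‖(g : C(X, A)) - extendExp (E n) g‖ₑ * ‖(f : C(X, A))‖ₑ) := by
        simp only [enorm_eq_nnnorm]
        exact_mod_cast h3
      refine h4.trans ?_
      calc _ ≤ 2 * ((F * ENNReal.ofReal (b n)) * ‖(g : C(X, A))‖ₑ +
            (G * ENNReal.ofReal (b n)) * ‖(f : C(X, A))‖ₑ) := by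
            gcongr
            · exact h.ahLip_le_iff.mp le_rfl n
            · exact h.ahLip_le_iff.mp le_rfl n
        _ = _ := by ring
    calc ahLip E b k ≤ (lipConst (f : C(X, A)) * ‖(g : C(X, A))‖ₑ +
        lipConst (g : C(X, A)) * ‖(f : C(X, A))‖ₑ) +
          2 * (F * ‖(g : C(X, A))‖ₑ + G * ‖(f : C(X, A))‖ₑ) := add_le_add h1 h2
      _ ≤ 2 * (lipConst (f : C(X, A)) * ‖(g : C(X, A))‖ₑ +
        lipConst (g : C(X, A)) * ‖(f : C(X, A))‖ₑ) +
          2 * (F * ‖(g : C(X, A))‖ₑ + G * ‖(f : C(X, A))‖ₑ) := by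
          refine add_le_add (le_mul_of_one_le_left (zero_le) one_le_two) le_rfl
      _ = 2 * ((lipConst (f : C(X, A)) + F) * ‖(g : C(X, A))‖ₑ +
          (lipConst (g : C(X, A)) + G) * ‖(f : C(X, A))‖ₑ) := by ring
  intro f g k
  refine ⟨fun hk => key f g k (1 / 2) 1 (by norm_num) (by norm_num) ?_,
    fun hk => key f g k (1 / (2 * Complex.I)) (-1) (by norm_num) (by norm_num) ?_⟩
  · rw [hk, one_smul]
  · rw [hk, neg_smul, one_smul, sub_eq_add_neg]

theorem lowerSemicontinuous_ahLip : LowerSemicontinuous (ahLip (X := X) E b) := by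
  have hc : Continuous (Subtype.val : selfAdjoint C(X, A) → C(X, A)) := continuous_subtype_val
  refine LowerSemicontinuous.add (lowerSemicontinuous_lipConst.comp hc)
    (lowerSemicontinuous_iSup fun n => Continuous.lowerSemicontinuous ?_)
  exact (ENNReal.continuous_div_const _ (h.ofReal_weight_ne_zero n)).comp
    (hc.sub ((continuous_extendExp (E n)).comp hc)).enorm

theorem exists_real_scalar {a : A} (ha : IsSelfAdjoint a) : ∃ r : ℝ, E 0 a = (r : ℂ) • 1 := by
  obtain ⟨c, hc⟩ := h.scalar a
  refine ⟨c.re, ?_⟩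
  have hsa : IsSelfAdjoint (E 0 a) := by
    rw [isSelfAdjoint_iff, ← h.map_star, ha.star_eq]
  rw [hc] at hsa ⊢
  exact smul_one_eq_re hsa

/-- A vanishing Lipschitz constant makes `f` constant; the vanishing term `n = 0` makes its value a
scalar, real by self-adjointness. -/
theorem ahLip_eq_zero_iff [Nonempty X] (f : selfAdjoint C(X, A)) :
    ahLip E b f = 0 ↔ ∃ r : ℝ, (f : C(X, A)) = (r : ℂ) • 1 := by
  constructor
  · intro h0
    obtain ⟨x₀⟩ := ‹Nonempty X›
    obtain ⟨r, hr⟩ := h.exists_real_scalar (isSelfAdjoint_coe_apply f x₀)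
    refine ⟨r, ContinuousMap.ext fun x => ?_⟩
    have h1 := h.enorm_sub_le_ahLip f 0
    rw [h0, zero_mul, nonpos_iff_eq_zero, enorm_eq_zero, sub_eq_zero] at h1
    have h2 := edist_le_lipConst (f : C(X, A)) x x₀
    have h3 : lipConst (f : C(X, A)) = 0 := by
      rw [← nonpos_iff_eq_zero, ← h0]
      exact lipConst_le_ahLip f
    rw [h3, zero_mul, nonpos_iff_eq_zero, edist_eq_zero] at h2
    rw [h2]
    have h4 := DFunLike.congr_fun h1 x₀
    rw [extendExp_apply, hr] at h4
    exact h4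
  · rintro ⟨r, hr⟩
    have h1 : lipConst (f : C(X, A)) ≤ 0 := lipConst_le_iff.mpr fun x y => by simp [hr]
    have h2 : (⨆ n : ℕ, ‖(f : C(X, A)) - extendExp (E n) f‖ₑ / ENNReal.ofReal (b n)) ≤ 0 := by
      refine h.ahLip_le_iff.mpr fun n => ?_
      have : extendExp (E n) (f : C(X, A)) = f := by
        ext x
        simp [hr, extendExp_apply, h.map_one]
      rw [this, sub_self, enorm_zero]
      exact zero_le
    exact nonpos_iff_eq_zero.mp ((add_le_add h1 h2).trans (add_zero _).le)

/-- Approximants are Lipschitz partitions of unity with coefficients `E_n (f i)`. They are Lipschitz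
and fixed by `E_m` for `m ≥ n`, so only finitely many terms of the supremum survive. -/
theorem dense_ahLip_ne_top : Dense {f : selfAdjoint C(X, A) | ahLip E b f ≠ ∞} := by
  refine Metric.dense_iff.mpr fun f ε hε => ?_
  obtain ⟨t, w, hw, happ⟩ := exists_partition_approx (f : C(X, A)) (ε := ε / 3) (by positivity)
  obtain ⟨n, hn⟩ : ∃ n, ∀ i ∈ t, ‖E n ((f : C(X, A)) i) - (f : C(X, A)) i‖ ≤ ε / 3 := by
    have hev : ∀ᶠ n in Filter.atTop, ∀ i ∈ t,
        ‖E n ((f : C(X, A)) i) - (f : C(X, A)) i‖ ≤ ε / 3 := by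
      rw [Filter.eventually_all_finset]
      intro i _
      filter_upwards [(h.tendsto ((f : C(X, A)) i)).eventually
        (Metric.ball_mem_nhds _ (by positivity : 0 < ε / 3))] with n hn
      rw [dist_eq_norm] at hn
      exact hn.le
    exact hev.exists
  let a : X → A := fun i => E n ((f : C(X, A)) i)
  let g₀ : C(X, A) := ∑ i ∈ t, (⟨fun x => ((w i x : ℝ) : ℂ) • a i,
    (Complex.continuous_ofReal.comp (w i).continuous).smul continuous_const⟩ : C(X, A))
  have hg₀ : ∀ x, g₀ x = ∑ i ∈ t, ((w i x : ℝ) : ℂ) • a i := fun x => by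
    simp only [g₀, ContinuousMap.sum_apply]
    rfl
  have hsa : IsSelfAdjoint g₀ := by
    refine ContinuousMap.ext fun x => ?_
    rw [ContinuousMap.star_apply, hg₀, star_sum]
    refine Finset.sum_congr rfl fun i _ => ?_
    rw [star_smul, ← h.map_star, (isSelfAdjoint_coe_apply f i).star_eq]
    congr 1
    exact Complex.conj_ofReal _
  have hEg : ∀ m, n ≤ m → extendExp (E m) g₀ = g₀ := by
    intro m hm
    refine ContinuousMap.ext fun x => ?_
    rw [extendExp_apply, hg₀, map_sum]
    refine Finset.sum_congr rfl fun i _ => ?_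
    rw [map_smul, h.apply_of_le hm]
  refine ⟨⟨g₀, hsa⟩, ?_, ?_⟩
  · rw [Metric.mem_ball, dist_comm, Subtype.dist_eq, dist_eq_norm]
    refine lt_of_le_of_lt ((ContinuousMap.norm_le _ (by positivity : (0 : ℝ) ≤ 2 * (ε / 3))).mpr
      fun x => ?_) (by linarith)
    rw [ContinuousMap.sub_apply]
    change ‖(f : C(X, A)) x - g₀ x‖ ≤ _
    rw [hg₀]
    exact happ a hn x
  · choose K hK using hw
    have h1 : lipConst g₀ ≠ ∞ := by
      refine ne_top_of_le_ne_top (b := ∑ i ∈ t, (K i : ℝ≥0∞) * ‖a i‖ₑ) ?_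
        (lipConst_le_iff.mpr fun x y => ?_)
      · exact ENNReal.sum_ne_top.mpr fun i _ => ENNReal.mul_ne_top ENNReal.coe_ne_top enorm_ne_top
      · rw [edist_eq_enorm_sub, hg₀, hg₀, ← Finset.sum_sub_distrib, Finset.sum_mul]
        refine (enorm_sum_le _ _).trans (Finset.sum_le_sum fun i _ => ?_)
        rw [← sub_smul, enorm_smul, ← Complex.ofReal_sub]
        have h2 : ‖((w i x - w i y : ℝ) : ℂ)‖ₑ = edist (w i x) (w i y) := by
          rw [edist_eq_enorm_sub, ← ofReal_norm, ← ofReal_norm,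
            Complex.norm_real]
        rw [h2, mul_right_comm]
        exact mul_le_mul_left (hK i x y) _
    have h2 : (⨆ m : ℕ, ‖g₀ - extendExp (E m) g₀‖ₑ / ENNReal.ofReal (b m)) ≠ ∞ := by
      refine ne_top_of_le_ne_top (b := ∑ m ∈ Finset.range n,
        ‖g₀ - extendExp (E m) g₀‖ₑ / ENNReal.ofReal (b m)) ?_ (iSup_le fun m => ?_)
      · exact ENNReal.sum_ne_top.mpr fun m _ =>
          ENNReal.div_ne_top enorm_ne_top (h.ofReal_weight_ne_zero m)
      · by_cases hm : m < n
        · exact Finset.single_le_sum (f := fun m => ‖g₀ - extendExp (E m) g₀‖ₑ /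
            ENNReal.ofReal (b m)) (fun _ _ => zero_le) (Finset.mem_range.mpr hm)
        · rw [hEg m (not_lt.mp hm), sub_self, enorm_zero, ENNReal.zero_div]
          exact zero_le
    exact ENNReal.add_ne_top.mpr ⟨h1, h2⟩

end CondExpTower

/-! ### Total boundedness of the Lipschitz balls -/

theorem totallyBounded_of_approx {M : Type*} [PseudoMetricSpace M] {s : Set M}
    (h : ∀ ε > 0, ∃ t : Set M, TotallyBounded t ∧ ∀ x ∈ s, ∃ y ∈ t, dist x y < ε) :
    TotallyBounded s := by
  refine Metric.totallyBounded_iff.mpr fun ε hε => ?_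
  obtain ⟨t, ht, hst⟩ := h (ε / 2) (half_pos hε)
  obtain ⟨r, hr, htr⟩ := Metric.totallyBounded_iff.mp ht (ε / 2) (half_pos hε)
  refine ⟨r, hr, fun x hx => ?_⟩
  obtain ⟨y, hy, hxy⟩ := hst x hx
  obtain ⟨z, hz, hyz⟩ := Set.mem_iUnion₂.mp (htr hy)
  refine Set.mem_iUnion₂.mpr ⟨z, hz, ?_⟩
  rw [Metric.mem_ball] at hyz ⊢
  have := dist_triangle x y z
  linarith

/-- Arzelà–Ascoli: the `1`-Lipschitz condition gives equicontinuity, and the values stay in a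
compact set. -/
theorem totallyBounded_lipschitz {X : Type u} [MetricSpace X] [CompactSpace X] {A : Type v}
    [MetricSpace A] {K : Set A} (hK : IsCompact K) :
    TotallyBounded {f : C(X, A) | (∀ x, f x ∈ K) ∧ LipschitzWith 1 f} := by
  let e := ContinuousMap.isometryEquivBoundedOfCompact X A
  let s : Set (BoundedContinuousFunction X A) := {f | (∀ x, f x ∈ K) ∧ LipschitzWith 1 f}
  have hs : IsCompact (closure s) := by
    refine BoundedContinuousFunction.arzela_ascoli K hK s (fun f x hf => hf.1 x) ?_
    refine (LipschitzWith.uniformEquicontinuous _ 1 fun f => ?_).equicontinuous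
    exact f.2.2
  have := totallyBounded_preimage e.isometry.isUniformInducing
    (hs.totallyBounded.subset subset_closure)
  exact this

namespace CondExpTower

variable {A : Type v} [CStarAlgebra A] {X : Type u} [MetricSpace X] [CompactSpace X]
  {E : ℕ → A →L[ℂ] A} {b : ℕ → ℝ}

theorem dist_le_of_ahLip_le {f : selfAdjoint C(X, A)} (hf : ahLip E b f ≤ 1) (x y : X) :
    dist ((f : C(X, A)) x) ((f : C(X, A)) y) ≤ dist x y := by
  have h1 := edist_le_lipConst (f : C(X, A)) x y
  have h2 : edist ((f : C(X, A)) x) ((f : C(X, A)) y) ≤ edist x y :=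
    h1.trans (mul_le_of_le_one_left (zero_le) ((lipConst_le_ahLip f).trans hf))
  rw [edist_dist, edist_dist] at h2
  exact (ENNReal.ofReal_le_ofReal_iff dist_nonneg).mp h2

variable (h : CondExpTower E b)
include h

theorem norm_sub_le_of_ahLip_le {f : selfAdjoint C(X, A)} (hf : ahLip E b f ≤ 1) (n : ℕ) :
    ‖(f : C(X, A)) - extendExp (E n) f‖ ≤ b n := by
  have h1 := h.enorm_sub_le_ahLip f n
  have h2 : ‖(f : C(X, A)) - extendExp (E n) f‖ₑ ≤ ENNReal.ofReal (b n) :=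
    h1.trans (mul_le_of_le_one_left (zero_le) hf)
  rw [← ofReal_norm] at h2
  exact (ENNReal.ofReal_le_ofReal_iff (h.pos n).le).mp h2

/-- The scalar is `E_0 (f x₀)`: moving from `x` to `x₀` costs at most the diameter, and replacing `f
x₀` by its expectation costs `b 0`. -/
theorem exists_norm_sub_smul_one_le [Nonempty X] {f : selfAdjoint C(X, A)}
    (hf : ahLip E b f ≤ 1) :
    ∃ r : ℝ, ‖f - r • 1‖ ≤ Metric.diam (Set.univ : Set X) + b 0 := by
  obtain ⟨x₀⟩ := ‹Nonempty X›
  obtain ⟨r, hr⟩ := h.exists_real_scalar (isSelfAdjoint_coe_apply f x₀)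
  refine ⟨r, (ContinuousMap.norm_le _ (add_nonneg Metric.diam_nonneg (h.pos 0).le)).mpr
    fun x => ?_⟩
  have e : ((f - r • 1 : selfAdjoint C(X, A)) : C(X, A)) x = (f : C(X, A)) x - (r : ℂ) • 1 := by
    rw [Complex.coe_smul]; rfl
  have h1 : dist ((f : C(X, A)) x) ((f : C(X, A)) x₀) ≤ Metric.diam (Set.univ : Set X) :=
    (dist_le_of_ahLip_le hf x x₀).trans
      (Metric.dist_le_diam_of_mem (isCompact_univ.isBounded) (Set.mem_univ _) (Set.mem_univ _))
  have h2 : ‖(f : C(X, A)) x₀ - E 0 ((f : C(X, A)) x₀)‖ ≤ b 0 :=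
    (((f : C(X, A)) - extendExp (E 0) f).norm_coe_le_norm x₀).trans
      (h.norm_sub_le_of_ahLip_le hf 0)
  change ‖((f - r • 1 : selfAdjoint C(X, A)) : C(X, A)) x‖ ≤ _
  rw [e, ← hr]
  calc _ = ‖((f : C(X, A)) x - (f : C(X, A)) x₀) +
        ((f : C(X, A)) x₀ - E 0 ((f : C(X, A)) x₀))‖ := by rw [sub_add_sub_cancel]
    _ ≤ _ := (norm_add_le _ _).trans (add_le_add (by rwa [← dist_eq_norm]) h2)

theorem isCompact_range_inter (n : ℕ) (R : ℝ) :
    IsCompact {a : A | a ∈ (E n : A →ₗ[ℂ] A).range ∧ ‖a‖ ≤ R} := by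
  have := h.finiteDimensional n
  have := FiniteDimensional.proper ℂ (E n : A →ₗ[ℂ] A).range
  have h1 : {a : A | a ∈ (E n : A →ₗ[ℂ] A).range ∧ ‖a‖ ≤ R} =
      Subtype.val '' (Metric.closedBall (0 : (E n : A →ₗ[ℂ] A).range) R) := by
    ext a
    simp [and_comm]
  rw [h1]
  exact (isCompact_closedBall _ _).image continuous_subtype_val

/-- On the ball, `f` is within `b n` of `E_n f`, a `1`-Lipschitz function with values in a bounded,
hence relatively compact, part of a finite-dimensional space. -/
theorem totallyBounded_ahLip (R : ℝ) :
    TotallyBounded {f : selfAdjoint C(X, A) | ahLip E b f ≤ 1 ∧ ‖f‖ ≤ R} := by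
  set s := {f : selfAdjoint C(X, A) | ahLip E b f ≤ 1 ∧ ‖f‖ ≤ R} with hs
  have key : TotallyBounded (Subtype.val '' s) := by
    refine totallyBounded_of_approx fun ε hε => ?_
    obtain ⟨n, hn⟩ : ∃ n, b n < ε := by
      have := h.tendsto_weight.eventually (gt_mem_nhds hε)
      exact this.exists
    refine ⟨_, totallyBounded_lipschitz (X := X) (h.isCompact_range_inter n R), ?_⟩
    rintro _ ⟨f, ⟨hf, hfR⟩, rfl⟩
    refine ⟨extendExp (E n) f, ⟨fun x => ⟨⟨_, rfl⟩, ?_⟩, ?_⟩, ?_⟩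
    · exact (h.norm_le n _).trans (((f : C(X, A)).norm_coe_le_norm x).trans hfR)
    · refine LipschitzWith.of_dist_le_mul fun x y => ?_
      rw [extendExp_apply, extendExp_apply, dist_eq_norm, ← map_sub, NNReal.coe_one, one_mul]
      refine (h.norm_le n _).trans ?_
      rw [← dist_eq_norm]
      exact dist_le_of_ahLip_le hf x y
    · rw [dist_eq_norm]
      exact (h.norm_sub_le_of_ahLip_le hf n).trans_lt hn
  exact (totallyBounded_preimage isUniformEmbedding_subtype_val.isUniformInducing key).subset
    (Set.subset_preimage_image _ _)

theorem isTotallyBoundedLip_ahLip [Nonempty X] : IsTotallyBoundedLip (ahLip (X := X) E b) where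
  add_le := ahLip_add_le
  smul := ahLip_smul
  dense_dom := h.dense_ahLip_ne_top
  eq_zero_iff := h.ahLip_eq_zero_iff
  lowerSemicontinuous := h.lowerSemicontinuous_ahLip
  totallyBounded := ⟨_, fun _ => h.exists_norm_sub_smul_one_le, h.totallyBounded_ahLip _⟩

end CondExpTower

/-! ### The C⋆-tensor product of `C(X)` and a UHF algebra -/

section TensorEval

variable (X : Type u) [TopologicalSpace X] (A : Type v) [CStarAlgebra A]

/-- The map `f ↦ f 1` of `C(X)` to `C(X, A)`. -/
noncomputable def scalarFunHom : C(X, ℂ) →ₐ[ℂ] C(X, A) where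
  toFun f := ⟨fun x => f x • (1 : A), f.continuous.smul continuous_const⟩
  map_one' := ContinuousMap.ext fun x => one_smul ℂ _
  map_mul' f g := ContinuousMap.ext fun x => by
    simp [mul_smul, smul_comm (f x) (g x)]
  map_zero' := ContinuousMap.ext fun x => zero_smul ℂ _
  map_add' f g := ContinuousMap.ext fun x => add_smul _ _ _
  commutes' c := ContinuousMap.ext fun x => by
    simp [Algebra.algebraMap_eq_smul_one]

/-- The map of `A` to the constant functions in `C(X, A)`. -/
noncomputable def constFunHom : A →ₐ[ℂ] C(X, A) where
  toFun a := ContinuousMap.const X a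
  map_one' := rfl
  map_mul' _ _ := rfl
  map_zero' := rfl
  map_add' _ _ := rfl
  commutes' _ := rfl

theorem commute_scalarFunHom_constFunHom (f : C(X, ℂ)) (a : A) :
    Commute (scalarFunHom X A f) (constFunHom X A a) :=
  ContinuousMap.ext fun x => by
    change f x • (1 : A) * a = a * f x • (1 : A)
    rw [smul_one_mul, mul_smul_one]

/-- The algebra homomorphism `f ⊗ a ↦ (x ↦ f(x) a)`. -/
noncomputable def tensorEvalAlgHom : C(X, ℂ) ⊗[ℂ] A →ₐ[ℂ] C(X, A) :=
  Algebra.TensorProduct.lift (scalarFunHom X A) (constFunHom X A)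
    (commute_scalarFunHom_constFunHom X A)

theorem tensorEvalAlgHom_tmul (f : C(X, ℂ)) (a : A) (x : X) :
    tensorEvalAlgHom X A (f ⊗ₜ[ℂ] a) x = f x • a := by
  have h : tensorEvalAlgHom X A (f ⊗ₜ[ℂ] a) = scalarFunHom X A f * constFunHom X A a :=
    Algebra.TensorProduct.lift_tmul _ _ _ _ _
  rw [h]
  exact smul_one_mul _ _

/-- The canonical ⋆-homomorphism `f ⊗ a ↦ (x ↦ f(x) a)` of the algebraic tensor product of `C(X)`
and `A` to `C(X, A)`. -/
noncomputable def tensorEval : C(X, ℂ) ⊗[ℂ] A →⋆ₐ[ℂ] C(X, A) where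
  __ := tensorEvalAlgHom X A
  map_star' t := by
    change tensorEvalAlgHom X A (star t) = star (tensorEvalAlgHom X A t)
    induction t using TensorProduct.induction_on with
    | zero => rw [star_zero, map_zero, star_zero]
    | tmul f a =>
      refine ContinuousMap.ext fun x => ?_
      rw [TensorProduct.star_tmul, ContinuousMap.star_apply, tensorEvalAlgHom_tmul,
        tensorEvalAlgHom_tmul, star_smul]
      rfl
    | add s t hs ht => rw [star_add, map_add, hs, ht, map_add, star_add]

variable {X A}

theorem tensorEval_tmul (f : C(X, ℂ)) (a : A) (x : X) :
    tensorEval X A (f ⊗ₜ[ℂ] a) x = f x • a :=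
  tensorEvalAlgHom_tmul X A f a x

theorem tensorEval_one : tensorEval X A 1 = 1 := by
  refine ContinuousMap.ext fun x => ?_
  rw [Algebra.TensorProduct.one_def, tensorEval_tmul]
  exact one_smul ℂ _

end TensorEval

/-! ### Matrix-valued functions: `C(X) ⊗ M_k` is `C(X, M_k)` -/

section MatrixFunctions

variable {X : Type u} [TopologicalSpace X] {k : ℕ}

/-- The matrix unit `e_ij`. -/
def matUnit (i j : Fin k) : MatAlg k := CStarMatrix.ofMatrix (Matrix.single i j 1)

theorem sum_smul_matUnit (a : MatAlg k) : ∑ i, ∑ j, a i j • matUnit i j = a := by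
  have h := Matrix.matrix_eq_sum_single (CStarMatrix.ofMatrix.symm a)
  refine Eq.trans ?_ h.symm
  refine Finset.sum_congr rfl fun i _ => Finset.sum_congr rfl fun j _ => ?_
  have := Matrix.smul_single (a i j) i j (1 : ℂ)
  rw [smul_eq_mul, mul_one] at this
  exact this

theorem continuous_matAlg_apply (i j : Fin k) : Continuous fun a : MatAlg k => a i j :=
  AddMonoidHomClass.continuous_of_bound
    ({ toFun := fun a => a i j, map_zero' := rfl, map_add' := fun _ _ => rfl } : MatAlg k →+ ℂ) 1
    fun a => by
      rw [one_mul]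
      exact CStarMatrix.norm_entry_le_norm (M := a) (i := i) (j := j)

/-- The entries of a matrix valued function. -/
noncomputable def entryFun (i j : Fin k) : C(X, MatAlg k) →ₗ[ℂ] C(X, ℂ) where
  toFun F := ⟨fun x => F x i j, (continuous_matAlg_apply i j).comp F.continuous⟩
  map_add' _ _ := rfl
  map_smul' _ _ := rfl

/-- The inverse of `tensorEval` for matrix valued functions. -/
noncomputable def matrixTensor : C(X, MatAlg k) →ₗ[ℂ] C(X, ℂ) ⊗[ℂ] MatAlg k :=
  ∑ i, ∑ j, (TensorProduct.mk ℂ C(X, ℂ) (MatAlg k)).flip (matUnit i j) ∘ₗ entryFun i j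

theorem matrixTensor_apply (F : C(X, MatAlg k)) :
    matrixTensor F = ∑ i, ∑ j, entryFun i j F ⊗ₜ[ℂ] matUnit i j := by
  simp [matrixTensor, LinearMap.sum_apply]

theorem matrixTensor_tensorEval (t : C(X, ℂ) ⊗[ℂ] MatAlg k) :
    matrixTensor (tensorEval X (MatAlg k) t) = t := by
  induction t using TensorProduct.induction_on with
  | zero => simp
  | tmul f a =>
    rw [matrixTensor_apply]
    conv_rhs => rw [← sum_smul_matUnit a]
    rw [TensorProduct.tmul_sum]
    refine Finset.sum_congr rfl fun i _ => ?_
    rw [TensorProduct.tmul_sum]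
    refine Finset.sum_congr rfl fun j _ => ?_
    have e : entryFun i j (tensorEval X (MatAlg k) (f ⊗ₜ[ℂ] a)) = a i j • f := by
      refine ContinuousMap.ext fun x => ?_
      change (tensorEval X (MatAlg k) (f ⊗ₜ[ℂ] a)) x i j = a i j • f x
      rw [tensorEval_tmul, CStarMatrix.smul_apply, smul_eq_mul, smul_eq_mul, mul_comm]
    rw [e, TensorProduct.smul_tmul]
  | add s t hs ht => rw [map_add, map_add, hs, ht]

theorem tensorEval_matrixTensor (F : C(X, MatAlg k)) :
    tensorEval X (MatAlg k) (matrixTensor F) = F := by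
  refine ContinuousMap.ext fun x => ?_
  rw [matrixTensor_apply, map_sum, ContinuousMap.sum_apply]
  conv_rhs => rw [← sum_smul_matUnit (F x)]
  refine Finset.sum_congr rfl fun i _ => ?_
  rw [map_sum, ContinuousMap.sum_apply]
  refine Finset.sum_congr rfl fun j _ => ?_
  rw [tensorEval_tmul]
  rfl

/-- Matrix units invert `tensorEval`, so the algebraic tensor product is already the C⋆-algebra
`C(X, M_k)`, whose ⋆-homomorphisms are automatically contractive. -/
theorem norm_apply_le_norm_tensorEval [CompactSpace X] {D : Type*} [CStarAlgebra D]
    (Φ : C(X, ℂ) ⊗[ℂ] MatAlg k →⋆ₐ[ℂ] D) (t : C(X, ℂ) ⊗[ℂ] MatAlg k) :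
    ‖Φ t‖ ≤ ‖tensorEval X (MatAlg k) t‖ := by
  let e := StarAlgEquiv.ofBijective (tensorEval X (MatAlg k))
    ⟨Function.LeftInverse.injective matrixTensor_tensorEval,
      Function.RightInverse.surjective tensorEval_matrixTensor⟩
  let Ψ : C(X, MatAlg k) →⋆ₐ[ℂ] D := Φ.comp (e.symm : C(X, MatAlg k) →⋆ₐ[ℂ] _)
  have h := NonUnitalStarAlgHom.norm_apply_le Ψ (e t)
  have h2 : Ψ (e t) = Φ t := congrArg Φ (e.symm_apply_apply t)
  rwa [h2] at h

end MatrixFunctions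

/-! ### The maximal C⋆-norm on `C(X) ⊗ UHF(β)` is the supremum norm -/

section UHFTensor

variable {X : Type u} [TopologicalSpace X] [CompactSpace X] {β : BaireSeq}

variable (X β) in
/-- The inclusion of `C(X) ⊗ M_{⊠β(n)}(ℂ)` into the algebraic tensor product of `C(X)` and
`UHF(β)`. -/
noncomputable def tensorStage (n : ℕ) :
    C(X, ℂ) ⊗[ℂ] MatAlg (boxtimes β n) →⋆ₐ[ℂ] C(X, ℂ) ⊗[ℂ] UHF β where
  __ := Algebra.TensorProduct.map (AlgHom.id ℂ C(X, ℂ)) (uhfHom β n).toAlgHom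
  map_star' t := by
    change Algebra.TensorProduct.map (AlgHom.id ℂ C(X, ℂ)) (uhfHom β n).toAlgHom (star t) =
      star (Algebra.TensorProduct.map (AlgHom.id ℂ C(X, ℂ)) (uhfHom β n).toAlgHom t)
    induction t using TensorProduct.induction_on with
    | zero => simp
    | tmul f a =>
      rw [TensorProduct.star_tmul, Algebra.TensorProduct.map_tmul,
        Algebra.TensorProduct.map_tmul, TensorProduct.star_tmul]
      congr 1
      exact map_star (uhfHom β n) a
    | add s t hs ht => rw [star_add, map_add, hs, ht, map_add, star_add]

theorem tensorStage_tmul (n : ℕ) (f : C(X, ℂ)) (a : MatAlg (boxtimes β n)) :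
    tensorStage X β n (f ⊗ₜ[ℂ] a) = f ⊗ₜ[ℂ] uhfHom β n a := rfl

theorem tensorEval_tensorStage (n : ℕ) (t : C(X, ℂ) ⊗[ℂ] MatAlg (boxtimes β n)) (x : X) :
    tensorEval X (UHF β) (tensorStage X β n t) x = uhfHom β n (tensorEval X _ t x) := by
  induction t using TensorProduct.induction_on with
  | zero => simp
  | tmul f a => rw [tensorStage_tmul, tensorEval_tmul, tensorEval_tmul, map_smul]
  | add s t hs ht =>
    rw [map_add, map_add, ContinuousMap.add_apply, hs, ht, map_add, ContinuousMap.add_apply,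
      map_add]

theorem norm_tensorEval_tensorStage (n : ℕ) (t : C(X, ℂ) ⊗[ℂ] MatAlg (boxtimes β n)) :
    ‖tensorEval X (UHF β) (tensorStage X β n t)‖ = ‖tensorEval X _ t‖ := by
  refine le_antisymm ?_ ?_
  · refine (ContinuousMap.norm_le _ (norm_nonneg _)).mpr fun x => ?_
    rw [tensorEval_tensorStage, norm_uhfHom]
    exact ContinuousMap.norm_coe_le_norm _ x
  · refine (ContinuousMap.norm_le _ (norm_nonneg _)).mpr fun x => ?_
    rw [← norm_uhfHom β n, ← tensorEval_tensorStage]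
    exact ContinuousMap.norm_coe_le_norm _ x

theorem CStarSeminorm.tensorStage_le (p : CStarSeminorm (C(X, ℂ) ⊗[ℂ] UHF β)) (n : ℕ)
    (t : C(X, ℂ) ⊗[ℂ] MatAlg (boxtimes β n)) :
    p.toSeminorm (tensorStage X β n t) ≤ ‖tensorEval X (UHF β) (tensorStage X β n t)‖ := by
  rw [← p.norm_coe, norm_tensorEval_tensorStage]
  exact norm_apply_le_norm_tensorEval (p.coeHom.comp (tensorStage X β n)) t

variable (X β) in
/-- The map of the algebraic tensor product of `C(X)` and `UHF(β)` to `C(X) ⊗ M_{⊠β(n)}(ℂ)` induced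
by the trace preserving map. -/
noncomputable def tensorProj (n : ℕ) :
    C(X, ℂ) ⊗[ℂ] UHF β →ₗ[ℂ] C(X, ℂ) ⊗[ℂ] MatAlg (boxtimes β n) :=
  LinearMap.lTensor C(X, ℂ) (uhfProj β n : UHF β →ₗ[ℂ] MatAlg (boxtimes β n))

/-- On elementary tensors this is `p(f ⊗ c) ≤ ‖f‖ ‖c‖` with `c = a - E_n a → 0`; sums follow by
subadditivity. -/
theorem CStarSeminorm.tendsto_tensorProj (p : CStarSeminorm (C(X, ℂ) ⊗[ℂ] UHF β))
    (t : C(X, ℂ) ⊗[ℂ] UHF β) :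
    Filter.Tendsto (fun n => p.toSeminorm (t - tensorStage X β n (tensorProj X β n t)))
      Filter.atTop (𝓝 0) := by
  induction t using TensorProduct.induction_on with
  | zero => simp
  | tmul f a =>
    have h1 : Filter.Tendsto (fun n => ‖f‖ * ‖a - uhfExp β n a‖) Filter.atTop (𝓝 0) := by
      have := ((tendsto_const_nhds (x := a)).sub (tendsto_uhfExp a)).norm.const_mul ‖f‖
      simpa using this
    refine squeeze_zero (fun n => apply_nonneg _ _) (fun n => ?_) h1
    have e : f ⊗ₜ[ℂ] a - tensorStage X β n (tensorProj X β n (f ⊗ₜ[ℂ] a)) =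
        f ⊗ₜ[ℂ] (a - uhfExp β n a) := by
      rw [TensorProduct.tmul_sub]
      rfl
    rw [e]
    exact p.tmul_le _ _
  | add s t hs ht =>
    have h := hs.add ht
    rw [add_zero] at h
    refine squeeze_zero (fun n => apply_nonneg _ _) (fun n => ?_) h
    rw [map_add, map_add, add_sub_add_comm]
    exact map_add_le_add p.toSeminorm _ _

variable (X β) in
/-- The C⋆-seminorm of `C(X, UHF(β))` on the algebraic tensor product. -/
noncomputable def evalSeminorm : CStarSeminorm (C(X, ℂ) ⊗[ℂ] UHF β) where
  toFun t := ‖tensorEval X (UHF β) t‖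
  map_zero' := by simp
  add_le' s t := by rw [map_add]; exact norm_add_le _ _
  neg' t := by rw [map_neg, norm_neg]
  smul' c t := by rw [map_smul, norm_smul]
  mul_le' s t := by
    change ‖tensorEval X (UHF β) (s * t)‖ ≤ _
    rw [map_mul]
    exact norm_mul_le _ _
  star_mul_self' t := by
    change ‖tensorEval X (UHF β) (star t * t)‖ = ‖tensorEval X (UHF β) t‖ ^ 2
    rw [map_mul, map_star, CStarRing.norm_star_mul_self, sq]

theorem evalSeminorm_apply (t : C(X, ℂ) ⊗[ℂ] UHF β) :
    (evalSeminorm X β).toSeminorm t = ‖tensorEval X (UHF β) t‖ := rfl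

/-- The inequality holds at every matrix stage. It passes to `t` because the truncations of `t`
converge to it both for `p` and for the supremum seminorm. -/
theorem CStarSeminorm.le_norm_tensorEval (p : CStarSeminorm (C(X, ℂ) ⊗[ℂ] UHF β))
    (t : C(X, ℂ) ⊗[ℂ] UHF β) : p.toSeminorm t ≤ ‖tensorEval X (UHF β) t‖ := by
  have h := (p.tendsto_tensorProj t).add ((evalSeminorm X β).tendsto_tensorProj t)
  have h2 := h.add_const ‖tensorEval X (UHF β) t‖
  rw [add_zero, zero_add] at h2
  refine ge_of_tendsto' h2 fun n => ?_
  set s := tensorStage X β n (tensorProj X β n t) with hs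
  have h3 : p.toSeminorm t ≤ p.toSeminorm (t - s) + p.toSeminorm s := by
    have := map_add_le_add p.toSeminorm (t - s) s
    rwa [sub_add_cancel] at this
  have h4 : p.toSeminorm s ≤ ‖tensorEval X (UHF β) s‖ := p.tensorStage_le n _
  have h5 : ‖tensorEval X (UHF β) s‖ ≤
      (evalSeminorm X β).toSeminorm (t - s) + ‖tensorEval X (UHF β) t‖ := by
    rw [evalSeminorm_apply, map_sub, add_comm, ← norm_neg (_ - _), neg_sub]
    have := norm_add_le (tensorEval X (UHF β) t) (tensorEval X (UHF β) s - tensorEval X (UHF β) t)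
    rwa [add_sub_cancel] at this
  linarith

variable (X β) in
/-- The largest C⋆-seminorm on the algebraic tensor product of `C(X)` and `UHF(β)`. -/
noncomputable abbrev maxSeminorm : CStarSeminorm (C(X, ℂ) ⊗[ℂ] UHF β) :=
  CStarSeminorm.sup (CStarSeminorm.bddAbove_tensor (A := C(X, ℂ)) (B := UHF β))

/-- The supremum norm dominates all C⋆-seminorms and is one of them. -/
theorem norm_coe_maxSeminorm (t : C(X, ℂ) ⊗[ℂ] UHF β) :
    ‖(maxSeminorm X β).coe t‖ = ‖tensorEval X (UHF β) t‖ := by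
  rw [CStarSeminorm.norm_coe]
  refine le_antisymm ((maxSeminorm X β).le_norm_tensorEval t) ?_
  exact le_ciSup (CStarSeminorm.bddAbove_tensor t) (evalSeminorm X β)

variable (X β) in
/-- The canonical map of the C⋆-tensor product to `C(X, UHF(β))` as a continuous linear map. -/
noncomputable def tensorEvalL : CStarTensor C(X, ℂ) (UHF β) →L[ℂ] C(X, UHF β) :=
  (tensorEval X (UHF β)).toAlgHom.toLinearMap.extendOfNorm
    (maxSeminorm X β).coeHom.toAlgHom.toLinearMap

theorem tensorEvalL_coe (t : C(X, ℂ) ⊗[ℂ] UHF β) :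
    tensorEvalL X β ((maxSeminorm X β).coe t) = tensorEval X (UHF β) t :=
  LinearMap.extendOfNorm_eq (maxSeminorm X β).denseRange_coe
    ⟨1, fun t => by rw [one_mul]; exact (norm_coe_maxSeminorm t).ge⟩ t

theorem norm_tensorEvalL (t : CStarTensor C(X, ℂ) (UHF β)) : ‖tensorEvalL X β t‖ = ‖t‖ := by
  refine (maxSeminorm X β).denseRange_coe.induction_on
    (p := fun t => ‖tensorEvalL X β t‖ = ‖t‖) t
    (isClosed_eq (tensorEvalL X β).continuous.norm continuous_norm) fun t => ?_
  rw [tensorEvalL_coe, norm_coe_maxSeminorm]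

variable (X β) in
/-- The canonical ⋆-homomorphism of the C⋆-tensor product to `C(X, UHF(β))`. -/
noncomputable def tensorEvalHom : CStarTensor C(X, ℂ) (UHF β) →⋆ₐ[ℂ] C(X, UHF β) where
  __ := AlgHom.ofLinearMap (tensorEvalL X β : CStarTensor C(X, ℂ) (UHF β) →ₗ[ℂ] C(X, UHF β))
    (by
      change tensorEvalL X β 1 = 1
      exact ((congrArg _ (CStarSeminorm.coe_one _).symm).trans (tensorEvalL_coe 1)).trans
        tensorEval_one)
    (fun s t => by
      change tensorEvalL X β (s * t) = tensorEvalL X β s * tensorEvalL X β t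
      refine (maxSeminorm X β).denseRange_coe.induction_on₂
        (p := fun s t => tensorEvalL X β (s * t) = tensorEvalL X β s * tensorEvalL X β t)
        (isClosed_eq ((tensorEvalL X β).continuous.comp continuous_mul)
          (((tensorEvalL X β).continuous.comp continuous_fst).mul
            ((tensorEvalL X β).continuous.comp continuous_snd))) (fun s t => ?_) s t
      rw [← CStarSeminorm.coe_mul, tensorEvalL_coe, tensorEvalL_coe, tensorEvalL_coe, map_mul])
  map_star' t := by
    change tensorEvalL X β (star t) = star (tensorEvalL X β t)
    refine (maxSeminorm X β).denseRange_coe.induction_on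
      (p := fun t => tensorEvalL X β (star t) = star (tensorEvalL X β t)) t
      (isClosed_eq ((tensorEvalL X β).continuous.comp continuous_star)
        (tensorEvalL X β).continuous.star) fun t => ?_
    rw [← CStarSeminorm.coe_star, tensorEvalL_coe, tensorEvalL_coe, map_star]

end UHFTensor

/-! ### The canonical isomorphism with `C(X, UHF(β))` -/

section UHFTensorMetric

variable (X : Type u) [MetricSpace X] [CompactSpace X] (β : BaireSeq)

theorem denseRange_tensorEval {A : Type v} [CStarAlgebra A] : DenseRange (tensorEval X A) := by
  refine Metric.denseRange_iff.mpr fun f ε hε => ?_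
  obtain ⟨t, w, -, happ⟩ := exists_partition_approx f (ε := ε / 3) (by positivity)
  let z : C(X, ℂ) ⊗[ℂ] A := ∑ i ∈ t, (⟨fun x => ((w i x : ℝ) : ℂ),
    Complex.continuous_ofReal.comp (w i).continuous⟩ : C(X, ℂ)) ⊗ₜ[ℂ] f i
  refine ⟨z, ?_⟩
  rw [dist_eq_norm]
  refine lt_of_le_of_lt ((ContinuousMap.norm_le _ (by positivity : (0 : ℝ) ≤ 2 * (ε / 3))).mpr
    fun x => ?_) (by linarith)
  have e : tensorEval X A z x = ∑ i ∈ t, ((w i x : ℝ) : ℂ) • f i := by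
    simp only [z, map_sum, ContinuousMap.sum_apply, tensorEval_tmul]
    rfl
  rw [ContinuousMap.sub_apply, e]
  exact happ f (fun i _ => by rw [sub_self, norm_zero]; positivity) x

/-- An isometry on a complete space has closed range, and the range is dense by partitions of unity.
-/
theorem bijective_tensorEvalHom : Function.Bijective (tensorEvalHom X β) := by
  have hiso : Isometry (tensorEvalL X β) :=
    AddMonoidHomClass.isometry_of_norm (tensorEvalL X β) norm_tensorEvalL
  refine ⟨hiso.injective, ?_⟩
  have hcl : IsClosed (Set.range (tensorEvalL X β)) := hiso.isClosedEmbedding.isClosed_range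
  have hd : Dense (Set.range (tensorEvalL X β)) := by
    refine (denseRange_tensorEval X (A := UHF β)).mono ?_
    rintro _ ⟨t, rfl⟩
    exact ⟨_, tensorEvalL_coe t⟩
  have h := hcl.closure_eq.symm.trans hd.closure_eq
  exact Set.range_eq_univ.mp h

/-- The canonical ⋆-isomorphism of the C⋆-tensor product with `C(X, UHF(β))`. -/
noncomputable def tensorEquiv : CStarTensor C(X, ℂ) (UHF β) ≃⋆ₐ[ℂ] C(X, UHF β) :=
  StarAlgEquiv.ofBijective (tensorEvalHom X β) (bijective_tensorEvalHom X β)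

theorem tensorEquiv_tmul (f : C(X, ℂ)) (a : UHF β) (x : X) :
    tensorEquiv X β (CStarTensor.tmul f a) x = f x • a := by
  change tensorEvalL X β ((maxSeminorm X β).coe _) x = _
  rw [tensorEvalL_coe, tensorEval_tmul]

end UHFTensorMetric

/-! ### Retractions given by conditional expectations -/

section TowerRetraction

variable {A B : Type v} [CStarAlgebra A] [CStarAlgebra B]

/-- A ⋆-homomorphism of C⋆-algebras as a continuous linear map. -/
noncomputable def StarAlgHom.toContinuousLinear (f : A →⋆ₐ[ℂ] B) : A →L[ℂ] B :=
  LinearMap.mkContinuous f.toAlgHom.toLinearMap 1 fun a => by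
    rw [one_mul]
    exact NonUnitalStarAlgHom.norm_apply_le f a

theorem StarAlgHom.continuous_of_cstar (f : A →⋆ₐ[ℂ] B) : Continuous f :=
  f.toContinuousLinear.continuous

variable {X : Type u} [MetricSpace X] [CompactSpace X]

/-- The compression to `B` of a family of maps of `A`. -/
noncomputable def compress (ι : B →⋆ₐ[ℂ] A) (p : A →L[ℂ] B) (E : ℕ → A →L[ℂ] A) (n : ℕ) :
    B →L[ℂ] B := p ∘L E n ∘L ι.toContinuousLinear

theorem compress_apply (ι : B →⋆ₐ[ℂ] A) (p : A →L[ℂ] B) (E : ℕ → A →L[ℂ] A) (n : ℕ) (b : B) :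
    compress ι p E n b = p (E n (ι b)) := rfl

theorem ContinuousMap.norm_eq_of_forall {C : Type*} [NormedAddCommGroup C] {f : C(X, A)}
    {g : C(X, C)} (h : ∀ x, ‖f x‖ = ‖g x‖) : ‖f‖ = ‖g‖ := by
  refine le_antisymm ?_ ?_
  · exact (ContinuousMap.norm_le _ (norm_nonneg _)).mpr fun x =>
      (h x).le.trans (g.norm_coe_le_norm x)
  · exact (ContinuousMap.norm_le _ (norm_nonneg _)).mpr fun x =>
      (h x).ge.trans (f.norm_coe_le_norm x)

namespace CondExpTower

variable {E : ℕ → A →L[ℂ] A} {b : ℕ → ℝ} (h : CondExpTower E b)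
include h

omit [CompactSpace X] in
theorem lipConst_extendExp_le (n : ℕ) (f : C(X, A)) :
    lipConst (extendExp (E n) f) ≤ lipConst f := by
  refine lipConst_le_iff.mpr fun x y => le_trans ?_ (edist_le_lipConst f x y)
  rw [extendExp_apply, extendExp_apply, edist_dist, edist_dist, dist_eq_norm, dist_eq_norm,
    ← map_sub]
  exact ENNReal.ofReal_le_ofReal (h.norm_le n _)

/-- For `n ≥ N` the `n`-th term of `E_N f` vanishes; for `n ≤ N` it is `E_N (f - E_n f)`, since the
expectations commute. -/
theorem ahLip_extendExp_le (N : ℕ) (f g : selfAdjoint C(X, A))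
    (hg : (g : C(X, A)) = extendExp (E N) f) : ahLip E b g ≤ ahLip E b f := by
  unfold ahLip
  rw [hg]
  generalize (f : C(X, A)) = f
  refine add_le_add (h.lipConst_extendExp_le N f) (iSup_mono fun n => ?_)
  gcongr ?_ / _
  rcases le_total N n with hn | hn
  · have e : extendExp (E N) f - extendExp (E n) (extendExp (E N) f) = 0 :=
      ContinuousMap.ext fun x => sub_eq_zero.mpr (h.apply_of_le hn _).symm
    rw [e, enorm_zero]
    exact zero_le
  · have e : extendExp (E N) f - extendExp (E n) (extendExp (E N) f) =
        extendExp (E N) (f - extendExp (E n) f) := ContinuousMap.ext fun x => by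
      change E N (f x) - E n (E N (f x)) = E N (f x - E n (f x))
      rw [map_sub, h.apply_of_ge hn, h.apply_of_le hn]
    rw [e, ← ofReal_norm, ← ofReal_norm]
    exact ENNReal.ofReal_le_ofReal (norm_extendExp_le (h.norm_le N) _)

/-- The retraction of the Lip-norm of a tower given by one of its conditional expectations. -/
noncomputable def lipRetraction {ι : B →⋆ₐ[ℂ] A} {p : A →L[ℂ] B} {N : ℕ} (hp : ∀ b, p (ι b) = b)
    (hι : ∀ a, ι (p a) = E N a) :
    LipRetraction (ahLip (X := X) E b) (ahLip (X := X) (compress ι p E) b)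
      (ENNReal.ofReal (b N)) := by
  have hinj : Function.Injective ι := Function.LeftInverse.injective hp
  have hn : ∀ c, ‖ι c‖ = ‖c‖ := NonUnitalStarAlgHom.norm_map ι hinj
  -- Every `E_n` preserves the range of `ι`, which is that of `E_N`: for `n ≥ N` it acts there as
  -- the identity, for `n ≤ N` its range is smaller. Compressing therefore loses nothing.
  have hE : ∀ n c, ι (p (E n (ι c))) = E n (ι c) := fun n c => by
    rw [hι]
    rcases le_total N n with hNn | hNn
    · have e : ι c = E N (ι c) := by rw [← hι, hp]
      rw [e, h.apply_of_le hNn, h.apply_of_le le_rfl]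
    · exact h.apply_of_le hNn _
  have hlip : ∀ g : selfAdjoint C(X, B),
      ahLip E b (saMap (ContinuousMap.compStarAlgHom X ι ι.continuous_of_cstar) g) =
        ahLip (compress ι p E) b g := by
    intro g
    unfold ahLip
    rw [coe_saMap]
    generalize (g : C(X, B)) = g
    congr 1
    · unfold lipConst
      refine iSup_congr fun x => iSup_congr fun y => ?_
      congr 1
      change edist (ι (g x)) (ι (g y)) = _
      rw [edist_dist, edist_dist, dist_eq_norm, dist_eq_norm, ← map_sub, hn]
    · refine iSup_congr fun n => ?_
      congr 1
      rw [← ofReal_norm, ← ofReal_norm]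
      congr 1
      refine ContinuousMap.norm_eq_of_forall fun x => ?_
      change ‖ι (g x) - E n (ι (g x))‖ = ‖g x - p (E n (ι (g x)))‖
      rw [← hE, ← map_sub, hn, hp]
  exact
  { incl := ContinuousMap.compStarAlgHom X ι ι.continuous_of_cstar
    proj := p.compLeftContinuous ℂ X
    proj_incl := fun g => ContinuousMap.ext fun x => hp _
    norm_proj_le := fun f => (ContinuousMap.norm_le _ (norm_nonneg f)).mpr fun x => by
      change ‖p (f x)‖ ≤ _
      rw [← hn, hι]
      exact (h.norm_le N _).trans (f.norm_coe_le_norm x)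
    proj_star := fun f => ContinuousMap.ext fun x => hinj <| by
      change ι (p (star (f x))) = ι (star (p (f x)))
      rw [StarHomClass.map_star ι, hι, hι, h.map_star]
    lip_incl := hlip
    lip_proj := fun f g hg => by
      rw [← hlip]
      refine h.ahLip_extendExp_le N f _ ?_
      rw [coe_saMap, hg]
      exact ContinuousMap.ext fun x => hι _
    enorm_sub_le := fun f hf => by
      have e : ContinuousMap.compStarAlgHom X ι ι.continuous_of_cstar
          (p.compLeftContinuous ℂ X (f : C(X, A))) = extendExp (E N) f :=
        ContinuousMap.ext fun x => hι _
      rw [e]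
      refine (h.enorm_sub_le_ahLip f N).trans ?_
      exact (mul_le_mul_left hf _).trans (one_mul _).le }

end CondExpTower

end TowerRetraction

/-! ### Transport of retractions along ⋆-isomorphisms -/

namespace LipRetraction

variable {A A' B : Type u} [CStarAlgebra A] [CStarAlgebra A'] [CStarAlgebra B]
  {LA : selfAdjoint A → ℝ≥0∞} {LB : selfAdjoint B → ℝ≥0∞} {ε : ℝ≥0∞}

/-- The retraction from the domain of a ⋆-isomorphism obtained from one from its codomain. -/
noncomputable def precompEquiv (ρ : LipRetraction LA LB ε) (e : A' ≃⋆ₐ[ℂ] A) :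
    LipRetraction (fun a => LA (saMap (e : A' →⋆ₐ[ℂ] A) a)) LB ε := by
  have hn : ∀ a, ‖e a‖ = ‖a‖ := NonUnitalStarAlgHom.norm_map (e : A' →⋆ₐ[ℂ] A) e.injective
  exact
  { incl := (e.symm : A →⋆ₐ[ℂ] A').comp ρ.incl
    proj := ρ.proj ∘L (e : A' →⋆ₐ[ℂ] A).toContinuousLinear
    proj_incl := fun b => by
      change ρ.proj (e (e.symm (ρ.incl b))) = b
      rw [e.apply_symm_apply, ρ.proj_incl]
    norm_proj_le := fun a => (ρ.norm_proj_le (e a)).trans (hn a).le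
    proj_star := fun a => by
      change ρ.proj (e (star a)) = star (ρ.proj (e a))
      rw [map_star, ρ.proj_star]
    lip_incl := fun b => by
      rw [← ρ.lip_incl b]
      congr 1
      exact Subtype.ext (e.apply_symm_apply _)
    lip_proj := fun a b hb => ρ.lip_proj _ b hb
    enorm_sub_le := fun a ha => by
      have h := ρ.enorm_sub_le _ ha
      rw [← ofReal_norm] at h ⊢
      refine le_trans (le_of_eq (congrArg _ ?_)) h
      rw [← hn, map_sub]
      congr 2
      exact e.apply_symm_apply _ }

/-- A ⋆-isomorphism as a retraction onto its domain. -/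
noncomputable def ofEquiv (e : A' ≃⋆ₐ[ℂ] A) (LA : selfAdjoint A → ℝ≥0∞) :
    LipRetraction LA (fun a => LA (saMap (e : A' →⋆ₐ[ℂ] A) a)) 0 where
  incl := e
  proj := (e.symm : A →⋆ₐ[ℂ] A').toContinuousLinear
  proj_incl := e.symm_apply_apply
  norm_proj_le := NonUnitalStarAlgHom.norm_apply_le (e.symm : A →⋆ₐ[ℂ] A')
  proj_star := map_star (e.symm : A →⋆ₐ[ℂ] A')
  lip_incl _ := rfl
  lip_proj a b hb := le_of_eq <| by
    congr 1
    refine Subtype.ext ?_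
    rw [coe_saMap, hb]
    exact e.apply_symm_apply _
  enorm_sub_le a _ := by
    have h : (e : A' →⋆ₐ[ℂ] A) ((e.symm : A →⋆ₐ[ℂ] A').toContinuousLinear a) = a :=
      e.apply_symm_apply _
    rw [h, sub_self, enorm_zero]

end LipRetraction

/-! ### The Lip-norms of UHF algebras -/

/-- The entries of a Baire sequence are positive, so each factor is at least `2`. This matches the
weights to the metric of the Baire space. -/
theorem two_pow_le_boxtimes (β : BaireSeq) (n : ℕ) : 2 ^ n ≤ boxtimes β n := by
  have h : ∏ _j ∈ Finset.range n, 2 ≤ boxtimes β n :=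
    Finset.prod_le_prod' fun j _ => Nat.succ_le_succ (β j).pos
  simpa using h

theorem boxtimes_eq_of_forall_lt {β η : BaireSeq} {n : ℕ} (h : ∀ j < n, β j = η j) :
    boxtimes β n = boxtimes η n :=
  Finset.prod_congr rfl fun j hj => by rw [h j (Finset.mem_range.mp hj)]

theorem one_div_boxtimes_le (β : BaireSeq) (n : ℕ) :
    1 / (boxtimes β n : ℝ) ≤ ((2 : ℝ) ^ n)⁻¹ := by
  rw [one_div]
  refine inv_anti₀ (by positivity) ?_
  exact_mod_cast two_pow_le_boxtimes β n

theorem condExpTower_uhfExp (β : BaireSeq) :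
    CondExpTower (uhfExp β) fun n => 1 / (boxtimes β n : ℝ) where
  norm_le := norm_uhfExp_le
  apply_of_le h a := uhfExp_uhfExp_of_le h a
  apply_of_ge h a := uhfExp_uhfExp_of_ge h a
  map_star := uhfExp_star
  map_one := uhfExp_one
  map_mul := uhfExp_mul
  tendsto := tendsto_uhfExp
  finiteDimensional n := by
    have hle : (uhfExp β n : UHF β →ₗ[ℂ] UHF β).range ≤
        (uhfHom β n).toAlgHom.toLinearMap.range := by
      rintro _ ⟨x, rfl⟩
      exact ⟨uhfProj β n x, (uhfExp_apply n x).symm⟩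
    exact Submodule.finiteDimensional_of_le hle
  scalar a := by
    -- The stage `0` consists of `1 × 1` matrices, whose only entry is the scalar.
    refine ⟨uhfProj β 0 a ⟨0, boxtimes_pos β 0⟩ ⟨0, boxtimes_pos β 0⟩, ?_⟩
    rw [uhfExp_apply, ← map_one (uhfHom β 0), ← map_smul]
    congr 1
    have h1 : boxtimes β 0 = 1 := rfl
    have hs : ∀ i : Fin (boxtimes β 0), i = ⟨0, boxtimes_pos β 0⟩ := fun i =>
      Fin.ext (Nat.lt_one_iff.mp (i.2.trans_eq h1))
    ext i j
    rw [hs i, hs j, CStarMatrix.smul_apply, CStarMatrix.one_apply, if_pos rfl, smul_eq_mul, mul_one]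
  pos n := one_div_pos.mpr (Nat.cast_pos.mpr (boxtimes_pos β n))
  tendsto_weight := by
    refine squeeze_zero (fun n => by positivity) (one_div_boxtimes_le β) ?_
    exact tendsto_inv_atTop_zero.comp (tendsto_pow_atTop_atTop_of_one_lt one_lt_two)

/-- The maps of `UHF(β)` to and from `M_{⊠β(N)}(ℂ)`, with the description of the conditional
expectations on this algebra in terms of matrices. -/
theorem exists_matrix_compression (β : BaireSeq) (N k : ℕ) (hk : boxtimes β N = k) :
    ∃ (ι : MatAlg k →⋆ₐ[ℂ] UHF β) (p : UHF β →L[ℂ] MatAlg k),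
      (∀ a, p (ι a) = a) ∧ (∀ x, ι (p x) = uhfExp β N x) ∧
      (∀ n ≤ N, ∀ a, compress ι p (uhfExp β) n a =
        amplifyFun (boxtimes_pos β n) (blockTrace (boxtimes β n) k a)) ∧
      ∀ n, N ≤ n → ∀ a, compress ι p (uhfExp β) n a = a := by
  -- The size is a free variable so that two sequences with propositionally equal `⊠(N)` can share
  -- the type `MatAlg k`.
  subst hk
  refine ⟨uhfHom β N, uhfProj β N, uhfProj_uhfHom_self N, fun x => (uhfExp_apply N x).symm,
    fun n hn a => ?_, fun n hn a => ?_⟩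
  · rw [compress_apply, uhfExp_apply, uhfProj_uhfHom hn, ← uhfHom_map β hn, uhfProj_uhfHom_self]
    rfl
  · rw [compress_apply, uhfExp_uhfHom hn, uhfProj_uhfHom_self]

/-- The inner sizes `⊠β(n)` and `⊠η(n)` are equal but not definitionally so; this transports the
description of `E_n` from one to the other. -/
theorem amplifyFun_blockTrace_congr {k k' l : ℕ} (h : k = k') (hk : 0 < k) (hk' : 0 < k')
    (a : MatAlg l) : (amplifyFun hk (blockTrace k l a) : MatAlg l) =
      amplifyFun hk' (blockTrace k' l a) := by
  subst h
  rfl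

theorem LipRetraction.isQCQMS {A B : Type u} [CStarAlgebra A] [CStarAlgebra B] {C : ℝ≥0}
    {LA : selfAdjoint A → ℝ≥0∞} {LB : selfAdjoint B → ℝ≥0∞} {ε : ℝ≥0∞}
    (ρ : LipRetraction LA LB ε) (h : IsTotallyBoundedLip LA) (hq : IsQuasiLeibniz C LA) :
    (LipPair.mk B LB).IsQCQMS C :=
  ⟨(ρ.isTotallyBoundedLip h).isLipNorm, ρ.isQuasiLeibniz hq⟩

variable (X : Type u) [MetricSpace X] [CompactSpace X]

theorem isTotallyBoundedLip_uhfFunPair [Nonempty X] (β : BaireSeq) :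
    IsTotallyBoundedLip (uhfFunPair X β (uhfExp β)).lip :=
  (condExpTower_uhfExp β).isTotallyBoundedLip_ahLip

theorem isQuasiLeibniz_uhfFunPair (β : BaireSeq) :
    IsQuasiLeibniz 2 (uhfFunPair X β (uhfExp β)).lip :=
  (condExpTower_uhfExp β).isQuasiLeibniz_ahLip

theorem isQCQMS_uhfFunPair [Nonempty X] (β : BaireSeq) :
    (uhfFunPair X β (uhfExp β)).IsQCQMS 2 :=
  ⟨(isTotallyBoundedLip_uhfFunPair X β).isLipNorm, isQuasiLeibniz_uhfFunPair X β⟩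

theorem nonempty_stateSpace_continuousMap_uhf [Nonempty X] (β : BaireSeq) :
    (stateSpace C(X, UHF β)).Nonempty := by
  obtain ⟨x⟩ := ‹Nonempty X›
  let φ : C(X, UHF β) →L[ℂ] ℂ :=
    (WeakDual.toStrongDual (uhfTrace β)).comp (ContinuousMap.evalCLM ℂ x)
  refine ⟨StrongDual.toWeakDual φ, fun f => ?_, ?_⟩
  · exact (isTracialState_uhfTrace (β := β)).1.1 (f x)
  · exact (isTracialState_uhfTrace (β := β)).1.2

theorem nonempty_stateSpace_uhfFunPair [Nonempty X] (β : BaireSeq)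
    (E : ℕ → UHF β →L[ℂ] UHF β) : (stateSpace (uhfFunPair X β E).carrier).Nonempty :=
  nonempty_stateSpace_continuousMap_uhf X β

theorem nonempty_stateSpace_uhfTensorPair [Nonempty X] (β : BaireSeq)
    (E : ℕ → UHF β →L[ℂ] UHF β) (π : CStarTensor C(X, ℂ) (UHF β) ≃⋆ₐ[ℂ] C(X, UHF β)) :
    (stateSpace (uhfTensorPair X β E π).carrier).Nonempty := by
  obtain ⟨φ, hφ⟩ := nonempty_stateSpace_continuousMap_uhf X β
  exact ⟨_, dualMap_mem_stateSpace (π : CStarTensor C(X, ℂ) (UHF β) →⋆ₐ[ℂ] C(X, UHF β)) hφ⟩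

/-- An isomorphism is a retraction moving no element, so all the properties are inherited from `C(X,
UHF(β))`. -/
theorem isQCQMS_uhfTensorPair [Nonempty X] (β : BaireSeq)
    (π : CStarTensor C(X, ℂ) (UHF β) ≃⋆ₐ[ℂ] C(X, UHF β)) :
    (uhfTensorPair X β (uhfExp β) π).IsQCQMS 2 := by
  have ρ := LipRetraction.ofEquiv π (uhfFunPair X β (uhfExp β)).lip
  have h := ρ.isQCQMS (isTotallyBoundedLip_uhfFunPair X β) (isQuasiLeibniz_uhfFunPair X β)
  exact h

-- From `N` on both numerators vanish, so the weights beyond `N`, where the two sequences may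
-- differ, are irrelevant.
variable {X} in
theorem ahLip_congr {A : Type v} [CStarAlgebra A] {E F : ℕ → A →L[ℂ] A} {b c : ℕ → ℝ} {N : ℕ}
    (hEF : ∀ n ≤ N, E n = F n) (hbc : ∀ n ≤ N, b n = c n) (hE : ∀ n, N ≤ n → ∀ a, E n a = a)
    (hF : ∀ n, N ≤ n → ∀ a, F n a = a) : ahLip (X := X) E b = ahLip F c := by
  funext f
  unfold ahLip
  congr 1
  refine iSup_congr fun n => ?_
  rcases le_total n N with hn | hn
  · rw [hEF n hn, hbc n hn]
  · have hE' : extendExp (E n) (f : C(X, A)) = f := ContinuousMap.ext fun x => hE n hn _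
    have hF' : extendExp (F n) (f : C(X, A)) = f := ContinuousMap.ext fun x => hF n hn _
    rw [hE', hF', sub_self, enorm_zero, ENNReal.zero_div, ENNReal.zero_div]

variable {X} in
/-- The retraction obtained from equal Lip-norms and a larger bound. -/
noncomputable def LipRetraction.mono {A B : Type u} [CStarAlgebra A] [CStarAlgebra B]
    {LA : selfAdjoint A → ℝ≥0∞} {LB LB' : selfAdjoint B → ℝ≥0∞} {ε δ : ℝ≥0∞}
    (ρ : LipRetraction LA LB ε) (hL : LB = LB') (hε : ε ≤ δ) : LipRetraction LA LB' δ where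
  incl := ρ.incl
  proj := ρ.proj
  proj_incl := ρ.proj_incl
  norm_proj_le := ρ.norm_proj_le
  proj_star := ρ.proj_star
  lip_incl b := (ρ.lip_incl b).trans (congrFun hL b)
  lip_proj a b h := (congrFun hL b).symm.trans_le (ρ.lip_proj a b h)
  enorm_sub_le a ha := (ρ.enorm_sub_le a ha).trans hε

/-- The common space is `C(X, M_k)` with `k = ⊠β(N)`. Agreement at the indices `j < N` suffices for
all the sizes up to and including `⊠(N)`, since `⊠(N)` omits the entry at `N`. -/
theorem exists_common_retraction [Nonempty X] {β η : BaireSeq} {N : ℕ}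
    (h : ∀ j < N, β j = η j) :
    ∃ M : LipPair.{u}, M.IsQCQMS 2 ∧
      Nonempty (LipRetraction (uhfFunPair X β (uhfExp β)).lip M.lip
        (ENNReal.ofReal ((2 : ℝ) ^ N)⁻¹)) ∧
      Nonempty (LipRetraction (uhfFunPair X η (uhfExp η)).lip M.lip
        (ENNReal.ofReal ((2 : ℝ) ^ N)⁻¹)) := by
  have hbox : ∀ n ≤ N, boxtimes β n = boxtimes η n := fun n hn =>
    boxtimes_eq_of_forall_lt fun j hj => h j (hj.trans_le hn)
  obtain ⟨ι, p, hp, hι, hle, hge⟩ := exists_matrix_compression β N _ rfl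
  obtain ⟨ι', p', hp', hι', hle', hge'⟩ := exists_matrix_compression η N _ (hbox N le_rfl).symm
  have hL : ahLip (X := X) (compress ι' p' (uhfExp η)) (fun n => 1 / (boxtimes η n : ℝ)) =
      ahLip (X := X) (compress ι p (uhfExp β)) fun n => 1 / (boxtimes β n : ℝ) := by
    refine ahLip_congr (fun n hn => ContinuousLinearMap.ext fun a => ?_)
      (fun n hn => by rw [hbox n hn]) hge' hge
    rw [hle n hn, hle' n hn]
    exact amplifyFun_blockTrace_congr (hbox n hn).symm _ _ a
  have hw : ∀ ξ : BaireSeq, ENNReal.ofReal (1 / (boxtimes ξ N : ℝ)) ≤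
      ENNReal.ofReal ((2 : ℝ) ^ N)⁻¹ := fun ξ =>
    ENNReal.ofReal_le_ofReal (one_div_boxtimes_le ξ N)
  have ρ : LipRetraction (uhfFunPair X β (uhfExp β)).lip _ _ :=
    ((condExpTower_uhfExp β).lipRetraction (X := X) hp hι).mono rfl (hw β)
  have σ : LipRetraction (uhfFunPair X η (uhfExp η)).lip _ _ :=
    ((condExpTower_uhfExp η).lipRetraction (X := X) hp' hι').mono hL (hw η)
  exact ⟨LipPair.mk _ _, ρ.isQCQMS (isTotallyBoundedLip_uhfFunPair X β)
    (isQuasiLeibniz_uhfFunPair X β), ⟨ρ⟩, ⟨σ⟩⟩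

theorem BaireSeq.exists_eq_of_ne {β η : BaireSeq} (h : β ≠ η) :
    ∃ N : ℕ, (∀ j < N, β j = η j) ∧ edist β η = ENNReal.ofReal ((2 : ℝ) ^ N)⁻¹ := by
  refine ⟨sInf {m : ℕ | β m ≠ η m}, fun j hj => ?_, ?_⟩
  · by_contra hne
    exact Nat.notMem_of_lt_sInf hj hne
  · rw [edist_dist]
    congr 1
    exact if_neg h

theorem qpropinquity_uhfFunPair_le [Nonempty X] (β η : BaireSeq) :
    qpropinquity 2 (uhfFunPair X β (uhfExp β)) (uhfFunPair X η (uhfExp η)) ≤ 2 * edist β η := by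
  by_cases hβη : β = η
  · subst hβη
    rw [qpropinquity_self (isQCQMS_uhfFunPair X β) (nonempty_stateSpace_uhfFunPair X β _)]
    exact zero_le
  -- `N` is the first index of disagreement, so each of the two bridges costs exactly `d(β, η)` at
  -- most.
  obtain ⟨N, hN, hd⟩ := BaireSeq.exists_eq_of_ne hβη
  obtain ⟨M, hM, ⟨ρ⟩, ⟨σ⟩⟩ := exists_common_retraction X hN
  rw [hd, two_mul]
  exact qpropinquity_le_of_retractions (isQCQMS_uhfFunPair X β) hM (isQCQMS_uhfFunPair X η) ρ σ
    (nonempty_stateSpace_uhfFunPair X β _) (nonempty_stateSpace_uhfFunPair X η _)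

/-- The same intermediate space serves: both retractions are precomposed with the isomorphisms `π`,
leaving their bounds unchanged. -/
theorem qpropinquity_uhfTensorPair_le [Nonempty X]
    (π : ∀ β : BaireSeq, CStarTensor C(X, ℂ) (UHF β) ≃⋆ₐ[ℂ] C(X, UHF β)) (β η : BaireSeq) :
    qpropinquity 2 (uhfTensorPair X β (uhfExp β) (π β)) (uhfTensorPair X η (uhfExp η) (π η)) ≤
      2 * edist β η := by
  by_cases hβη : β = η
  · subst hβη
    rw [qpropinquity_self (isQCQMS_uhfTensorPair X β (π β))
      (nonempty_stateSpace_uhfTensorPair X β _ _)]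
    exact zero_le
  obtain ⟨N, hN, hd⟩ := BaireSeq.exists_eq_of_ne hβη
  obtain ⟨M, hM, ⟨ρ⟩, ⟨σ⟩⟩ := exists_common_retraction X hN
  rw [hd, two_mul]
  exact qpropinquity_le_of_retractions (isQCQMS_uhfTensorPair X β (π β)) hM
    (isQCQMS_uhfTensorPair X η (π η)) (ρ.precompEquiv (π β)) (σ.precompEquiv (π η))
    (nonempty_stateSpace_uhfTensorPair X β _ _) (nonempty_stateSpace_uhfTensorPair X η _ _)

theorem tendsto_zero_of_le_two_mul_edist {Y : Type*} [PseudoEMetricSpace Y] {F : Y → Y → ℝ≥0∞}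
    (h : ∀ x y, F x y ≤ 2 * edist x y) (y : Y) :
    Filter.Tendsto (fun x => F x y) (𝓝 y) (𝓝 0) := by
  have h1 : Filter.Tendsto (fun x => 2 * edist x y) (𝓝 y) (𝓝 0) := by
    have h2 : Filter.Tendsto (fun x => edist x y) (𝓝 y) (𝓝 0) :=
      tendsto_iff_edist_tendsto_0.mp Filter.tendsto_id
    have h3 := ENNReal.Tendsto.const_mul (a := 2) h2 (Or.inr ENNReal.ofNat_ne_top)
    rwa [mul_zero] at h3
  exact tendsto_of_tendsto_of_tendsto_of_le_of_le tendsto_const_nhds h1 (fun _ => zero_le)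
    fun x => h x y

theorem theoremt (X : Type u) [MetricSpace X] [CompactSpace X] [Nonempty X] :
    ∃ (τ : ∀ β : BaireSeq, WeakDual ℂ (UHF β))
      (E : ∀ β : BaireSeq, ℕ → UHF β →L[ℂ] UHF β)
      (π : ∀ β : BaireSeq, CStarTensor C(X, ℂ) (UHF β) ≃⋆ₐ[ℂ] C(X, UHF β)),
      -- `τ β` is the unique tracial state of `UHF(β)`, and it is faithful
      (∀ β, IsTracialState (τ β) ∧ IsFaithfulState (τ β) ∧
        ∀ σ : WeakDual ℂ (UHF β), IsTracialState σ → σ = τ β) ∧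
      -- `E β n` is the unique trace preserving conditional expectation onto the `n`-th subalgebra
      (∀ β n, (IsCondExp (uhfSub β n) (E β n) ∧ ∀ a, τ β (E β n a) = τ β a) ∧
        ∀ F : UHF β →L[ℂ] UHF β,
          IsCondExp (uhfSub β n) F → (∀ a, τ β (F a) = τ β a) → F = E β n) ∧
      -- `π β` is the canonical isomorphism
      (∀ β (f : C(X, ℂ)) (a : UHF β) (x : X), π β (CStarTensor.tmul f a) x = f x • a) ∧
      -- the result for `C(X) ⊗ UHF(β)`
      ((∀ β, (uhfTensorPair X β (E β) (π β)).IsQCQMS 2) ∧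
        (∀ β η, qpropinquity 2 (uhfTensorPair X β (E β) (π β)) (uhfTensorPair X η (E η) (π η)) ≤
          2 * edist β η) ∧
        (∀ β, Filter.Tendsto (fun η => qpropinquity 2 (uhfTensorPair X η (E η) (π η))
          (uhfTensorPair X β (E β) (π β))) (𝓝 β) (𝓝 0))) ∧
      -- the result for `C(X, UHF(β))`
      ((∀ β, (uhfFunPair X β (E β)).IsQCQMS 2) ∧
        (∀ β η, qpropinquity 2 (uhfFunPair X β (E β)) (uhfFunPair X η (E η)) ≤
          2 * edist β η) ∧
        (∀ β, Filter.Tendsto (fun η => qpropinquity 2 (uhfFunPair X η (E η))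
          (uhfFunPair X β (E β))) (𝓝 β) (𝓝 0))) :=
  ⟨uhfTrace, uhfExp, tensorEquiv X,
    fun _ => ⟨isTracialState_uhfTrace, isFaithfulState_uhfTrace, fun _ => eq_uhfTrace⟩,
    fun _ n => ⟨⟨isCondExp_uhfExp n, uhfTrace_uhfExp n⟩, fun _ => eq_uhfExp⟩,
    fun β f a x => tensorEquiv_tmul X β f a x,
    ⟨fun β => isQCQMS_uhfTensorPair X β _,
      qpropinquity_uhfTensorPair_le X (tensorEquiv X),
      fun β => tendsto_zero_of_le_two_mul_edist
        (F := fun β η => qpropinquity 2 (uhfTensorPair X β (uhfExp β) (tensorEquiv X β))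
          (uhfTensorPair X η (uhfExp η) (tensorEquiv X η)))
        (qpropinquity_uhfTensorPair_le X (tensorEquiv X)) β⟩,
    ⟨isQCQMS_uhfFunPair X, qpropinquity_uhfFunPair_le X,
      fun β => tendsto_zero_of_le_two_mul_edist
        (F := fun β η => qpropinquity 2 (uhfFunPair X β (uhfExp β))
          (uhfFunPair X η (uhfExp η))) (qpropinquity_uhfFunPair_le X) β⟩⟩
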